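/- \textbf{Theorem (RAU under hyperrectangular uncertainty).} Let $P$ be a finite set of $n$ papers and $R$ a finite set of $m$ reviewers. Let $k_p\in\mathbb N$ ($p\in P$), $u_r\in\mathbb N$ ($r\in R$) and a set of conflicts $\mathcal C\subseteq P\times R$ be given. Let $\mathcal A$ be the set of matrices $A\in\{0,1\}^{P\times R}$ such that $A_{p,r}=0$ for $(p,r)\in\mathcal C$, $\sum_{r}A_{p,r}=k_p$ for every $p$, and $\sum_p A_{p,r}\le u_r$ for every $r$. Put $\mathrm{USW}(A,S)=\frac1n\sum_{p\in P}\sum_{r\in R}A_{p,r}S_{p,r}$ (read as $0$ if $n=0$). Let $\underline S,\bar S\in\mathbb R^{P\times R}$ satisfy $\underline S_{p,r}\le\bar S_{p,r}$ for all $p,r$, and let $\mathcal S_\Box=\{X\in\mathbb R^{P\times R}: \underline S_{p,r}\le X_{p,r}\le\bar S_{p,r}\ \forall p,r\}$. (1) The maximin-optimal assignments are exactly the maximisers of welfare for the lower scores: \[\operatorname*{argmax}_{A\in\mathcal A}\ \inf_{S\in\mathcal S_\Box}\mathrm{USW}(A,S)=\operatorname*{argmax}_{A\in\mathcal A}\ \mathrm{USW}(A,\underline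 S),\] where $\operatorname{argmax}$ denotes the set of all maximisers. (2) This problem reduces to a linear program. Let $Q$ be the set of matrices $X\in[0,1]^{P\times R}$ with $X_{p,r}=0$ for $(p,r)\in\mathcal C$, $\sum_rX_{p,r}=k_p$ for every $p$ and $\sum_pX_{p,r}\le u_r$ for every $r$. The constraint matrix of this system, whose rows are the coefficient vectors of the paper sums $\sum_rX_{p,r}$, of the reviewer sums $\sum_pX_{p,r}$ and of the single variables $X_{p,r}$, is totally unimodular, and the sets in (1) are equal to the set of those vertices (extreme points) of the polytope $Q$ that maximise $\mathrm{USW}(X,\underline S)$ over $Q$. (3) RAU with a hyperrectangular uncertainty set is solvable in polynomial time: there are one algorithm (a program for a random access machine with integer cells and the operations $+,-,\times$, sign tests, and indirect addressing, under the logarithmic cost criterion, i.e. every operation is charged the bit lengths of the integers and addresses it handles) and one polynomial $f$ such that, for all $n,m$, $k$, $u$, $\mathcal C$ and all rational $\underline S\le\bar S$ in $\mathbb Q^{n\times m}$ (numerators and denominators written in binary), the algorithm halts after time at most $f(\text{bit size of the input})$ and outputs an element of $\operatorname{argmax}_{A\in\mathcal A}\inf_{S\in\mathcal S_\Box}\mathrm{USW}(A,S)$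 if $\mathcal A\ne\emptyset$, and reports infeasibility if $\mathcal A=\emptyset$. -/

import Mathlib

open scoped BigOperators

/-! ## Reviewer assignment under uncertainty -/

/-- The hard constraints of a reviewer assignment problem with paper set `P` and reviewer set `R`:
paper `p` needs exactly `coverage p` reviewers, reviewer `r` takes at most `load r` papers, and
`(p, r) ∈ conflicts` forbids assigning `r` to `p`. -/
structure AssignmentConstraints (P R : Type*) where
  coverage : P → ℕ
  load : R → ℕ
  conflicts : Set (P × R)

/-- The permissible assignments: `0/1` matrices that respect the conflicts of interest, the paper
coverage requirements and the reviewer load bounds. -/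
def AssignmentConstraints.permissible {P R : Type*} [Fintype P] [Fintype R]
    (K : AssignmentConstraints P R) : Set (Matrix P R ℝ) :=
  {A | (∀ p r, A p r = 0 ∨ A p r = 1) ∧
       (∀ p r, (p, r) ∈ K.conflicts → A p r = 0) ∧
       (∀ p, ∑ r, A p r = (K.coverage p : ℝ)) ∧
       (∀ r, ∑ p, A p r ≤ (K.load r : ℝ))}

/-- Utilitarian social welfare `(1/n) ∑ₚ ∑ᵣ A p r * S p r`, where `n` is the number of papers. -/
noncomputable def USW {P R : Type*} [Fintype P] [Fintype R] (A S : Matrix P R ℝ) : ℝ :=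
  (1 / (Fintype.card P : ℝ)) * ∑ p, ∑ r, A p r * S p r

/-- The infimum of the welfare of `A` over the uncertainty set `𝒮`, in the extended reals. -/
noncomputable def worstCaseUSW {P R : Type*} [Fintype P] [Fintype R]
    (𝒮 : Set (Matrix P R ℝ)) (A : Matrix P R ℝ) : EReal :=
  ⨅ S ∈ 𝒮, (USW A S : EReal)

/-- The set of all maximisers of `f` over `s`. -/
def argmaxOn {α β : Type*} [Preorder β] (s : Set α) (f : α → β) : Set α :=
  {a | a ∈ s ∧ ∀ b ∈ s, f b ≤ f a}

/-- The maximin-optimal assignments for the feasible set `𝒜` and the uncertainty set `𝒮`. -/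
noncomputable def maximinAssignments {P R : Type*} [Fintype P] [Fintype R]
    (𝒜 𝒮 : Set (Matrix P R ℝ)) : Set (Matrix P R ℝ) :=
  argmaxOn 𝒜 (worstCaseUSW 𝒮)

/-- The axis-aligned hyperrectangle with lower corner `L` and upper corner `U`. -/
def boxUncertainty {P R : Type*} (L U : Matrix P R ℝ) : Set (Matrix P R ℝ) :=
  {X | ∀ p r, L p r ≤ X p r ∧ X p r ≤ U p r}

/-! ## The assignment linear program -/

/-- The constraint matrix of the assignment linear program in the variables `x (p, r)`: a row of
coefficients of `∑ᵣ x (p, r)` for each paper `p`, one of `∑ₚ x (p, r)` for each reviewer `r`, and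
one of the single variable `x (p, r)` for each pair. -/
def assignmentMatrix (P R : Type*) [DecidableEq P] [DecidableEq R] :
    Matrix ((P ⊕ R) ⊕ (P × R)) (P × R) ℝ :=
  Matrix.fromRows
    (Matrix.of fun i q =>
      match i with
      | Sum.inl p => if q.1 = p then 1 else 0
      | Sum.inr r => if q.2 = r then 1 else 0)
    1

/-- The feasible polytope of the assignment linear program, i.e. the permissible assignments with
the integrality requirement relaxed to `0 ≤ X p r ≤ 1`. -/
def AssignmentConstraints.relaxation {P R : Type*} [Fintype P] [Fintype R]
    [DecidableEq P] [DecidableEq R] (K : AssignmentConstraints P R) : Set (Matrix P R ℝ) :=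
  {X | let y := (assignmentMatrix P R).mulVec (fun q => X q.1 q.2)
       (∀ p, y (Sum.inl (Sum.inl p)) = (K.coverage p : ℝ)) ∧
       (∀ r, y (Sum.inl (Sum.inr r)) ≤ (K.load r : ℝ)) ∧
       (∀ q, 0 ≤ y (Sum.inr q) ∧ y (Sum.inr q) ≤ 1) ∧
       (∀ q ∈ K.conflicts, y (Sum.inr q) = 0)}

/-! ## A machine model with bit cost

Programs of a small imperative language, i.e. a random access machine with integer cells. The cells
are arranged in two-dimensional arrays, and every operation is charged the bit lengths of
the integers (addresses included) that it handles: the logarithmic cost criterion, which is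
polynomially equivalent to the running time of Turing machines. -/

/-- `σ a i j` is the content of cell `(i, j)` of array number `a`. -/
abbrev Store : Type := ℕ → ℤ → ℤ → ℤ

/-- The number of binary digits of `|z|`. -/
def bitLength (z : ℤ) : ℕ := z.natAbs.size

/-- Integer expressions; `cell a i j` reads cell `(i, j)` of array `a`. -/
inductive IntExpr : Type
  | const (c : ℤ)
  | cell (a : ℕ) (i j : IntExpr)
  | add (e₁ e₂ : IntExpr)
  | sub (e₁ e₂ : IntExpr)
  | mul (e₁ e₂ : IntExpr)

/-- The value of an expression. -/
def IntExpr.val (σ : Store) : IntExpr → ℤ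
  | const c => c
  | cell a i j => σ a (i.val σ) (j.val σ)
  | add e₁ e₂ => e₁.val σ + e₂.val σ
  | sub e₁ e₂ => e₁.val σ - e₂.val σ
  | mul e₁ e₂ => e₁.val σ * e₂.val σ

/-- The bit cost of evaluating an expression. -/
def IntExpr.cost (σ : Store) : IntExpr → ℕ
  | const c => 1 + bitLength c
  | cell a i j => i.cost σ + j.cost σ + 1 + bitLength (i.val σ) + bitLength (j.val σ)
      + bitLength (σ a (i.val σ) (j.val σ))
  | add e₁ e₂ => e₁.cost σ + e₂.cost σ + 1 + bitLength (e₁.val σ) + bitLength (e₂.val σ)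
  | sub e₁ e₂ => e₁.cost σ + e₂.cost σ + 1 + bitLength (e₁.val σ) + bitLength (e₂.val σ)
  | mul e₁ e₂ => e₁.cost σ + e₂.cost σ + 1 + bitLength (e₁.val σ) + bitLength (e₂.val σ)

/-- Programs: `write a i j e` stores the value of `e` in cell `(i, j)` of array `a`; `ifPos` and
`whilePos` test whether the value of an expression is positive. -/
inductive Prog : Type
  | skip
  | write (a : ℕ) (i j e : IntExpr)
  | seq (c₁ c₂ : Prog)
  | ifPos (e : IntExpr) (c₁ c₂ : Prog)
  | whilePos (e : IntExpr) (c : Prog)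

/-- The store with cell `(i, j)` of array `a` replaced by `v`. -/
def Store.set (σ : Store) (a : ℕ) (i j v : ℤ) : Store :=
  fun a' i' j' => if a' = a ∧ i' = i ∧ j' = j then v else σ a' i' j'

/-- `Exec c σ t τ`: the program `c`, started in the store `σ`, halts in the store `τ` after a run
of total bit cost `t`. -/
inductive Exec : Prog → Store → ℕ → Store → Prop
  | skip (σ : Store) : Exec Prog.skip σ 1 σ
  | write (σ : Store) (a : ℕ) (i j e : IntExpr) :
      Exec (Prog.write a i j e) σ
        (i.cost σ + j.cost σ + e.cost σ + 1 + bitLength (i.val σ) + bitLength (j.val σ)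
          + bitLength (e.val σ))
        (σ.set a (i.val σ) (j.val σ) (e.val σ))
  | seq {c₁ c₂ : Prog} {σ ρ τ : Store} {s t : ℕ} (h₁ : Exec c₁ σ s ρ) (h₂ : Exec c₂ ρ t τ) :
      Exec (Prog.seq c₁ c₂) σ (s + t) τ
  | ifTrue {e : IntExpr} {c₁ c₂ : Prog} {σ τ : Store} {t : ℕ} (he : 0 < e.val σ)
      (h : Exec c₁ σ t τ) :
      Exec (Prog.ifPos e c₁ c₂) σ (e.cost σ + 1 + bitLength (e.val σ) + t) τ
  | ifFalse {e : IntExpr} {c₁ c₂ : Prog} {σ τ : Store} {t : ℕ} (he : ¬ 0 < e.val σ)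
      (h : Exec c₂ σ t τ) :
      Exec (Prog.ifPos e c₁ c₂) σ (e.cost σ + 1 + bitLength (e.val σ) + t) τ
  | whileTrue {e : IntExpr} {c : Prog} {σ ρ τ : Store} {s t : ℕ} (he : 0 < e.val σ)
      (h₁ : Exec c σ s ρ) (h₂ : Exec (Prog.whilePos e c) ρ t τ) :
      Exec (Prog.whilePos e c) σ (e.cost σ + 1 + bitLength (e.val σ) + s + t) τ
  | whileFalse {e : IntExpr} {c : Prog} {σ : Store} (he : ¬ 0 < e.val σ) :
      Exec (Prog.whilePos e c) σ (e.cost σ + 1 + bitLength (e.val σ)) σ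

/-- A search problem, with instances `x` of bit size `size x` that are presented to the machine as
the store `input x` and whose correct final stores are described by `Correct x`, is solvable in
polynomial time: one program halts on every instance with a correct final store, at a cost bounded
by a fixed polynomial in the size of the instance. -/
def SolvableInPolyTime {ι : Type*} (size : ι → ℕ) (input : ι → Store)
    (Correct : ι → Store → Prop) : Prop :=
  ∃ (c : Prog) (f : Polynomial ℕ), ∀ x : ι, ∃ (t : ℕ) (τ : Store),
    Exec c (input x) t τ ∧ t ≤ f.eval (size x) ∧ Correct x τ

/-! ## The computational problem -/

/-- An instance of the computational problem: `n` papers, `m` reviewers, hard constraints, and a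
nonempty box given by rational lower and upper scores. -/
structure BoxInstance where
  n : ℕ
  m : ℕ
  constraints : AssignmentConstraints (Fin n) (Fin m)
  lower : Matrix (Fin n) (Fin m) ℚ
  upper : Matrix (Fin n) (Fin m) ℚ
  lower_le_upper : ∀ p r, lower p r ≤ upper p r

/-- The array with the entries of an `n × m` table in the cells `(i, j)`, `0 ≤ i < n`, `0 ≤ j < m`,
and `0` in every other cell. -/
def tableArray {n m : ℕ} (f : Fin n → Fin m → ℤ) : ℤ → ℤ → ℤ := fun i j =>
  if h : (0 ≤ i ∧ i.toNat < n) ∧ (0 ≤ j ∧ j.toNat < m) then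
    f ⟨i.toNat, h.1.2⟩ ⟨j.toNat, h.2.2⟩
  else 0

open Classical in
/-- The input store: numbers of papers and reviewers in cell `(0, 0)` of arrays `0` and `1`,
coverage requirements and load bounds in column `0` of arrays `2` and `3`, indicators of conflicts
in array `4`, numerators and denominators of the lower scores in arrays `5` and `6` and of the upper
scores in arrays `7` and `8`; every other cell is `0`. -/
noncomputable def BoxInstance.input (I : BoxInstance) : Store
  | 0 => tableArray fun (_ _ : Fin 1) => (I.n : ℤ)
  | 1 => tableArray fun (_ _ : Fin 1) => (I.m : ℤ)
  | 2 => tableArray fun p (_ : Fin 1) => (I.constraints.coverage p : ℤ)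
  | 3 => tableArray fun r (_ : Fin 1) => (I.constraints.load r : ℤ)
  | 4 => tableArray fun p r => if (p, r) ∈ I.constraints.conflicts then 1 else 0
  | 5 => tableArray fun p r => (I.lower p r).num
  | 6 => tableArray fun p r => ((I.lower p r).den : ℤ)
  | 7 => tableArray fun p r => (I.upper p r).num
  | 8 => tableArray fun p r => ((I.upper p r).den : ℤ)
  | _ => fun _ _ => 0

/-- The bit size of an instance. -/
def BoxInstance.size (I : BoxInstance) : ℕ :=
  bitLength I.n + bitLength I.m
    + ∑ p, (1 + bitLength (I.constraints.coverage p))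
    + ∑ r, (1 + bitLength (I.constraints.load r))
    + ∑ p, ∑ r, (1 + bitLength (I.lower p r).num + bitLength ((I.lower p r).den : ℤ)
        + bitLength (I.upper p r).num + bitLength ((I.upper p r).den : ℤ))

/-- The final store `τ` answers the instance: if there are permissible assignments, then cell
`(0, 0)` of array `9` holds `1` and array `10` holds a maximin-optimal assignment for the box; if
there are none, then cell `(0, 0)` of array `9` holds `0`. -/
def BoxInstance.Correct (I : BoxInstance) (τ : Store) : Prop :=
  (I.constraints.permissible.Nonempty →
    τ 9 0 0 = 1 ∧
    (Matrix.of fun (p : Fin I.n) (r : Fin I.m) => ((τ 10 (p : ℕ) (r : ℕ) : ℤ) : ℝ)) ∈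
      maximinAssignments I.constraints.permissible
        (boxUncertainty (I.lower.map (fun x : ℚ => (x : ℝ)))
          (I.upper.map (fun x : ℚ => (x : ℝ))))) ∧
  (¬ I.constraints.permissible.Nonempty → τ 9 0 0 = 0)

/-! ## A program logic for the machine -/

/-! For the box, entries of an assignment are nonnegative, so welfare is monotone in the scores and
its infimum is attained at the lower corner (`worstCaseUSW_box`).

For the polytope, a square minor of the bipartite incidence matrix either has a column with at most
one nonzero entry, along which it is expanded, or is singular because its paper rows and its
reviewer rows have the same sum. Integrality of vertices is not derived from total unimodularity: a
dimension count (`exists_direction`) shows that a fractional point can be moved both ways inside the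
polytope. A linear functional on a compact polytope is maximal at some vertex, which gives
`argmaxOn_permissible_eq`.

For the algorithm, an assignment is a circulation hub → paper → reviewer → hub, where the arc from a
paper to a reviewer has unit capacity and costs minus the shifted score. These arcs are inserted one
at a time while potentials with nonnegative reduced costs on all residual arcs are maintained. If a
new arc from `p₀` to `r₀` violates its inequality, a tree of tight arcs is grown from `r₀` and the
potentials off the tree are raised. Either the violation disappears, or `p₀` joins the tree and one
unit is sent around the cycle closed by the new arc, which saturates it (`Growing`, `Tracing`,
`Runs.insertArc`). Final potentials certify optimality by weak duality (`Residual.optimal`). The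
shift of the scores exceeds the sum of their absolute values, so covering more demand outweighs any
loss of score; hence unmet demand remains exactly when no permissible assignment exists
(`Residual.solves`).

For the running time, `Runs` separates the number of elementary steps from the bit length of the
cells. One insertion turns a bound `B` on the potentials into `2 * B + W`, where `W` bounds the
costs; after `n * m` insertions the potentials may be exponentially large, but their bit length is
still linear in the input size. -/

theorem bitLength_le_iff {z : ℤ} {b : ℕ} : bitLength z ≤ b ↔ |z| < 2 ^ b := by
  unfold bitLength
  rw [Nat.size_le, Int.abs_eq_natAbs]
  exact_mod_cast Iff.rfl

theorem abs_lt_two_pow_bitLength (z : ℤ) : |z| < 2 ^ bitLength z :=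
  bitLength_le_iff.1 le_rfl

theorem bitLength_mul_le (x y : ℤ) : bitLength (x * y) ≤ bitLength x + bitLength y := by
  rw [bitLength_le_iff, abs_mul, pow_add]
  exact mul_lt_mul'' (abs_lt_two_pow_bitLength x) (abs_lt_two_pow_bitLength y) (abs_nonneg _)
    (abs_nonneg _)

theorem bitLength_neg (x : ℤ) : bitLength (-x) = bitLength x := by simp [bitLength]

theorem bitLength_add_le (x y : ℤ) : bitLength (x + y) ≤ bitLength x + bitLength y + 1 := by
  rw [bitLength_le_iff]
  have hx := abs_lt_two_pow_bitLength x
  have hy := abs_lt_two_pow_bitLength y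
  have h1 : (2 : ℤ) ^ bitLength x ≤ 2 ^ (bitLength x + bitLength y) :=
    pow_le_pow_right₀ (by norm_num) (by omega)
  have h2 : (2 : ℤ) ^ bitLength y ≤ 2 ^ (bitLength x + bitLength y) :=
    pow_le_pow_right₀ (by norm_num) (by omega)
  calc |x + y| ≤ |x| + |y| := abs_add_le _ _
    _ < 2 ^ (bitLength x + bitLength y + 1) := by rw [pow_succ]; linarith

theorem bitLength_sub_le (x y : ℤ) : bitLength (x - y) ≤ bitLength x + bitLength y + 1 := by
  have := bitLength_add_le x (-y)
  rwa [bitLength_neg, ← sub_eq_add_neg] at this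

/-- All cells hold integers of bit length at most `b`. -/
def Store.Bdd (b : ℕ) (σ : Store) : Prop := ∀ a i j, |σ a i j| < 2 ^ b

theorem Store.Bdd.set {b : ℕ} {σ : Store} (h : σ.Bdd b) {a : ℕ} {i j v : ℤ} (hv : |v| < 2 ^ b) :
    (σ.set a i j v).Bdd b := by
  intro a' i' j'
  unfold Store.set
  split_ifs
  exacts [hv, h _ _ _]

theorem Store.set_of_ne {σ : Store} {a a' : ℕ} {i j v : ℤ} (h : a' ≠ a) :
    σ.set a i j v a' = σ a' := by
  funext i' j'
  simp [Store.set, h]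

theorem Store.set_same (σ : Store) (a : ℕ) (i j v : ℤ) : σ.set a i j v a i j = v := by
  simp [Store.set]

/-- A factor relating the cost of an expression to the bit length of the cells. -/
def IntExpr.weight : IntExpr → ℕ
  | const c => 1 + bitLength c
  | cell _ i j => 2 * i.weight + 2 * j.weight + 1
  | add e₁ e₂ => 2 * e₁.weight + 2 * e₂.weight + 1
  | sub e₁ e₂ => 2 * e₁.weight + 2 * e₂.weight + 1
  | mul e₁ e₂ => 2 * e₁.weight + 2 * e₂.weight + 1

/-- An operation at most adds the bit lengths of its arguments, plus one, and the expression is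
fixed in advance. Intermediate values therefore need no bound of their own; only values that are
written do. -/
theorem IntExpr.cost_le {b : ℕ} {σ : Store} (h : σ.Bdd b) (e : IntExpr) :
    e.cost σ ≤ e.weight * (b + 1) ∧ bitLength (e.val σ) ≤ e.weight * (b + 1) := by
  induction e with
  | const c =>
    simp only [cost, val, weight]
    constructor <;> nlinarith [Nat.zero_le (bitLength c), Nat.zero_le b]
  | cell a i j hi hj =>
    simp only [cost, val, weight]
    have := bitLength_le_iff.2 (h a (i.val σ) (j.val σ))
    constructor <;> nlinarith
  | add e₁ e₂ h₁ h₂ =>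
    simp only [cost, val, weight]
    have := bitLength_add_le (e₁.val σ) (e₂.val σ)
    constructor <;> nlinarith
  | sub e₁ e₂ h₁ h₂ =>
    simp only [cost, val, weight]
    have := bitLength_sub_le (e₁.val σ) (e₂.val σ)
    constructor <;> nlinarith
  | mul e₁ e₂ h₁ h₂ =>
    simp only [cost, val, weight]
    have := bitLength_mul_le (e₁.val σ) (e₂.val σ)
    constructor <;> nlinarith

/-- A factor relating the cost of one step of a program to the bit length of the cells. -/
def Prog.weight : Prog → ℕ
  | skip => 1
  | write _ i j e => 2 * i.weight + 2 * j.weight + 2 * e.weight + 1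
  | seq c₁ c₂ => c₁.weight + c₂.weight
  | ifPos e c₁ c₂ => 2 * e.weight + 1 + c₁.weight + c₂.weight
  | whilePos e c => 2 * e.weight + 1 + c.weight

/-- If the cells of `σ` have bit length at most `b`, then so have those of all stores in the run of
`c` from `σ`, the run has at most `s` elementary steps, and its final store satisfies `Q`. -/
def Runs (b : ℕ) (c : Prog) (σ : Store) (s : ℕ) (Q : Store → Prop) : Prop :=
  σ.Bdd b → ∃ t τ, Exec c σ t τ ∧ t ≤ c.weight * ((b + 1) * s) ∧ τ.Bdd b ∧ Q τ

namespace Runs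

variable {b s t : ℕ} {σ : Store} {Q Q' : Store → Prop} {c c₁ c₂ : Prog} {e : IntExpr}

theorem mono (h : Runs b c σ s Q) (hs : s ≤ t) (hQ : ∀ τ, Q τ → Q' τ) : Runs b c σ t Q' := by
  intro hb
  obtain ⟨r, τ, h1, h2, h3, h4⟩ := h hb
  exact ⟨r, τ, h1, h2.trans (by gcongr), h3, hQ _ h4⟩

theorem skip (h : Q σ) : Runs b Prog.skip σ 1 Q := by
  intro hb
  exact ⟨1, σ, Exec.skip σ, by simp [Prog.weight], hb, h⟩

theorem write {a : ℕ} {i j : IntExpr} (hv : |e.val σ| < 2 ^ b)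
    (h : Q (σ.set a (i.val σ) (j.val σ) (e.val σ))) : Runs b (Prog.write a i j e) σ 1 Q := by
  intro hb
  refine ⟨_, _, Exec.write σ a i j e, ?_, hb.set hv, h⟩
  have h1 := i.cost_le hb
  have h2 := j.cost_le hb
  have h3 := e.cost_le hb
  simp only [Prog.weight]
  nlinarith

theorem seq (h : Runs b c₁ σ s fun ρ => Runs b c₂ ρ t Q) :
    Runs b (Prog.seq c₁ c₂) σ (s + t) Q := by
  intro hb
  obtain ⟨r, ρ, h1, h2, h3, h4⟩ := h hb
  obtain ⟨r', τ, h1', h2', h3', h4'⟩ := h4 h3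
  refine ⟨_, τ, Exec.seq h1 h1', ?_, h3', h4'⟩
  simp only [Prog.weight]
  calc r + r' ≤ c₁.weight * ((b + 1) * s) + c₂.weight * ((b + 1) * t) := add_le_add h2 h2'
    _ ≤ c₁.weight * ((b + 1) * (s + t)) + c₂.weight * ((b + 1) * (s + t)) := by gcongr <;> omega
    _ = _ := by ring

theorem ifPos (h₁ : 0 < e.val σ → Runs b c₁ σ s Q) (h₂ : ¬ 0 < e.val σ → Runs b c₂ σ s Q) :
    Runs b (Prog.ifPos e c₁ c₂) σ (s + 1) Q := by
  intro hb
  have he := e.cost_le hb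
  by_cases h : 0 < e.val σ
  · obtain ⟨r, τ, h1, h2, h3, h4⟩ := h₁ h hb
    refine ⟨_, τ, Exec.ifTrue h h1, ?_, h3, h4⟩
    simp only [Prog.weight]
    calc _ ≤ e.weight * (b + 1) + 1 + e.weight * (b + 1) + c₁.weight * ((b + 1) * s) := by omega
      _ ≤ _ := by
        have : 0 ≤ (b + 1) * s * (2 * e.weight + 1) := by positivity
        have : 0 ≤ (b + 1) * (s + 1) * c₂.weight := by positivity
        nlinarith [Nat.zero_le (b * c₁.weight)]
  · obtain ⟨r, τ, h1, h2, h3, h4⟩ := h₂ h hb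
    refine ⟨_, τ, Exec.ifFalse h h1, ?_, h3, h4⟩
    simp only [Prog.weight]
    calc _ ≤ e.weight * (b + 1) + 1 + e.weight * (b + 1) + c₂.weight * ((b + 1) * s) := by omega
      _ ≤ _ := by
        have : 0 ≤ (b + 1) * s * (2 * e.weight + 1) := by positivity
        have : 0 ≤ (b + 1) * (s + 1) * c₁.weight := by positivity
        nlinarith [Nat.zero_le (b * c₂.weight)]

/-- The index of `Inv` is fuel: each execution of the body consumes one unit, so with no fuel left
the guard cannot be positive. -/
theorem whilePos (Inv : ℕ → Store → Prop)
    (hbody : ∀ k ρ, Inv k ρ → 0 < e.val ρ → ∃ k', k = k' + 1 ∧ Runs b c ρ s (Inv k'))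
    (hend : ∀ k ρ, Inv k ρ → ¬ 0 < e.val ρ → Q ρ) :
    ∀ k σ, Inv k σ → Runs b (Prog.whilePos e c) σ (k * (s + 1) + 1) Q := by
  intro k
  induction k with
  | zero =>
    intro σ h hb
    by_cases he : 0 < e.val σ
    · obtain ⟨k', hk', -⟩ := hbody 0 σ h he
      omega
    · refine ⟨_, σ, Exec.whileFalse he, ?_, hb, hend _ _ h he⟩
      have he := e.cost_le hb
      simp only [Prog.weight]
      nlinarith [Nat.zero_le (b * c.weight), Nat.zero_le c.weight]
  | succ k ih =>
    intro σ h hb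
    have hc := e.cost_le hb
    by_cases he : 0 < e.val σ
    · obtain ⟨k', hk', hr⟩ := hbody _ σ h he
      obtain rfl : k = k' := by omega
      obtain ⟨r, ρ, h1, h2, h3, h4⟩ := hr hb
      obtain ⟨r', τ, h1', h2', h3', h4'⟩ := ih ρ h4 h3
      refine ⟨_, τ, Exec.whileTrue he h1 h1', ?_, h3', h4'⟩
      simp only [Prog.weight] at h2' ⊢
      calc _ ≤ e.weight * (b + 1) + 1 + e.weight * (b + 1) + c.weight * ((b + 1) * s)
            + (2 * e.weight + 1 + c.weight) * ((b + 1) * (k * (s + 1) + 1)) := by omega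
        _ ≤ (2 * e.weight + 1 + c.weight) * ((b + 1) * (s + 1))
            + (2 * e.weight + 1 + c.weight) * ((b + 1) * (k * (s + 1) + 1)) := by
          gcongr
          have : 0 ≤ (b + 1) * s * (2 * e.weight + 1) := by positivity
          nlinarith [Nat.zero_le (b * c.weight)]
        _ = _ := by ring
    · refine ⟨_, σ, Exec.whileFalse he, ?_, hb, hend _ _ h he⟩
      simp only [Prog.weight]
      calc _ ≤ (2 * e.weight + 1 + c.weight) * ((b + 1) * 1) := by
            nlinarith [Nat.zero_le (b * c.weight), Nat.zero_le c.weight]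
        _ ≤ _ := by gcongr; omega

end Runs

/-- The scalar variable stored in cell `(0, 0)` of array `a`. -/
abbrev IntExpr.var (a : ℕ) : IntExpr := .cell a (.const 0) (.const 0)

/-- Assignment to a scalar variable. -/
abbrev Prog.assign (a : ℕ) (e : IntExpr) : Prog := .write a (.const 0) (.const 0) e

/-- `for x = 0, …, e - 1 do c`. -/
def Prog.forRange (x : ℕ) (e : IntExpr) (c : Prog) : Prog :=
  .seq (.assign x (.const 0))
    (.whilePos (.sub e (.var x)) (.seq c (.assign x (.add (.var x) (.const 1)))))

theorem Runs.assign {b a : ℕ} {σ : Store} {Q : Store → Prop} {e : IntExpr}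
    (hv : |e.val σ| < 2 ^ b) (h : Q (σ.set a 0 0 (e.val σ))) : Runs b (Prog.assign a e) σ 1 Q :=
  Runs.write hv h

/-- The invariant counts completed rounds and may not depend on the counter cell, because the
counter is reset before the loop and incremented outside the body. The body has to return the
counter unchanged. -/
theorem Runs.forRange {b s x M : ℕ} {σ : Store} {c : Prog} {e : IntExpr}
    (Inv : ℕ → Store → Prop) (hM : (M : ℤ) < 2 ^ b) (h0 : Inv 0 σ)
    (hstable : ∀ k ρ v, Inv k ρ → Inv k (ρ.set x 0 0 v))
    (hval : ∀ k ρ, Inv k ρ → e.val ρ = M)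
    (hbody : ∀ k ρ, k < M → Inv k ρ → ρ x 0 0 = k →
      Runs b c ρ s fun τ => τ x 0 0 = k ∧ Inv (k + 1) τ) :
    Runs b (Prog.forRange x e c) σ (M * (s + 2) + 2) (Inv M) := by
  have hw := Runs.whilePos (b := b) (s := s + 1) (e := .sub e (.var x))
    (c := .seq c (.assign x (.add (.var x) (.const 1)))) (Q := Inv M)
    -- Fuel counts the rounds still to come, so the loop invariant is read at `M - k`.
    (fun k ρ => k ≤ M ∧ Inv (M - k) ρ ∧ ρ x 0 0 = ((M - k : ℕ) : ℤ))
    (by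
      rintro k ρ ⟨hk, hI, hx⟩ hpos
      have hv := hval _ _ hI
      simp only [IntExpr.val] at hpos
      rw [hv, hx] at hpos
      obtain ⟨k', rfl⟩ : ∃ k', k = k' + 1 := ⟨k - 1, by omega⟩
      refine ⟨k', rfl, Runs.seq ((hbody _ ρ (by omega) hI hx).mono le_rfl ?_)⟩
      rintro τ ⟨hτ, hIτ⟩
      have hk' : M - (k' + 1) + 1 = M - k' := by omega
      have hk2 : ((M - (k' + 1) : ℕ) : ℤ) + 1 = ((M - k' : ℕ) : ℤ) := by omega
      refine Runs.assign ?_ ?_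
      · simp only [IntExpr.val, hτ, hk2]
        rw [abs_of_nonneg (by positivity)]
        have : ((M - k' : ℕ) : ℤ) ≤ M := by omega
        omega
      · simp only [IntExpr.val, hτ, hk2]
        exact ⟨by omega, hk' ▸ hstable _ _ _ hIτ, Store.set_same _ _ _ _ _⟩)
    (by
      rintro k ρ ⟨hk, hI, hx⟩ hneg
      have hv := hval _ _ hI
      simp only [IntExpr.val] at hneg
      rw [hv, hx] at hneg
      obtain rfl : k = 0 := by omega
      simpa using hI)
  unfold Prog.forRange
  refine (Runs.seq (s := 1) (t := M * (s + 2) + 1) ?_).mono (by omega) fun _ h => h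
  refine Runs.assign (by simp [IntExpr.val]) ?_
  simp only [IntExpr.val]
  exact hw M _ ⟨le_rfl, by simpa using hstable _ _ _ h0, by simp [Store.set_same]⟩

/-! ## The worst case over a box -/

theorem USW_mono_right {P R : Type*} [Fintype P] [Fintype R] {A S T : Matrix P R ℝ}
    (hA : ∀ p r, 0 ≤ A p r) (h : ∀ p r, S p r ≤ T p r) : USW A S ≤ USW A T := by
  unfold USW
  refine mul_le_mul_of_nonneg_left ?_ (by positivity)
  exact Finset.sum_le_sum fun p _ => Finset.sum_le_sum fun r _ =>
    mul_le_mul_of_nonneg_left (h p r) (hA p r)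

theorem AssignmentConstraints.permissible_nonneg {P R : Type*} [Fintype P] [Fintype R]
    {K : AssignmentConstraints P R} {A : Matrix P R ℝ} (hA : A ∈ K.permissible) (p : P) (r : R) :
    0 ≤ A p r := by
  rcases hA.1 p r with h | h <;> simp [h]

/-- The lower corner belongs to the box because of `hLU`, and monotonicity in the scores makes it a
minimiser. -/
theorem worstCaseUSW_box {P R : Type*} [Fintype P] [Fintype R] {A L U : Matrix P R ℝ}
    (hA : ∀ p r, 0 ≤ A p r) (hLU : ∀ p r, L p r ≤ U p r) :
    worstCaseUSW (boxUncertainty L U) A = (USW A L : EReal) := by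
  refine le_antisymm (iInf₂_le L fun p r => ⟨le_rfl, hLU p r⟩) (le_iInf₂ fun S hS => ?_)
  exact_mod_cast USW_mono_right hA fun p r => (hS p r).1

theorem maximinAssignments_box {P R : Type*} [Fintype P] [Fintype R]
    (K : AssignmentConstraints P R) {L U : Matrix P R ℝ} (hLU : ∀ p r, L p r ≤ U p r) :
    maximinAssignments K.permissible (boxUncertainty L U)
      = argmaxOn K.permissible (fun A => USW A L) := by
  ext A
  refine and_congr_right fun hA => forall₂_congr fun B hB => ?_
  rw [worstCaseUSW_box (K.permissible_nonneg hA) hLU, worstCaseUSW_box (K.permissible_nonneg hB) hLU]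
  exact EReal.coe_le_coe_iff

/-! ## Total unimodularity -/

/-- The vertex-edge incidence matrix of the complete bipartite graph on `P` and `R`. -/
def bipartiteIncidence (P R : Type*) [DecidableEq P] [DecidableEq R] :
    Matrix (P ⊕ R) (P × R) ℝ :=
  Matrix.of fun i q =>
    match i with
    | Sum.inl p => if q.1 = p then 1 else 0
    | Sum.inr r => if q.2 = r then 1 else 0

section
variable {P R : Type*} [DecidableEq P] [DecidableEq R]

theorem bipartiteIncidence_apply (i : P ⊕ R) (q : P × R) :
    bipartiteIncidence P R i q = if i = Sum.inl q.1 ∨ i = Sum.inr q.2 then 1 else 0 := by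
  rcases i with p | r <;> simp [bipartiteIncidence, eq_comm]

/-- Every column of the minor has one paper row and one reviewer row, so signing paper rows by `1`
and reviewer rows by `-1` gives a vanishing combination of the rows. -/
theorem bipartiteIncidence_det_eq_zero {k : ℕ} [NeZero k] {f : Fin k → P ⊕ R} {g : Fin k → P × R}
    (hf : Function.Injective f) (hl : ∀ j, ∃ i, f i = Sum.inl (g j).1)
    (hr : ∀ j, ∃ i, f i = Sum.inr (g j).2) :
    ((bipartiteIncidence P R).submatrix f g).det = 0 := by
  refine Matrix.exists_vecMul_eq_zero_iff.1
    ⟨fun i => Sum.elim (fun _ => 1) (fun _ => -1) (f i), fun h => ?_, ?_⟩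
  · have := congrFun h 0
    rcases hfi : f 0 with p | r <;> simp [hfi] at this
  · funext j
    obtain ⟨i₁, h₁⟩ := hl j
    obtain ⟨i₂, h₂⟩ := hr j
    -- Injectivity of `f` makes each endpoint of the edge `g j` occur in exactly one row.
    have key : ∀ i, Sum.elim (fun _ => (1 : ℝ)) (fun _ => -1) (f i)
        * bipartiteIncidence P R (f i) (g j)
        = (if i = i₁ then 1 else 0) - (if i = i₂ then 1 else 0) := by
      intro i
      rw [bipartiteIncidence_apply, ← h₁, ← h₂]
      simp only [hf.eq_iff]
      by_cases hi₁ : i = i₁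
      · have : i₁ ≠ i₂ := by rintro rfl; rw [h₁] at h₂; cases h₂
        subst hi₁
        simp [h₁, this]
      · by_cases hi₂ : i = i₂
        · subst hi₂
          simp [h₂, hi₁]
        · simp [hi₁, hi₂]
    simp only [Matrix.vecMul, dotProduct, Matrix.submatrix_apply, Pi.zero_apply]
    rw [Finset.sum_congr rfl fun i _ => key i]
    simp

/-- Induction on the order of the minor: expand along a column with at most one nonzero entry. If
there is none, both endpoints of every column are among the rows and the determinant vanishes. -/
theorem bipartiteIncidence_isTotallyUnimodular :
    (bipartiteIncidence P R).IsTotallyUnimodular := by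
  intro k
  induction k with
  | zero =>
    intro f g _ _
    exact ⟨1, by simp⟩
  | succ k ih =>
    intro f g hf hg
    by_cases h : ∃ j i₀, ∀ i ≠ i₀, bipartiteIncidence P R (f i) (g j) = 0
    · obtain ⟨j, i₀, hj⟩ := h
      rw [Matrix.det_succ_column _ j, Finset.sum_eq_single i₀
        (fun i _ hi => by simp [hj i hi]) (by simp), Matrix.submatrix_apply,
        Matrix.submatrix_submatrix]
      obtain ⟨s, hs⟩ := ih (f ∘ i₀.succAbove) (g ∘ j.succAbove)
        (hf.comp Fin.succAbove_right_injective) (hg.comp Fin.succAbove_right_injective)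
      rw [← hs, bipartiteIncidence_apply]
      split_ifs
      · rcases neg_one_pow_eq_or ℝ ((i₀ : ℕ) + (j : ℕ)) with h | h
        · exact ⟨s, by simp [h]⟩
        · exact ⟨-s, by simp [h]⟩
      · exact ⟨0, by simp⟩
    · push Not at h
      refine ⟨0, ?_⟩
      rw [bipartiteIncidence_det_eq_zero hf]
      · simp
      · intro j
        by_contra! hc
        by_cases hr : ∃ i, f i = Sum.inr (g j).2
        · obtain ⟨i₀, hi₀⟩ := hr
          obtain ⟨i, hi, hne⟩ := h j i₀
          refine hne ?_
          rw [bipartiteIncidence_apply, if_neg]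
          rintro (h' | h')
          · exact hc i h'
          · exact hi (hf (h'.trans hi₀.symm))
        -- Neither endpoint is among the rows, so the whole column vanishes and any row can serve as
        -- the exceptional one.
        · obtain ⟨i, hi, hne⟩ := h j 0
          push Not at hr
          exact hne (by simp [bipartiteIncidence_apply, hr, hc])
      · intro j
        by_contra! hc
        by_cases hl : ∃ i, f i = Sum.inl (g j).1
        · obtain ⟨i₀, hi₀⟩ := hl
          obtain ⟨i, hi, hne⟩ := h j i₀
          refine hne ?_
          rw [bipartiteIncidence_apply, if_neg]
          rintro (h' | h')
          · exact hi (hf (h'.trans hi₀.symm))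
          · exact hc i h'
        · obtain ⟨i, hi, hne⟩ := h j 0
          push Not at hl
          exact hne (by simp [bipartiteIncidence_apply, hl, hc])

theorem assignmentMatrix_isTotallyUnimodular : (assignmentMatrix P R).IsTotallyUnimodular :=
  (Matrix.fromRows_one_isTotallyUnimodular_iff (bipartiteIncidence P R)).2
    bipartiteIncidence_isTotallyUnimodular

end

/-! ## Vertices of the assignment polytope -/

section
variable {P R : Type*} [Fintype P] [Fintype R] [DecidableEq P] [DecidableEq R]
  {K : AssignmentConstraints P R}

theorem AssignmentConstraints.mem_relaxation_iff {X : Matrix P R ℝ} :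
    X ∈ K.relaxation ↔ (∀ p, ∑ r, X p r = (K.coverage p : ℝ)) ∧
      (∀ r, ∑ p, X p r ≤ (K.load r : ℝ)) ∧ (∀ p r, 0 ≤ X p r ∧ X p r ≤ 1) ∧
      (∀ p r, (p, r) ∈ K.conflicts → X p r = 0) := by
  have h1 : ∀ p, (assignmentMatrix P R).mulVec (fun q => X q.1 q.2) (Sum.inl (Sum.inl p))
      = ∑ r, X p r := fun p => by
    simp [assignmentMatrix, Matrix.mulVec, dotProduct, Fintype.sum_prod_type]
  have h2 : ∀ r, (assignmentMatrix P R).mulVec (fun q => X q.1 q.2) (Sum.inl (Sum.inr r))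
      = ∑ p, X p r := fun r => by
    simp [assignmentMatrix, Matrix.mulVec, dotProduct, Fintype.sum_prod_type]
  have h3 : ∀ q, (assignmentMatrix P R).mulVec (fun q => X q.1 q.2) (Sum.inr q)
      = X q.1 q.2 := fun q => by
    simp [assignmentMatrix]
  simp only [relaxation, Set.mem_ofPred_eq, h1, h2, h3, Prod.forall]

theorem AssignmentConstraints.permissible_subset_relaxation : K.permissible ⊆ K.relaxation := by
  intro A hA
  refine mem_relaxation_iff.2 ⟨hA.2.2.1, hA.2.2.2, fun p r => ?_, hA.2.1⟩
  rcases hA.1 p r with h | h <;> simp [h]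

/-- Entrywise, `0` and `1` are the endpoints of the interval `[0, 1]` and so are no proper convex
combinations of other points of it. -/
theorem AssignmentConstraints.permissible_subset_extremePoints :
    K.permissible ⊆ Set.extremePoints ℝ K.relaxation := by
  intro A hA
  refine mem_extremePoints_iff_left.2 ⟨permissible_subset_relaxation hA, ?_⟩
  rintro X hX Y hY ⟨a, b, ha, hb, hab, hXY⟩
  have hX := (mem_relaxation_iff.1 hX).2.2.1
  have hY := (mem_relaxation_iff.1 hY).2.2.1
  ext p r
  have h : a * X p r + b * Y p r = A p r := by rw [← hXY]; simp
  rcases hA.1 p r with h0 | h0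
  · rw [h0] at h ⊢
    have h1 := mul_nonneg ha.le (hX p r).1
    have h2 := mul_nonneg hb.le (hY p r).1
    have h3 : a * X p r = 0 := by linarith
    exact (mul_eq_zero.1 h3).resolve_left ha.ne'
  · rw [h0] at h ⊢
    have h1 := mul_nonneg ha.le (sub_nonneg.2 (hX p r).2)
    have h2 := mul_nonneg hb.le (sub_nonneg.2 (hY p r).2)
    have h3 : a * (1 - X p r) = 0 := by nlinarith
    linarith [(mul_eq_zero.1 h3).resolve_left ha.ne']

/-- If all other values were integers, `f i₀` would be a difference of integers strictly between `0`
and `1`. -/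
theorem exists_other_fractional {ι : Type*} [Fintype ι] [DecidableEq ι] {f : ι → ℝ}
    (h01 : ∀ i, 0 ≤ f i ∧ f i ≤ 1) {k : ℕ} (hk : ∑ i, f i = k) {i₀ : ι}
    (h0 : 0 < f i₀ ∧ f i₀ < 1) : ∃ i₁ ≠ i₀, 0 < f i₁ ∧ f i₁ < 1 := by
  by_contra! hc
  have hint : ∀ i, ∃ z : ℤ, i ≠ i₀ → f i = z := by
    intro i
    rcases (h01 i).1.eq_or_lt with h | h
    · exact ⟨0, fun _ => by simp [← h]⟩
    · exact ⟨1, fun hi => by simpa using le_antisymm (h01 i).2 (hc i hi h)⟩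
  choose z hz using hint
  rw [← Finset.add_sum_erase _ _ (Finset.mem_univ i₀),
    Finset.sum_congr rfl fun i hi => hz i (Finset.ne_of_mem_erase hi)] at hk
  have h1 : f i₀ = (((k : ℤ) - ∑ i ∈ Finset.univ.erase i₀, z i : ℤ) : ℝ) := by
    push_cast
    linarith
  rw [h1] at h0
  have h2 : (0 : ℤ) < (k : ℤ) - ∑ i ∈ Finset.univ.erase i₀, z i := by exact_mod_cast h0.1
  have h3 : (k : ℤ) - ∑ i ∈ Finset.univ.erase i₀, z i < 1 := by exact_mod_cast h0.2
  omega

/-- A nonzero direction along which a fractional point of the polytope can be moved. -/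
theorem AssignmentConstraints.exists_direction {X : Matrix P R ℝ} (hX : X ∈ K.relaxation)
    {p₀ : P} {r₀ : R} (h₀ : 0 < X p₀ r₀ ∧ X p₀ r₀ < 1) :
    ∃ D : Matrix P R ℝ, D ≠ 0 ∧ (∀ p r, D p r ≠ 0 → 0 < X p r ∧ X p r < 1) ∧
      (∀ p, ∑ r, D p r = 0) ∧ (∀ r, ∑ p, X p r = (K.load r : ℝ) → ∑ p, D p r = 0) := by
  classical
  obtain ⟨hrow, hcol, h01, hconf⟩ := mem_relaxation_iff.1 hX
  let F : Finset (P × R) := {q | 0 < X q.1 q.2 ∧ X q.1 q.2 < 1}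
  have hF : ∀ p r, (p, r) ∈ F ↔ 0 < X p r ∧ X p r < 1 := fun p r => by simp [F]
  let FT : Finset (P × R) := {q ∈ F | ∑ p, X p q.2 = (K.load q.2 : ℝ)}
  let PF : Finset P := F.image Prod.fst
  let RT : Finset R := FT.image Prod.snd
  -- A row with a fractional entry contains at least two, its sum being integral; the same holds
  -- below for columns whose load bound is attained.
  have hPF : 2 * PF.card ≤ F.card := by
    refine Finset.mul_card_image_le_card _ _ fun p hp => ?_
    obtain ⟨⟨p', r⟩, hq, rfl⟩ := Finset.mem_image.1 hp
    obtain ⟨r', hne, h'⟩ := exists_other_fractional (h01 p') (hrow p') ((hF _ _).1 hq)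
    refine Finset.one_lt_card.2 ⟨(p', r), by simp [hq], (p', r'), by simp [hF, h'], ?_⟩
    simp [hne.symm]
  have hRT : 2 * RT.card ≤ FT.card := by
    refine Finset.mul_card_image_le_card _ _ fun r hr => ?_
    obtain ⟨⟨p, r'⟩, hq, rfl⟩ := Finset.mem_image.1 hr
    have hq' := Finset.mem_filter.1 hq
    obtain ⟨p', hne, h'⟩ := exists_other_fractional (fun p => h01 p r') hq'.2 ((hF _ _).1 hq'.1)
    refine Finset.one_lt_card.2 ⟨(p, r'), by simp [hq], (p', r'), ?_, ?_⟩
    · simp only [Finset.mem_filter, and_true, FT]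
      exact ⟨(hF _ _).2 h', hq'.2⟩
    · simp [hne.symm]
  have hFT : FT.card ≤ F.card := Finset.card_filter_le _ _
  -- A direction is a kernel vector of the map that takes the sums over the fractional rows and the
  -- tight fractional columns.
  let T : (F → ℝ) →ₗ[ℝ] (PF ⊕ RT → ℝ) :=
    { toFun := fun x i => Sum.elim (fun p : PF => ∑ q : F, if q.1.1 = p then x q else 0)
        (fun r : RT => ∑ q : F, if q.1.2 = r then x q else 0) i
      map_add' := fun x y => by
        funext i
        rcases i with p | r <;> simp [← Finset.sum_add_distrib, ite_add_ite]
      map_smul' := fun c x => by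
        funext i
        rcases i with p | r <;> simp [Finset.mul_sum] }
  -- The count gives only `PF.card + RT.card ≤ F.card`. If `T` were injective, equality would hold,
  -- all fractional entries would lie in tight columns, and `T` would be onto. But then the row sums
  -- and the column sums of any `x` have the same total, so the unit vector at `p₀` is not in the
  -- range.
  have hinj : ¬ Function.Injective T := by
    intro hinj
    have hle := LinearMap.finrank_le_finrank_of_injective hinj
    simp only [Module.finrank_fintype_fun_eq_card, Fintype.card_sum, Fintype.card_coe] at hle
    have hcard : FT.card = F.card := by omega
    have hFTF : FT = F := Finset.eq_of_subset_of_card_le (Finset.filter_subset _ _) hcard.ge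
    have hsurj : Function.Surjective T := by
      refine (LinearMap.injective_iff_surjective_of_finrank_eq_finrank ?_).1 hinj
      simp only [Module.finrank_fintype_fun_eq_card, Fintype.card_sum, Fintype.card_coe]
      omega
    have hp₀ : p₀ ∈ PF := Finset.mem_image.2 ⟨(p₀, r₀), (hF _ _).2 h₀, rfl⟩
    obtain ⟨x, hx⟩ := hsurj (Pi.single (Sum.inl ⟨p₀, hp₀⟩) 1)
    have e1 : ∑ p : PF, T x (Sum.inl p) = ∑ q, x q := by
      simp only [T, LinearMap.coe_mk, AddHom.coe_mk, Sum.elim_inl]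
      rw [Finset.sum_comm]
      refine Finset.sum_congr rfl fun q _ => ?_
      have hq : q.1.1 ∈ PF := Finset.mem_image_of_mem _ q.2
      rw [Finset.sum_eq_single ⟨q.1.1, hq⟩] <;> simp +contextual [Subtype.ext_iff, eq_comm]
    have e2 : ∑ r : RT, T x (Sum.inr r) = ∑ q, x q := by
      simp only [T, LinearMap.coe_mk, AddHom.coe_mk, Sum.elim_inr]
      rw [Finset.sum_comm]
      refine Finset.sum_congr rfl fun q _ => ?_
      have hq : q.1.2 ∈ RT := Finset.mem_image_of_mem _ (hFTF.symm ▸ q.2)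
      rw [Finset.sum_eq_single ⟨q.1.2, hq⟩] <;> simp +contextual [Subtype.ext_iff, eq_comm]
    rw [hx] at e1 e2
    simp [Pi.single_apply] at e1 e2
    linarith
  obtain ⟨x, hx, hx0⟩ : ∃ x, T x = 0 ∧ x ≠ 0 := by
    by_contra! hc
    exact hinj ((injective_iff_map_eq_zero T).2 hc)
  let D : Matrix P R ℝ := fun p r => if h : (p, r) ∈ F then x ⟨(p, r), h⟩ else 0
  have hDF : ∀ p r, (p, r) ∉ F → D p r = 0 := fun p r h => dif_neg h
  have hsum : ∀ φ : P × R → Prop, ∀ [DecidablePred φ],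
      (∑ q : F, if φ q.1 then x q else 0) = ∑ q : P × R, if φ q then D q.1 q.2 else 0 := by
    intro φ _
    rw [← Finset.sum_subset (Finset.subset_univ F), ← Finset.sum_coe_sort F]
    · refine Finset.sum_congr rfl fun q _ => ?_
      simp [D]
    · intro q _ hq
      simp [hDF q.1 q.2 hq]
  refine ⟨D, ?_, ?_, ?_, ?_⟩
  · intro hD
    apply hx0
    funext q
    have := congrFun (congrFun hD q.1.1) q.1.2
    simpa [D] using this
  · intro p r h
    by_contra hc
    exact h (hDF p r (mt (hF p r).1 hc))
  · intro p
    by_cases hp : p ∈ PF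
    · have h := congrFun hx (Sum.inl ⟨p, hp⟩)
      simp only [T, LinearMap.coe_mk, AddHom.coe_mk, Sum.elim_inl] at h
      rw [hsum (fun q => q.1 = p), Fintype.sum_prod_type] at h
      simpa using h
    · refine Finset.sum_eq_zero fun r _ => hDF p r fun h => hp ?_
      exact Finset.mem_image_of_mem Prod.fst h
  · intro r hr
    by_cases hr' : r ∈ RT
    · have h := congrFun hx (Sum.inr ⟨r, hr'⟩)
      simp only [T, LinearMap.coe_mk, AddHom.coe_mk, Sum.elim_inr] at h
      rw [hsum (fun q => q.2 = r), Fintype.sum_prod_type] at h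
      simpa using h
    · refine Finset.sum_eq_zero fun p _ => hDF p r fun h => hr' ?_
      exact Finset.mem_image_of_mem Prod.snd (Finset.mem_filter.2 ⟨h, hr⟩ : (p, r) ∈ FT)

-- Equalities and attained bounds are constant along `D`, and the finitely many slack bounds survive
-- small `ε` by continuity. Conflict entries are zero, hence not fractional, and do not move.
open Filter Topology in
theorem AssignmentConstraints.eventually_mem_relaxation {X D : Matrix P R ℝ}
    (hX : X ∈ K.relaxation) (hD : ∀ p r, D p r ≠ 0 → 0 < X p r ∧ X p r < 1)
    (hrow : ∀ p, ∑ r, D p r = 0)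
    (hcol : ∀ r, ∑ p, X p r = (K.load r : ℝ) → ∑ p, D p r = 0) :
    ∀ᶠ ε : ℝ in 𝓝 0, X + ε • D ∈ K.relaxation := by
  obtain ⟨h1, h2, h3, h4⟩ := mem_relaxation_iff.1 hX
  have hc : ∀ a d : ℝ, Tendsto (fun ε : ℝ => a + ε * d) (𝓝 0) (𝓝 a) := by
    intro a d
    have : Continuous fun ε : ℝ => a + ε * d := by fun_prop
    simpa using this.tendsto 0
  have e2 : ∀ r, ∀ᶠ ε : ℝ in 𝓝 0, ∑ p, X p r + ε * ∑ p, D p r ≤ K.load r := by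
    intro r
    rcases (h2 r).eq_or_lt with h | h
    · simp [hcol r h, h]
    · exact ((hc _ _).eventually (gt_mem_nhds h)).mono fun _ h => h.le
  have e3 : ∀ p r, ∀ᶠ ε : ℝ in 𝓝 0, 0 ≤ X p r + ε * D p r ∧ X p r + ε * D p r ≤ 1 := by
    intro p r
    by_cases h : D p r = 0
    · simp [h, h3 p r]
    · exact ((hc _ _).eventually (lt_mem_nhds (hD p r h).1)).and
        ((hc _ _).eventually (gt_mem_nhds (hD p r h).2)) |>.mono fun _ h => ⟨h.1.le, h.2.le⟩
  filter_upwards [eventually_all.2 e2, eventually_all.2 fun p => eventually_all.2 (e3 p)]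
    with ε g2 g3
  refine mem_relaxation_iff.2 ⟨fun p => ?_, fun r => ?_, g3, fun p r hpr => ?_⟩
  · simp [Finset.sum_add_distrib, ← Finset.mul_sum, h1, hrow]
  · simpa [Finset.sum_add_distrib, ← Finset.mul_sum] using g2 r
  · have hx := h4 p r hpr
    have : D p r = 0 := by
      by_contra h
      exact (hD p r h).1.ne' hx
    simp [hx, this]

-- A fractional point is the midpoint of two distinct points of the polytope, obtained by moving
-- along the direction and its negative.
open Filter Topology in
theorem AssignmentConstraints.extremePoints_relaxation :
    Set.extremePoints ℝ K.relaxation = K.permissible := by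
  refine Set.Subset.antisymm (fun X hXe => ?_) permissible_subset_extremePoints
  have hX : X ∈ K.relaxation := hXe.1
  obtain ⟨h1, h2, h3, h4⟩ := mem_relaxation_iff.1 hX
  refine ⟨fun p r => ?_, h4, h1, h2⟩
  by_contra! hpr
  obtain ⟨D, hD0, hD, hrow, hcol⟩ := exists_direction hX
    ⟨lt_of_le_of_ne (h3 p r).1 hpr.1.symm, lt_of_le_of_ne (h3 p r).2 hpr.2⟩
  have hev := eventually_mem_relaxation hX hD hrow hcol
  have hneg : Tendsto (fun ε : ℝ => -ε) (𝓝 0) (𝓝 0) := by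
    simpa using (continuous_neg (G := ℝ)).tendsto 0
  -- Passing to the right neighbourhood of `0` keeps the chosen `ε` nonzero.
  have hev' := (hev.and (hneg.eventually hev)).filter_mono (nhdsWithin_le_nhds (s := Set.Ioi 0))
  obtain ⟨ε, ⟨ha, hb⟩, hε⟩ := (hev'.and self_mem_nhdsWithin).exists
  have hseg : X ∈ openSegment ℝ (X + ε • D) (X + (-ε) • D) := by
    refine ⟨1 / 2, 1 / 2, by norm_num, by norm_num, by norm_num, ?_⟩
    ext p r
    simp
    ring
  have hεD : ε • D = 0 := by
    simpa using (mem_extremePoints_iff_left.1 hXe).2 _ ha _ hb hseg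
  exact hD0 ((smul_eq_zero.1 hεD).resolve_left (ne_of_gt hε))

theorem AssignmentConstraints.isCompact_relaxation :
    IsCompact (K.relaxation : Set (P → R → ℝ)) := by
  have hbox : IsCompact (Set.univ.pi fun _ : P => Set.univ.pi fun _ : R => Set.Icc (0 : ℝ) 1) :=
    isCompact_univ_pi fun _ => isCompact_univ_pi fun _ => isCompact_Icc
  refine hbox.of_isClosed_subset ?_ fun X hX => ?_
  · have : (K.relaxation : Set (P → R → ℝ)) = {X : P → R → ℝ |
        (∀ p, ∑ r, X p r = (K.coverage p : ℝ)) ∧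
        (∀ r, ∑ p, X p r ≤ (K.load r : ℝ)) ∧ (∀ p r, 0 ≤ X p r ∧ X p r ≤ 1) ∧
        (∀ p r, (p, r) ∈ K.conflicts → X p r = 0)} := Set.ext fun X => mem_relaxation_iff
    rw [this]
    simp only [Set.ofPred_and, Set.ofPred_forall]
    refine (isClosed_iInter fun p => isClosed_eq (by fun_prop) (by fun_prop)).inter
      ((isClosed_iInter fun r => isClosed_le (by fun_prop) (by fun_prop)).inter
      ((isClosed_iInter fun p => isClosed_iInter fun r =>
        (isClosed_le (by fun_prop) (by fun_prop)).inter
          (isClosed_le (by fun_prop) (by fun_prop))).inter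
      (isClosed_iInter fun p => isClosed_iInter fun r => isClosed_iInter fun _ =>
        isClosed_eq (by fun_prop) (by fun_prop))))
  · have := (mem_relaxation_iff.1 hX).2.2.1
    exact fun p _ r _ => this p r

/-- Welfare as a linear functional of the assignment. -/
noncomputable def welfareFunctional (S : Matrix P R ℝ) : (P → R → ℝ) →ₗ[ℝ] ℝ where
  toFun A := USW A S
  map_add' A B := by
    simp [USW, add_mul, Finset.sum_add_distrib, mul_add]
  map_smul' c A := by
    simp only [USW, Pi.smul_apply, smul_eq_mul, RingHom.id_apply, mul_assoc, ← Finset.mul_sum]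
    ring

/-- The maximisers form a nonempty compact exposed face. It has an extreme point by Krein–Milman,
and extreme points of a face are extreme in the whole set. -/
theorem AssignmentConstraints.exists_vertex_argmax (S : Matrix P R ℝ)
    (h : K.relaxation.Nonempty) :
    ∃ A ∈ Set.extremePoints ℝ K.relaxation, ∀ X ∈ K.relaxation, USW X S ≤ USW A S := by
  let s : Set (P → R → ℝ) := K.relaxation
  let l : StrongDual ℝ (P → R → ℝ) := (welfareFunctional S).toContinuousLinearMap
  have hs : IsCompact s := isCompact_relaxation
  have hexp : IsExposed ℝ s (l.toExposed s) := ContinuousLinearMap.toExposed.isExposed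
  obtain ⟨X, hX, hmax⟩ := hs.exists_isMaxOn h l.continuous.continuousOn
  obtain ⟨A, hA⟩ := (hexp.isCompact hs).extremePoints_nonempty ⟨X, hX, fun Y hY => hmax hY⟩
  exact ⟨A, hexp.isExtreme.extremePoints_subset_extremePoints hA, hA.1.2⟩

theorem AssignmentConstraints.argmaxOn_permissible_eq (S : Matrix P R ℝ) :
    argmaxOn K.permissible (fun A => USW A S)
      = argmaxOn K.relaxation (fun X => USW X S) ∩ Set.extremePoints ℝ K.relaxation := by
  ext A
  constructor
  · rintro ⟨hA, hmax⟩
    have hA' := permissible_subset_relaxation hA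
    refine ⟨⟨hA', fun X hX => ?_⟩, permissible_subset_extremePoints hA⟩
    obtain ⟨B, hB, hBmax⟩ := exists_vertex_argmax (K := K) S ⟨A, hA'⟩
    exact (hBmax X hX).trans (hmax B (extremePoints_relaxation (K := K) ▸ hB))
  · rintro ⟨⟨_, hmax⟩, hA⟩
    exact ⟨extremePoints_relaxation (K := K) ▸ hA,
      fun B hB => hmax B (permissible_subset_relaxation hB)⟩

end

/-! ## Residual networks

Networks live on the nodes `0, …, N - 1`; `res u v` is the residual capacity of the arc from `u` to
`v`, `cost u v` its cost, and `pi u 0` the potential of `u`. -/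

/-- The table `f` with entry `(i, j)` replaced by `w`. -/
def upd (f : ℤ → ℤ → ℤ) (i j w : ℤ) : ℤ → ℤ → ℤ := fun x y => if x = i ∧ y = j then w else f x y

theorem Store.set_eq_upd (σ : Store) (a : ℕ) (i j v : ℤ) : σ.set a i j v a = upd (σ a) i j v := by
  funext x y
  simp [Store.set, upd]

/-- `x` is one of the nodes `0, …, N - 1`. -/
abbrev IsNode (N : ℕ) (x : ℤ) : Prop := 0 ≤ x ∧ x < N

def inSum (N : ℕ) (f : ℤ → ℤ → ℤ) (x : ℤ) : ℤ := ∑ i ∈ Finset.range N, f i x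

def outSum (N : ℕ) (f : ℤ → ℤ → ℤ) (x : ℤ) : ℤ := ∑ i ∈ Finset.range N, f x i

theorem sum_range_ite_eq {N : ℕ} {u : ℤ} (hu : IsNode N u) (c : ℤ) :
    ∑ i ∈ Finset.range N, (if (i : ℤ) = u then c else 0) = c := by
  lift u to ℕ using hu.1
  have : u < N := by exact_mod_cast hu.2
  simp [Finset.sum_ite_eq', this]

/-- `res` arises from `base` by sending a circulation. -/
structure Circ (N : ℕ) (res base : ℤ → ℤ → ℤ) : Prop where
  tot : ∀ x y, IsNode N x → IsNode N y → res x y + res y x = base x y + base y x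
  inSum : ∀ x, IsNode N x → inSum N res x = inSum N base x
  outSum : ∀ x, IsNode N x → outSum N res x = outSum N base x

theorem Circ.trans {N : ℕ} {f g h : ℤ → ℤ → ℤ} (h₁ : Circ N f g) (h₂ : Circ N g h) : Circ N f h :=
  ⟨fun x y hx hy => (h₁.tot x y hx hy).trans (h₂.tot x y hx hy),
    fun x hx => (h₁.inSum x hx).trans (h₂.inSum x hx),
    fun x hx => (h₁.outSum x hx).trans (h₂.outSum x hx)⟩

theorem inSum_upd {N : ℕ} {f : ℤ → ℤ → ℤ} {i j w x : ℤ} (hi : IsNode N i) :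
    inSum N (upd f i j w) x = inSum N f x + if x = j then w - f i j else 0 := by
  unfold inSum
  by_cases hx : x = j
  · rw [if_pos hx, ← sum_range_ite_eq hi (w - f i j), ← Finset.sum_add_distrib]
    refine Finset.sum_congr rfl fun k _ => ?_
    by_cases hk : (k : ℤ) = i <;> simp [upd, hk, hx]
  · simp [upd, hx]

theorem outSum_upd {N : ℕ} {f : ℤ → ℤ → ℤ} {i j w x : ℤ} (hj : IsNode N j) :
    outSum N (upd f i j w) x = outSum N f x + if x = i then w - f i j else 0 := by
  unfold outSum
  by_cases hx : x = i
  · rw [if_pos hx, ← sum_range_ite_eq hj (w - f i j), ← Finset.sum_add_distrib]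
    refine Finset.sum_congr rfl fun k _ => ?_
    by_cases hk : (k : ℤ) = j <;> simp [upd, hk, hx]
  · simp [upd, hx]

/-- Opening an arc in both networks shifts their totals equally, provided that they agree on that
arc beforehand. -/
theorem Circ.upd {N : ℕ} {f g : ℤ → ℤ → ℤ} (h : Circ N f g) {i j : ℤ} (hi : IsNode N i)
    (hj : IsNode N j) (hfg : f i j = g i j) (w : ℤ) : Circ N (upd f i j w) (upd g i j w) := by
  refine ⟨fun x y hx hy => ?_, fun x hx => ?_, fun x hx => ?_⟩
  · have := h.tot x y hx hy
    have := h.tot i j hi hj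
    unfold _root_.upd
    split_ifs with h1 h2 h2
    · rfl
    · obtain ⟨rfl, rfl⟩ := h1
      linarith
    · obtain ⟨rfl, rfl⟩ := h2
      linarith
    · assumption
  · rw [inSum_upd hi, inSum_upd hi, h.inSum x hx, hfg]
  · rw [outSum_upd hj, outSum_upd hj, h.outSum x hx, hfg]

/-- Send one unit along the arc from `u` to `v`. -/
def push (res : ℤ → ℤ → ℤ) (u v : ℤ) : ℤ → ℤ → ℤ :=
  upd (upd res u v (res u v - 1)) v u (upd res u v (res u v - 1) v u + 1)

/-! ### Effect of one push on residual totals -/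

section push
variable {N : ℕ} {res : ℤ → ℤ → ℤ} {u v : ℤ}

theorem push_apply (huv : u ≠ v) (x y : ℤ) : push res u v x y
    = res x y - (if x = u ∧ y = v then 1 else 0) + (if x = v ∧ y = u then 1 else 0) := by
  unfold push upd
  by_cases h1 : x = u ∧ y = v
  · obtain ⟨rfl, rfl⟩ := h1
    simp [huv]
  · by_cases h2 : x = v ∧ y = u
    · obtain ⟨rfl, rfl⟩ := h2
      simp [huv.symm]
    · simp [h1, h2]

theorem push_tot (huv : u ≠ v) (x y : ℤ) :
    push res u v x y + push res u v y x = res x y + res y x := by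
  rw [push_apply huv, push_apply huv]
  simp only [and_comm (a := y = u), and_comm (a := y = v)]
  ring

/-- Incoming residual capacity moves from the head to the tail, so the changes cancel around a
cycle. This is the form flow conservation takes here. -/
theorem inSum_push (hu : IsNode N u) (hv : IsNode N v) (x : ℤ) :
    inSum N (push res u v) x
      = inSum N res x - (if x = v then 1 else 0) + (if x = u then 1 else 0) := by
  unfold push
  rw [inSum_upd hv, inSum_upd hu]
  split_ifs <;> ring

theorem outSum_push (hu : IsNode N u) (hv : IsNode N v) (x : ℤ) :
    outSum N (push res u v) x
      = outSum N res x - (if x = u then 1 else 0) + (if x = v then 1 else 0) := by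
  unfold push
  rw [outSum_upd hu, outSum_upd hv]
  split_ifs <;> ring

end push

/-- The nodes with `mark > 0` form a tree of tight residual arcs with root `r₀`. -/
structure TightTree (N : ℕ) (r₀ : ℤ) (res cost pi mark par : ℤ → ℤ → ℤ) : Prop where
  root_mark : mark r₀ 0 = 1
  eq_root : ∀ v, IsNode N v → mark v 0 = 1 → v = r₀
  mark_nonneg : ∀ v, IsNode N v → 0 ≤ mark v 0
  parent : ∀ v, IsNode N v → 1 < mark v 0 → IsNode N (par v 0) ∧ 0 < mark (par v 0) 0 ∧
    mark (par v 0) 0 < mark v 0 ∧ 0 < res (par v 0) v ∧ pi v 0 = pi (par v 0) 0 + cost (par v 0) v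

/-- The state of the search for a cycle through the new arc from `p₀` to `r₀`, after `k` rounds. -/
structure Growing (N : ℕ) (p₀ r₀ : ℤ) (res cost pi mark par : ℤ → ℤ → ℤ) (M : ℤ) (k : ℕ) :
    Prop where
  tree : TightTree N r₀ res cost pi mark par
  feas : ∀ u v, IsNode N u → IsNode N v → ¬ (u = p₀ ∧ v = r₀) → 0 < res u v →
    pi v 0 ≤ pi u 0 + cost u v
  viol : 0 ≤ pi r₀ 0 - cost p₀ r₀ - pi p₀ 0
  pi_nonneg : ∀ v, IsNode N v → 0 ≤ pi v 0
  bound : ∀ v, IsNode N v → pi v 0 + (pi r₀ 0 - cost p₀ r₀ - pi p₀ 0) ≤ M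
  mark_le : ∀ v, IsNode N v → mark v 0 ≤ k + 1
  progress : 0 < mark p₀ 0 ∨ pi r₀ 0 - cost p₀ r₀ - pi p₀ 0 ≤ 0 ∨
    k + 1 ≤ ({i ∈ Finset.range N | 0 < mark (i : ℤ) 0} : Finset ℕ).card

/-- `best` is the minimum of `viol` and of the reduced costs of those arcs leaving the tree that
satisfy `S`; if it is less than `viol`, it is attained at the arc from `bu` to `bv`. -/
structure BestArc (N : ℕ) (res cost pi mark : ℤ → ℤ → ℤ) (viol : ℤ) (S : ℤ → ℤ → Prop)
    (best bu bv : ℤ) : Prop where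
  le : best ≤ viol
  found : (bv = -1 ∧ best = viol) ∨ (IsNode N bv ∧ IsNode N bu ∧ 0 < mark bu 0 ∧ mark bv 0 = 0 ∧
    0 < res bu bv ∧ best = pi bu 0 + cost bu bv - pi bv 0)
  min : ∀ u v, IsNode N u → IsNode N v → S u v → 0 < mark u 0 → mark v 0 = 0 → 0 < res u v →
    best ≤ pi u 0 + cost u v - pi v 0

/-- Raise the potentials of the unmarked nodes below `k` by `c`. -/
def raisePotential (mark pi : ℤ → ℤ → ℤ) (c : ℤ) (k : ℕ) : ℤ → ℤ → ℤ :=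
  fun x y => if IsNode k x ∧ y = 0 ∧ mark x 0 = 0 then pi x y + c else pi x y

/-! ### Growing the tree of tight arcs -/

section growing
variable {N k : ℕ} {p₀ r₀ : ℤ} {res cost pi mark par : ℤ → ℤ → ℤ} {M best bu bv viol : ℤ}

theorem raisePotential_of_unmarked {v : ℤ} (hv : IsNode N v) (h : mark v 0 = 0) :
    raisePotential mark pi best N v 0 = pi v 0 + best := by
  unfold raisePotential
  rw [if_pos ⟨hv, rfl, h⟩]

theorem raisePotential_of_marked {v : ℤ} (h : 0 < mark v 0) :
    raisePotential mark pi best N v 0 = pi v 0 := by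
  unfold raisePotential
  rw [if_neg]
  rintro ⟨_, _, h'⟩
  omega

/-- While `p₀` is unmarked the new arc does not leave the tree, so only arcs with nonnegative
reduced cost compete with the violation. -/
theorem Growing.best_nonneg (h : Growing N p₀ r₀ res cost pi mark par M k) (hp : mark p₀ 0 = 0)
    {S : ℤ → ℤ → Prop}
    (hb : BestArc N res cost pi mark (pi r₀ 0 - cost p₀ r₀ - pi p₀ 0) S best bu bv) :
    0 ≤ best := by
  rcases hb.found with ⟨_, h2⟩ | ⟨h1, h2, h3, h4, h5, h6⟩
  · rw [h2]
    exact h.viol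
  · have := h.feas bu bv h2 h1 (fun hc => by rw [hc.1] at h3; omega) h5
    omega

/-- Tree arcs stay tight, having both ends marked. An arc leaving the tree loses `best`, which is at
most its reduced cost. The violation drops by `best` because only the `p₀` end of the new arc is
raised, and this drop pays for the rise of the potentials in `bound`. -/
theorem Growing.raise (h : Growing N p₀ r₀ res cost pi mark par M k) (hp₀ : IsNode N p₀)
    (hp : mark p₀ 0 = 0)
    (hb : BestArc N res cost pi mark (pi r₀ 0 - cost p₀ r₀ - pi p₀ 0) (fun _ _ => True)
      best bu bv) :
    Growing N p₀ r₀ res cost (raisePotential mark pi best N) mark par M k := by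
  have hbest := h.best_nonneg hp hb
  have hr₀ : raisePotential mark pi best N r₀ 0 = pi r₀ 0 :=
    raisePotential_of_marked (by rw [h.tree.root_mark]; norm_num)
  have hp₀' : raisePotential mark pi best N p₀ 0 = pi p₀ 0 + best :=
    raisePotential_of_unmarked hp₀ hp
  have hle := hb.le
  have hcase : ∀ v, IsNode N v →
      (0 < mark v 0 ∧ raisePotential mark pi best N v 0 = pi v 0) ∨
      (mark v 0 = 0 ∧ raisePotential mark pi best N v 0 = pi v 0 + best) := by
    intro v hv
    rcases (h.tree.mark_nonneg v hv).eq_or_lt with h0 | h0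
    · exact Or.inr ⟨h0.symm, raisePotential_of_unmarked hv h0.symm⟩
    · exact Or.inl ⟨h0, raisePotential_of_marked h0⟩
  refine ⟨⟨h.tree.root_mark, h.tree.eq_root, h.tree.mark_nonneg, ?_⟩, ?_, ?_, ?_, ?_, h.mark_le, ?_⟩
  · intro v hv hm
    obtain ⟨h1, h2, h3, h4, h5⟩ := h.tree.parent v hv hm
    rw [raisePotential_of_marked (by omega), raisePotential_of_marked h2]
    exact ⟨h1, h2, h3, h4, h5⟩
  · intro u v hu hv huv hres
    have := h.feas u v hu hv huv hres
    rcases hcase u hu with ⟨h1, h2⟩ | ⟨h1, h2⟩ <;> rcases hcase v hv with ⟨h3, h4⟩ | ⟨h3, h4⟩ <;>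
      rw [h2, h4]
    · omega
    · have := hb.min u v hu hv trivial h1 h3 hres
      omega
    · omega
    · omega
  · omega
  · intro v hv
    have := h.pi_nonneg v hv
    rcases hcase v hv with ⟨_, h2⟩ | ⟨_, h2⟩ <;> omega
  · intro v hv
    have := h.bound v hv
    rcases hcase v hv with ⟨_, h2⟩ | ⟨_, h2⟩ <;> omega
  · rcases h.progress with h1 | h1 | h1
    · exact Or.inl h1
    · exact Or.inr (Or.inl (by omega))
    · exact Or.inr (Or.inr h1)

/-- The label `k + 2` exceeds all earlier labels, which are at most `k + 1`; hence labels decrease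
strictly along parents. -/
theorem Growing.attach (h : Growing N p₀ r₀ res cost pi mark par M k)
    (hbv : IsNode N bv) (hbu : IsNode N bu) (hmu : 0 < mark bu 0) (hmv : mark bv 0 = 0)
    (hres : 0 < res bu bv) (htight : pi bv 0 = pi bu 0 + cost bu bv) :
    Growing N p₀ r₀ res cost pi (upd mark bv 0 (k + 2)) (upd par bv 0 bu) M (k + 1) := by
  have hm : ∀ v, v ≠ bv → upd mark bv 0 (k + 2) v 0 = mark v 0 := fun v hv => by simp [upd, hv]
  have hmb : upd mark bv 0 (k + 2) bv 0 = k + 2 := by simp [upd]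
  have hp : ∀ v, v ≠ bv → upd par bv 0 bu v 0 = par v 0 := fun v hv => by simp [upd, hv]
  have hpb : upd par bv 0 bu bv 0 = bu := by simp [upd]
  have hne : ∀ {v}, 0 < mark v 0 → v ≠ bv := by rintro v hv rfl; omega
  refine ⟨⟨?_, ?_, ?_, ?_⟩, h.feas, h.viol, h.pi_nonneg, h.bound, ?_, ?_⟩
  · rw [hm _ (hne (by rw [h.tree.root_mark]; norm_num)), h.tree.root_mark]
  · intro v hv h1
    by_cases hvb : v = bv
    · rw [hvb, hmb] at h1
      omega
    · rw [hm v hvb] at h1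
      exact h.tree.eq_root v hv h1
  · intro v hv
    by_cases hvb : v = bv
    · rw [hvb, hmb]
      omega
    · rw [hm v hvb]
      exact h.tree.mark_nonneg v hv
  · intro v hv h1
    by_cases hvb : v = bv
    · rw [hvb, hpb, hmb, hm bu (hne hmu)]
      have := h.mark_le bu hbu
      exact ⟨hbu, hmu, by omega, hres, htight⟩
    · rw [hm v hvb] at h1 ⊢
      rw [hp v hvb]
      obtain ⟨h2, h3, h4, h5, h6⟩ := h.tree.parent v hv h1
      rw [hm _ (hne h3)]
      exact ⟨h2, h3, h4, h5, h6⟩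
  · intro v hv
    by_cases hvb : v = bv
    · rw [hvb, hmb]
      push_cast
      omega
    · rw [hm v hvb]
      have := h.mark_le v hv
      push_cast
      omega
  · rcases h.progress with h1 | h1 | h1
    · exact Or.inl (by rwa [hm _ (hne h1)])
    · exact Or.inr (Or.inl h1)
    · refine Or.inr (Or.inr ?_)
      obtain ⟨w, rfl⟩ : ∃ w : ℕ, bv = w := ⟨bv.toNat, by omega⟩
      have hw : w ∉ ({i ∈ Finset.range N | 0 < mark (i : ℤ) 0} : Finset ℕ) := by
        simp [hmv]
      have hcard := Finset.card_insert_of_notMem hw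
      have hsub : insert w ({i ∈ Finset.range N | 0 < mark (i : ℤ) 0} : Finset ℕ)
          ⊆ ({i ∈ Finset.range N | 0 < upd mark w 0 (k + 2) (i : ℤ) 0} : Finset ℕ) := by
        intro i hi
        rcases Finset.mem_insert.1 hi with rfl | hi
        · simp only [Finset.mem_filter, Finset.mem_range, hmb]
          omega
        · simp only [Finset.mem_filter, Finset.mem_range] at hi ⊢
          rw [hm _ (hne hi.2)]
          exact hi
      have := Finset.card_le_card hsub
      omega

theorem Growing.succ (h : Growing N p₀ r₀ res cost pi mark par M k)
    (hdone : 0 < mark p₀ 0 ∨ pi r₀ 0 - cost p₀ r₀ - pi p₀ 0 ≤ 0) :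
    Growing N p₀ r₀ res cost pi mark par M (k + 1) :=
  ⟨h.tree, h.feas, h.viol, h.pi_nonneg, h.bound,
    fun v hv => by have := h.mark_le v hv; push_cast; omega,
    hdone.elim Or.inl fun h => Or.inr (Or.inl h)⟩

/-- Otherwise `N + 1` of the `N` nodes would be marked. -/
theorem Growing.done (h : Growing N p₀ r₀ res cost pi mark par M N) :
    0 < mark p₀ 0 ∨ pi r₀ 0 - cost p₀ r₀ - pi p₀ 0 ≤ 0 := by
  rcases h.progress with h1 | h1 | h1
  · exact Or.inl h1
  · exact Or.inr h1
  · have := (Finset.card_filter_le (Finset.range N) fun i : ℕ => 0 < mark (i : ℤ) 0)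
    rw [Finset.card_range] at this
    omega

end growing

/-- A residual network with feasible potentials between `0` and `B`, obtained from the network
`base` by sending a circulation. -/
structure Residual (N : ℕ) (res cost pi base : ℤ → ℤ → ℤ) (B : ℤ) : Prop where
  nonneg : ∀ u v, IsNode N u → IsNode N v → 0 ≤ res u v
  feas : ∀ u v, IsNode N u → IsNode N v → 0 < res u v → pi v 0 ≤ pi u 0 + cost u v
  circ : Circ N res base
  pi_nonneg : ∀ v, IsNode N v → 0 ≤ pi v 0
  pi_le : ∀ v, IsNode N v → pi v 0 ≤ B

/-- The residual network `res'` arises from `res` by sending one unit along the cycle through the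
arc from `p₀` to `r₀`, except for the part of the tree path from `r₀` to `v`. -/
structure Tracing (N : ℕ) (r₀ : ℤ) (res cost pi mark par res' : ℤ → ℤ → ℤ) (v : ℤ) : Prop where
  node : IsNode N v
  marked : 0 < mark v 0
  nonneg : ∀ x y, IsNode N x → IsNode N y → 0 ≤ res' x y
  feas : ∀ x y, IsNode N x → IsNode N y → 0 < res' x y → pi y 0 ≤ pi x 0 + cost x y
  tot : ∀ x y, res' x y + res' y x = res x y + res y x
  inSum : ∀ x, inSum N res' x
    = inSum N res x - (if x = r₀ then 1 else 0) + (if x = v then 1 else 0)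
  outSum : ∀ x, outSum N res' x
    = outSum N res x + (if x = r₀ then 1 else 0) - (if x = v then 1 else 0)
  path : ∀ x, IsNode N x → 1 < mark x 0 → mark x 0 ≤ mark v 0 → 0 < res' (par x 0) x

/-! ### Sending one unit around the cycle -/

section tracing
variable {N k : ℕ} {p₀ r₀ v : ℤ} {res cost pi mark par res' : ℤ → ℤ → ℤ} {M : ℤ}

/-- The push saturates the new arc, so only its reverse has to satisfy the potential inequality, and
that is the nonnegativity of the violation. The imbalance left at `p₀` is then carried along the
tree path back to `r₀`. -/
theorem Growing.startTracing (h : Growing N p₀ r₀ res cost pi mark par M k)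
    (hp₀ : IsNode N p₀) (hr₀ : IsNode N r₀) (hpr : p₀ ≠ r₀) (hm : 0 < mark p₀ 0)
    (hnn : ∀ u v, IsNode N u → IsNode N v → 0 ≤ res u v) (hres : res p₀ r₀ = 1)
    (hcost : ∀ u v, cost u v = - cost v u) :
    Tracing N r₀ res cost pi mark par (push res p₀ r₀) p₀ := by
  refine ⟨hp₀, hm, ?_, ?_, push_tot hpr, ?_, ?_, ?_⟩
  · intro x y hx hy
    have := hnn x y hx hy
    rw [push_apply hpr]
    by_cases h1 : x = p₀ ∧ y = r₀
    · obtain ⟨rfl, rfl⟩ := h1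
      simp [hres, hpr]
    · simp only [h1, if_false]
      split_ifs <;> omega
  · intro x y hx hy hpos
    rw [push_apply hpr] at hpos
    by_cases h1 : x = p₀ ∧ y = r₀
    · obtain ⟨rfl, rfl⟩ := h1
      simp [hres, hpr] at hpos
    · by_cases h2 : x = r₀ ∧ y = p₀
      · obtain ⟨rfl, rfl⟩ := h2
        have := h.viol
        have := hcost x y
        omega
      · simp only [h1, h2, if_false] at hpos
        exact h.feas x y hx hy h1 (by omega)
  · intro x
    rw [inSum_push hp₀ hr₀]
  · intro x
    rw [outSum_push hp₀ hr₀]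
    ring
  · intro x hx h1 _
    have hne : x ≠ r₀ := by
      rintro rfl
      rw [h.tree.root_mark] at h1
      omega
    obtain ⟨_, _, _, h2, _⟩ := h.tree.parent x hx h1
    rw [push_apply hpr]
    simp only [hne, and_false, if_false]
    split_ifs <;> omega

/-- Tree arcs are tight and costs antisymmetric, so the reversed arc is tight as well. The push
lowers capacity only on an arc into `v`, and the rest of the path has smaller labels. -/
theorem Tracing.step (h : Tracing N r₀ res cost pi mark par res' v)
    (ht : TightTree N r₀ res cost pi mark par) (hm : 1 < mark v 0)
    (hcost : ∀ u v, cost u v = - cost v u) :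
    Tracing N r₀ res cost pi mark par (push res' (par v 0) v) (par v 0) := by
  obtain ⟨h1, h2, h3, h4, h5⟩ := ht.parent v h.node hm
  have hne : par v 0 ≠ v := fun hc => by rw [hc] at h3; omega
  have hpos := h.path v h.node hm le_rfl
  refine ⟨h1, h2, ?_, ?_, ?_, ?_, ?_, ?_⟩
  · intro x y hx hy
    have := h.nonneg x y hx hy
    rw [push_apply hne]
    by_cases h6 : x = par v 0 ∧ y = v
    · obtain ⟨rfl, rfl⟩ := h6
      simp [hne]
      omega
    · simp only [h6, if_false]
      split_ifs <;> omega
  · intro x y hx hy hp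
    rw [push_apply hne] at hp
    by_cases h6 : x = v ∧ y = par v 0
    · obtain ⟨rfl, rfl⟩ := h6
      have := hcost x (par x 0)
      omega
    · simp only [h6, if_false] at hp
      refine h.feas x y hx hy ?_
      split_ifs at hp <;> omega
  · intro x y
    rw [push_tot hne, h.tot]
  · intro x
    rw [inSum_push h1 h.node, h.inSum]
    ring
  · intro x
    rw [outSum_push h1 h.node, h.outSum]
    ring
  · intro x hx h6 h7
    have hxv : x ≠ v := by rintro rfl; omega
    have := h.path x hx h6 (by omega)
    rw [push_apply hne]
    simp only [hxv, and_false, if_false]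
    split_ifs <;> omega

/-- Only the root has label `1`; there the two imbalances cancel. -/
theorem Tracing.circ (h : Tracing N r₀ res cost pi mark par res' v)
    (ht : TightTree N r₀ res cost pi mark par) (hm : ¬ 1 < mark v 0) : Circ N res' res := by
  have hv : v = r₀ := ht.eq_root v h.node (by have := h.marked; omega)
  subst hv
  exact ⟨fun x y _ _ => h.tot x y, fun x _ => by rw [h.inSum]; ring,
    fun x _ => by rw [h.outSum]; ring⟩

end tracing

/-! ### Opening a new arc in a residual network -/

section insertArc
variable {N : ℕ} {p₀ r₀ : ℤ} {res cost pi mark par base : ℤ → ℤ → ℤ} {B W : ℤ}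

theorem Residual.res_eq_zero (h : Residual N res cost pi base B) {x y : ℤ} (hx : IsNode N x)
    (hy : IsNode N y) (h1 : base x y = 0) (h2 : base y x = 0) : res x y = 0 := by
  have := h.circ.tot x y hx hy
  have := h.nonneg x y hx hy
  have := h.nonneg y x hy hx
  omega

theorem Residual.upd_nonneg (h : Residual N res cost pi base B) (u v : ℤ) (hu : IsNode N u)
    (hv : IsNode N v) : 0 ≤ upd res p₀ r₀ 1 u v := by
  unfold upd
  have := h.nonneg u v hu hv
  split_ifs <;> omega

theorem Residual.circ_upd (h : Residual N res cost pi base B) (hp₀ : IsNode N p₀)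
    (hr₀ : IsNode N r₀) (h1 : base p₀ r₀ = 0) (h2 : base r₀ p₀ = 0) :
    Circ N (upd res p₀ r₀ 1) (upd base p₀ r₀ 1) :=
  h.circ.upd hp₀ hr₀ (by rw [h.res_eq_zero hp₀ hr₀ h1 h2, h1]) 1

theorem Residual.insert (h : Residual N res cost pi base B) (hp₀ : IsNode N p₀)
    (hr₀ : IsNode N r₀) (h1 : base p₀ r₀ = 0) (h2 : base r₀ p₀ = 0)
    (hviol : pi r₀ 0 - cost p₀ r₀ - pi p₀ 0 ≤ 0) :
    Residual N (upd res p₀ r₀ 1) cost pi (upd base p₀ r₀ 1) B := by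
  refine ⟨h.upd_nonneg, fun u v hu hv hpos => ?_, h.circ_upd hp₀ hr₀ h1 h2, h.pi_nonneg, h.pi_le⟩
  by_cases huv : u = p₀ ∧ v = r₀
  · obtain ⟨rfl, rfl⟩ := huv
    omega
  · exact h.feas u v hu hv (by simpa [upd, huv] using hpos)

/-- The bound `2 * B + W` is a potential of at most `B` plus an initial violation of at most `B +
W`. -/
theorem Residual.startGrowing (h : Residual N res cost pi base B) (hp₀ : IsNode N p₀)
    (hr₀ : IsNode N r₀)
    (hviol : 0 < pi r₀ 0 - cost p₀ r₀ - pi p₀ 0) (hW : - cost p₀ r₀ ≤ W)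
    (hmark : ∀ v, IsNode N v → mark v 0 = if v = r₀ then 1 else 0) :
    Growing N p₀ r₀ (upd res p₀ r₀ 1) cost pi mark par (2 * B + W) 0 := by
  refine ⟨⟨by simp [hmark _ hr₀], ?_, ?_, ?_⟩, ?_, hviol.le, h.pi_nonneg, ?_, ?_, ?_⟩
  · intro v hv h3
    by_contra hc
    rw [hmark v hv, if_neg hc] at h3
    omega
  · intro v hv
    rw [hmark v hv]
    split_ifs <;> norm_num
  · intro v hv h3
    rw [hmark v hv] at h3
    split_ifs at h3 <;> omega
  · intro u v hu hv huv hpos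
    exact h.feas u v hu hv (by simpa [upd, huv] using hpos)
  · intro v hv
    have := h.pi_le v hv
    have := h.pi_le r₀ hr₀
    have := h.pi_nonneg p₀ hp₀
    omega
  · intro v hv
    rw [hmark v hv]
    split_ifs <;> norm_num
  · refine Or.inr (Or.inr ?_)
    rw [zero_add, Nat.one_le_iff_ne_zero, Finset.card_ne_zero]
    obtain ⟨w, rfl⟩ : ∃ w : ℕ, r₀ = w := ⟨r₀.toNat, by omega⟩
    exact ⟨w, by simp [hmark _ hr₀]; omega⟩

end insertArc

/-! ## The assignment network

The papers are the nodes `0, …, n - 1`, the reviewers the nodes `n, …, n + m - 1`, and node `n + m`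
is a hub. -/

/-- The assignment network with arcs from the hub to the papers, from the reviewers to the hub, and
from `p` to `r` for those pairs without conflict that precede `(i, j)` lexicographically. -/
def assignmentNet (n m : ℕ) (cov load conf : ℤ → ℤ → ℤ) (i j : ℕ) : ℤ → ℤ → ℤ := fun x y =>
  if x = n + m ∧ IsNode n y then cov y 0
  else if y = n + m ∧ n ≤ x ∧ x < n + m then load (x - n) 0
  else if IsNode n x ∧ (n ≤ y ∧ y < n + m) ∧ conf x (y - n) ≤ 0 ∧ (x < i ∨ x = i ∧ y - n < j)
    then 1
  else 0

section assignmentNet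
variable {n m : ℕ} {cov load conf : ℤ → ℤ → ℤ}

theorem assignmentNet_insert {i j : ℕ} (hi : i < n) (hj : j < m) (h : conf i j ≤ 0) :
    upd (assignmentNet n m cov load conf i j) i (n + j) 1
      = assignmentNet n m cov load conf i (j + 1) := by
  funext x y
  unfold upd
  by_cases hxy : x = i ∧ y = n + j
  · obtain ⟨rfl, rfl⟩ := hxy
    rw [if_pos ⟨rfl, rfl⟩]
    unfold assignmentNet
    rw [if_neg (by omega), if_neg (by omega), if_pos]
    refine ⟨⟨by omega, by omega⟩, by omega, ?_, Or.inr ⟨rfl, ?_⟩⟩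
    · simpa using h
    · push_cast
      omega
  · rw [if_neg hxy]
    unfold assignmentNet
    have : (x < i ∨ x = i ∧ y - n < j) ↔ (x < i ∨ x = i ∧ y - n < ((j + 1 : ℕ) : ℤ)) := by
      push_cast
      omega
    simp only [this]

theorem assignmentNet_skip {i j : ℕ} (h : ¬ conf i j ≤ 0) :
    assignmentNet n m cov load conf i j = assignmentNet n m cov load conf i (j + 1) := by
  funext x y
  unfold assignmentNet
  by_cases hxy : x = i ∧ y - n = j
  · simp [hxy.1, hxy.2, h]
  · have : (x < i ∨ x = i ∧ y - n < j) ↔ (x < i ∨ x = i ∧ y - n < ((j + 1 : ℕ) : ℤ)) := by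
      push_cast
      omega
    simp only [this]

theorem assignmentNet_row (i : ℕ) :
    assignmentNet n m cov load conf i m = assignmentNet n m cov load conf (i + 1) 0 := by
  funext x y
  unfold assignmentNet
  by_cases hy : y < n + m
  · by_cases hx : IsNode n x ∧ n ≤ y
    · have : (x < i ∨ x = i ∧ y - n < m) ↔
          (x < ((i + 1 : ℕ) : ℤ) ∨ x = ((i + 1 : ℕ) : ℤ) ∧ y - n < (0 : ℕ)) := by
        push_cast
        omega
      simp only [this]
    · have : ∀ φ ψ : Prop, ¬ (IsNode n x ∧ (n ≤ y ∧ y < n + m) ∧ φ ∧ ψ) :=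
        fun φ ψ h => hx ⟨h.1, h.2.1.1⟩
      simp only [this, if_false]
  · simp only [hy, and_false, false_and, if_false]

theorem assignmentNet_new {i j : ℕ} (hi : i < n) :
    assignmentNet n m cov load conf i j i (n + j) = 0 := by
  unfold assignmentNet
  rw [if_neg (by omega), ite_cond_eq_false, if_neg]
  · push Not
    intros
    omega
  · simp only [eq_iff_iff, iff_false]
    omega

theorem assignmentNet_new_rev {i j k l : ℕ} (hi : i < n) (hj : j < m) :
    assignmentNet n m cov load conf k l (n + j) i = 0 := by
  unfold assignmentNet
  rw [if_neg (by omega), if_neg (by omega), if_neg (by omega)]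

theorem assignmentNet_nonneg (hc : ∀ x, 0 ≤ cov x 0) (hl : ∀ x, 0 ≤ load x 0) (i j : ℕ) (x y : ℤ) :
    0 ≤ assignmentNet n m cov load conf i j x y := by
  unfold assignmentNet
  split_ifs
  exacts [hc _, hl _, zero_le_one, le_rfl]

theorem assignmentNet_le {c : ℤ} (h1 : 1 ≤ c) (hc : ∀ x, cov x 0 ≤ c) (hl : ∀ x, load x 0 ≤ c)
    (i j : ℕ) (x y : ℤ) : assignmentNet n m cov load conf i j x y ≤ c := by
  unfold assignmentNet
  split_ifs
  exacts [hc _, hl _, h1, by omega]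

theorem sum_range_nodes (n m : ℕ) (f : ℤ → ℤ) : ∑ i ∈ Finset.range (n + m + 1), f i
    = ∑ p : Fin n, f p + ∑ r : Fin m, f (n + r) + f (n + m) := by
  rw [Finset.sum_range_succ, Finset.sum_range_add, Finset.sum_range, Finset.sum_range]
  push_cast
  rfl

variable {res cost pi : ℤ → ℤ → ℤ} {B : ℤ}

/-- Pair totals are invariant under circulations. Hence `res (n + r) p`, the capacity for undoing
the arc from `p` to `r`, is the assignment entry. -/
theorem Residual.pair_sum
    (h : Residual (n + m + 1) res cost pi (assignmentNet n m cov load conf n 0) B)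
    (p : Fin n) (r : Fin m) :
    res p (n + r) + res (n + r) p = if conf p r ≤ 0 then 1 else 0 := by
  have hp := p.2
  have hr := r.2
  rw [h.circ.tot _ _ (by constructor <;> push_cast <;> omega)
    (by constructor <;> push_cast <;> omega), assignmentNet_new_rev hp hr, add_zero]
  unfold assignmentNet
  rw [if_neg (by omega), if_neg (by omega)]
  have : (n : ℤ) + r - n = r := by ring
  rw [this]
  refine if_congr ⟨fun h => h.2.2.1, fun h => ⟨by constructor <;> omega, by omega, h, ?_⟩⟩ rfl rfl
  left
  omega

/-- Incoming residual at a paper is conserved and initially comes from the hub alone; `res (n + m)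
p` is thus the unmet demand of `p`. -/
theorem Residual.paper_sum
    (h : Residual (n + m + 1) res cost pi (assignmentNet n m cov load conf n 0) B) (p : Fin n) :
    ∑ r : Fin m, res (n + r) p + res (n + m) p = cov p 0 := by
  have hp := p.2
  have h1 := h.circ.inSum p (by constructor <;> push_cast <;> omega)
  simp only [inSum] at h1
  rw [sum_range_nodes n m fun i => res i p, sum_range_nodes n m fun i =>
    assignmentNet n m cov load conf n 0 i p] at h1
  have e1 : ∀ q : Fin n, assignmentNet n m cov load conf n 0 q p = 0 := by
    intro q
    have hq := q.2
    unfold assignmentNet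
    rw [if_neg (by omega), if_neg (by omega), if_neg (by omega)]
  have e2 : ∀ r : Fin m, assignmentNet n m cov load conf n 0 (n + r) p = 0 :=
    fun r => assignmentNet_new_rev hp r.2
  have e3 : assignmentNet n m cov load conf n 0 (n + m) p = cov p 0 := by
    unfold assignmentNet
    rw [if_pos ⟨rfl, by constructor <;> omega⟩]
  have e4 : ∀ q : Fin n, res q p = 0 := by
    intro q
    have hq := q.2
    exact h.res_eq_zero (by constructor <;> push_cast <;> omega)
      (by constructor <;> push_cast <;> omega) (e1 q) (by
        unfold assignmentNet
        rw [if_neg (by omega), if_neg (by omega), if_neg (by omega)])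
  simp only [e1, e2, e3, e4, Finset.sum_const_zero, zero_add] at h1
  exact h1

/-- Outgoing residual at a reviewer is conserved and initially goes to the hub alone; what still
goes there is the unused load. -/
theorem Residual.reviewer_sum
    (h : Residual (n + m + 1) res cost pi (assignmentNet n m cov load conf n 0) B) (r : Fin m) :
    ∑ p : Fin n, res (n + r) p + res (n + r) (n + m) = load r 0 := by
  have hr := r.2
  have h1 := h.circ.outSum (n + r) (by constructor <;> push_cast <;> omega)
  simp only [outSum] at h1
  rw [sum_range_nodes n m fun i => res (n + r) i, sum_range_nodes n m fun i =>
    assignmentNet n m cov load conf n 0 (n + r) i] at h1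
  have e1 : ∀ s t : Fin m, assignmentNet n m cov load conf n 0 (n + s) (n + t) = 0 := by
    intro s t
    have hs := s.2
    have ht := t.2
    unfold assignmentNet
    rw [if_neg (by omega), if_neg (by omega), if_neg (by omega)]
  have e2 : ∀ p : Fin n, assignmentNet n m cov load conf n 0 (n + r) p = 0 :=
    fun p => assignmentNet_new_rev p.2 r.2
  have e3 : assignmentNet n m cov load conf n 0 (n + r) (n + m) = load r 0 := by
    unfold assignmentNet
    rw [if_neg (by omega), if_pos ⟨rfl, by omega⟩]
    congr 1
    ring
  have e4 : ∀ s : Fin m, res (n + r) (n + s) = 0 := by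
    intro s
    have hs := s.2
    exact h.res_eq_zero (by constructor <;> push_cast <;> omega)
      (by constructor <;> push_cast <;> omega) (e1 r s) (e1 s r)
  simp only [e1, e2, e3, e4, Finset.sum_const_zero, zero_add, add_zero] at h1
  exact h1

theorem Residual.reviewer_hub
    (h : Residual (n + m + 1) res cost pi (assignmentNet n m cov load conf n 0) B) (r : Fin m) :
    res (n + r) (n + m) + res (n + m) (n + r) = load r 0 := by
  have hr := r.2
  rw [h.circ.tot _ _ (by constructor <;> push_cast <;> omega)
    (by constructor <;> push_cast <;> omega)]
  unfold assignmentNet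
  rw [if_neg (by omega), if_pos ⟨rfl, by omega⟩, if_neg (by rintro ⟨_, h1, h2⟩; omega),
    if_neg (by omega), if_neg (by omega)]
  simp

/-- Feasible potentials certify that the assignment carried by a residual network is optimal. -/
theorem Residual.optimal
    (h : Residual (n + m + 1) res cost pi (assignmentNet n m cov load conf n 0) B)
    (hcost : ∀ u v, cost u v = - cost v u)
    (hhub : ∀ x : ℕ, cost x (n + m) = 0) {b : Fin n → Fin m → ℤ}
    (hb : ∀ p r, b p r = 0 ∨ b p r = 1) (hconf : ∀ (p : Fin n) (r : Fin m), ¬ conf p r ≤ 0 → b p r = 0)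
    (hrow : ∀ p : Fin n, ∑ r, b p r = cov p 0) (hcol : ∀ r : Fin m, ∑ p, b p r ≤ load r 0) :
    ∑ p, ∑ r, b p r * cost (n + r) p ≤ ∑ p : Fin n, ∑ r : Fin m, res (n + r) p * cost (n + r) p := by
  have node_p : ∀ p : Fin n, IsNode (n + m + 1) (p : ℤ) := fun p => by
    have := p.2
    constructor <;> push_cast <;> omega
  have node_r : ∀ r : Fin m, IsNode (n + m + 1) ((n : ℤ) + r) := fun r => by
    have := r.2
    constructor <;> push_cast <;> omega
  have node_h : IsNode (n + m + 1) ((n : ℤ) + m) := by constructor <;> push_cast <;> omega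
  have hhub' : ∀ r : Fin m, cost ((n : ℤ) + r) (n + m) = 0 := fun r => by
    simpa using hhub (n + r)
  have hhub'' : ∀ p : Fin n, cost ((n : ℤ) + m) p = 0 := fun p => by
    rw [hcost, hhub p, neg_zero]
  -- Where `b` differs from the flow, the residual arc that changes the flow towards `b` is open,
  -- and its potential inequality has the right sign.
  have arc : ∀ (p : Fin n) (r : Fin m), (b p r - res (n + r) p) * cost (n + r) p
      ≤ (b p r - res (n + r) p) * (pi p 0 - pi (n + r) 0) := by
    intro p r
    have h1 := h.pair_sum p r
    have h2 := h.nonneg _ _ (node_p p) (node_r r)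
    have h3 := h.nonneg _ _ (node_r r) (node_p p)
    have h4 := h.feas _ _ (node_p p) (node_r r)
    have h5 := h.feas _ _ (node_r r) (node_p p)
    have h6 := hcost (n + r) p
    by_cases hc : conf p r ≤ 0
    · rw [if_pos hc] at h1
      rcases hb p r with h7 | h7
      · rcases h3.eq_or_lt with h8 | h8
        · simp [h7, ← h8]
        · have h9 : res (n + r) p = 1 := by omega
          rw [h7, h9]
          have := h5 h8
          linarith
      · rcases h2.eq_or_lt with h8 | h8
        · have h9 : res (n + r) p = 1 := by omega
          simp [h7, h9]
        · have h9 : res (n + r) p = 0 := by omega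
          rw [h7, h9]
          have := h4 h8
          linarith
    · rw [if_neg hc] at h1
      have h9 : res (n + r) p = 0 := by omega
      simp [hconf p r hc, h9]
  have paper : ∀ p : Fin n, (∑ r, (b p r - res (n + r) p)) * (pi p 0 - pi (n + m) 0) ≤ 0 := by
    intro p
    rw [Finset.sum_sub_distrib, hrow p, ← h.paper_sum p, add_sub_cancel_left]
    rcases (h.nonneg _ _ node_h (node_p p)).eq_or_lt with h1 | h1
    · simp [← h1]
    · have := h.feas _ _ node_h (node_p p) h1
      rw [hhub''] at this
      exact mul_nonpos_of_nonneg_of_nonpos h1.le (by linarith)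
  -- A reviewer busier in the flow than in `b` leaves the arc from the hub open; one less busy
  -- leaves the arc to the hub open.
  have reviewer : ∀ r : Fin m,
      (∑ p : Fin n, (b p r - res (n + r) p)) * (pi (n + m) 0 - pi (n + r) 0) ≤ 0 := by
    intro r
    have h1 := h.reviewer_sum r
    have h2 := h.reviewer_hub r
    have h3 := hcol r
    have h4 : 0 ≤ ∑ p, b p r := Finset.sum_nonneg fun p _ => by rcases hb p r with h | h <;> omega
    rw [Finset.sum_sub_distrib]
    rcases lt_trichotomy (∑ p, b p r) (∑ p : Fin n, res (n + r) p) with h5 | h5 | h5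
    · have := h.feas _ _ node_h (node_r r) (by linarith)
      rw [hcost, hhub' r] at this
      exact mul_nonpos_of_nonpos_of_nonneg (by linarith) (by linarith)
    · simp [h5]
    · have := h.feas _ _ (node_r r) node_h (by linarith)
      rw [hhub' r] at this
      exact mul_nonpos_of_nonneg_of_nonpos (by linarith) (by linarith)
  -- The potential difference is split at the hub potential, which regroups the double sum by papers
  -- and by reviewers.
  have total : ∑ p : Fin n, ∑ r : Fin m, (b p r - res (n + r) p) * cost (n + r) p ≤ 0 := by
    calc _ ≤ ∑ p : Fin n, ∑ r : Fin m, (b p r - res (n + r) p) * (pi p 0 - pi (n + r) 0) :=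
          Finset.sum_le_sum fun p _ => Finset.sum_le_sum fun r _ => arc p r
      _ = ∑ p : Fin n, ∑ r : Fin m, ((b p r - res (n + r) p) * (pi p 0 - pi (n + m) 0)
            + (b p r - res (n + r) p) * (pi (n + m) 0 - pi (n + r) 0)) :=
          Finset.sum_congr rfl fun p _ => Finset.sum_congr rfl fun r _ => by ring
      _ = ∑ p : Fin n, (∑ r : Fin m, (b p r - res (n + r) p)) * (pi p 0 - pi (n + m) 0)
            + ∑ r : Fin m, (∑ p : Fin n, (b p r - res (n + r) p))
              * (pi (n + m) 0 - pi (n + r) 0) := by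
          simp only [Finset.sum_add_distrib, Finset.sum_mul]
          congr 1
          exact Finset.sum_comm
      _ ≤ 0 := add_nonpos (Finset.sum_nonpos fun p _ => paper p)
          (Finset.sum_nonpos fun r _ => reviewer r)
  simp only [sub_mul, Finset.sum_sub_distrib] at total
  linarith

end assignmentNet

/-- A permissible assignment has integral entries. -/
theorem AssignmentConstraints.exists_int_of_permissible {P R : Type*} [Fintype P] [Fintype R]
    {K : AssignmentConstraints P R} {A : Matrix P R ℝ} (hA : A ∈ K.permissible) :
    ∃ b : P → R → ℤ, (∀ p r, A p r = b p r) ∧ (∀ p r, b p r = 0 ∨ b p r = 1) ∧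
      (∀ p r, (p, r) ∈ K.conflicts → b p r = 0) ∧ (∀ p, ∑ r, b p r = K.coverage p) ∧
      ∀ r, ∑ p, b p r ≤ K.load r := by
  have : ∀ p r, ∃ z : ℤ, A p r = z ∧ (z = 0 ∨ z = 1) := fun p r => by
    rcases hA.1 p r with h | h
    · exact ⟨0, by simp [h]⟩
    · exact ⟨1, by simp [h]⟩
  choose b hb h01 using this
  refine ⟨b, hb, h01, fun p r h => ?_, fun p => ?_, fun r => ?_⟩
  · have := hA.2.1 p r h
    rw [hb] at this
    exact_mod_cast this
  · have := hA.2.2.1 p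
    simp only [hb] at this
    exact_mod_cast this
  · have := hA.2.2.2 r
    simp only [hb] at this
    exact_mod_cast this

/-- An optimal residual network for scores shifted by a large constant tells whether there are
permissible assignments, and carries an optimal one. -/
theorem Residual.solves {n m : ℕ} (K : AssignmentConstraints (Fin n) (Fin m))
    {cov load conf res cost pi : ℤ → ℤ → ℤ} {B big D : ℤ}
    (h : Residual (n + m + 1) res cost pi (assignmentNet n m cov load conf n 0) B)
    (hcost : ∀ u v, cost u v = - cost v u) (hhub : ∀ x : ℕ, cost x (n + m) = 0)
    (hcov : ∀ p : Fin n, cov p 0 = K.coverage p) (hload : ∀ r : Fin m, load r 0 = K.load r)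
    (hconf : ∀ (p : Fin n) (r : Fin m), conf p r ≤ 0 ↔ (p, r) ∉ K.conflicts)
    {w : Fin n → Fin m → ℤ} (hw : ∀ (p : Fin n) (r : Fin m), cost (n + r) p = w p r + big)
    (hbig : ∑ p, ∑ r, |w p r| < big) {L : Matrix (Fin n) (Fin m) ℝ} (hD : 0 < D)
    (hL : ∀ p r, (w p r : ℝ) = D * L p r) :
    (K.permissible.Nonempty → (∀ p : Fin n, res (n + m) p = 0) ∧
      (Matrix.of fun (p : Fin n) (r : Fin m) => ((res (n + r) p : ℤ) : ℝ)) ∈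
        argmaxOn K.permissible (fun A => USW A L)) ∧
    ((∀ p : Fin n, res (n + m) p = 0) → K.permissible.Nonempty) := by
  have h01 : ∀ (p : Fin n) (r : Fin m), 0 ≤ res (n + r) p ∧ res (n + r) p ≤ 1 ∧
      ((p, r) ∈ K.conflicts → res (n + r) p = 0) := by
    intro p r
    have h1 := h.pair_sum p r
    have hp := p.2
    have hr := r.2
    have h2 := h.nonneg p (n + r) (by constructor <;> push_cast <;> omega)
      (by constructor <;> push_cast <;> omega)
    have h3 := h.nonneg (n + r) p (by constructor <;> push_cast <;> omega)
      (by constructor <;> push_cast <;> omega)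
    refine ⟨h3, by split_ifs at h1 <;> omega, fun hc => ?_⟩
    rw [if_neg (by rw [hconf]; exact not_not.2 hc)] at h1
    omega
  have hhub_nonneg : ∀ p : Fin n, 0 ≤ res (n + m) p := by
    intro p
    have hp := p.2
    exact h.nonneg _ _ (by constructor <;> push_cast <;> omega)
      (by constructor <;> push_cast <;> omega)
  have hperm : (∀ p : Fin n, res (n + m) p = 0) →
      (Matrix.of fun (p : Fin n) (r : Fin m) => ((res (n + r) p : ℤ) : ℝ)) ∈ K.permissible := by
    intro h0
    refine ⟨fun p r => ?_, fun p r hc => ?_, fun p => ?_, fun r => ?_⟩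
    · obtain ⟨h1, h2, _⟩ := h01 p r
      have : res (n + r) p = 0 ∨ res (n + r) p = 1 := by omega
      simpa using by exact_mod_cast this
    · simpa using (h01 p r).2.2 hc
    · have := h.paper_sum p
      rw [h0, hcov, add_zero] at this
      simp only [Matrix.of_apply]
      exact_mod_cast this
    · have h1 := h.reviewer_sum r
      have hr := r.2
      have h2 := h.nonneg (n + r) (n + m) (by constructor <;> push_cast <;> omega)
        (by constructor <;> push_cast <;> omega)
      have : ∑ p : Fin n, res (n + r) p ≤ K.load r := by
        rw [← hload]
        linarith
      simp only [Matrix.of_apply]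
      exact_mod_cast this
  -- Rows of `b` are full, while the flow misses `res (n + m) p` in row `p`; the shift turns each
  -- missing unit into a penalty of `big`.
  have hopt : ∀ b : Fin n → Fin m → ℤ, (∀ p r, b p r = 0 ∨ b p r = 1) →
      (∀ p r, (p, r) ∈ K.conflicts → b p r = 0) → (∀ p, ∑ r, b p r = K.coverage p) →
      (∀ r, ∑ p, b p r ≤ K.load r) →
      ∑ p, ∑ r, b p r * w p r + big * ∑ p : Fin n, res (n + m) p
        ≤ ∑ p : Fin n, ∑ r : Fin m, res (n + r) p * w p r := by
    intro b hb1 hb2 hb3 hb4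
    have h1 := h.optimal hcost hhub hb1
      (fun p r hc => hb2 p r (by rwa [hconf, not_not] at hc))
      (fun p => by rw [hb3, hcov]) (fun r => by rw [hload]; exact hb4 r)
    simp only [hw, mul_add, Finset.sum_add_distrib, ← Finset.sum_mul, hb3] at h1
    have h2 : ∑ p : Fin n, ∑ r : Fin m, res (n + r) p
        = ∑ p : Fin n, (K.coverage p : ℤ) - ∑ p : Fin n, res (n + m) p := by
      rw [← Finset.sum_sub_distrib]
      refine Finset.sum_congr rfl fun p _ => ?_
      rw [← hcov, ← h.paper_sum p]
      ring
    rw [h2] at h1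
    linarith
  refine ⟨fun ⟨A, hA⟩ => ?_, fun h0 => ⟨_, hperm h0⟩⟩
  -- One missing unit costs at least `big`. The entries of the flow and of `b` differ by at most
  -- one, so the scores gain at most the sum of the `|w p r|`, which is smaller.
  have h0 : ∀ p : Fin n, res (n + m) p = 0 := by
    by_contra! hc
    obtain ⟨p₀, hp₀⟩ := hc
    obtain ⟨b, -, hb1, hb2, hb3, hb4⟩ := K.exists_int_of_permissible hA
    have h1 := hopt b hb1 hb2 hb3 hb4
    have h2 : 1 ≤ ∑ p : Fin n, res (n + m) p := by
      have := Finset.single_le_sum (f := fun p : Fin n => res (n + m) p)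
        (fun p _ => hhub_nonneg p) (Finset.mem_univ p₀)
      have := hhub_nonneg p₀
      omega
    have h3 : ∑ p : Fin n, ∑ r : Fin m, (res (n + r) p * w p r - b p r * w p r)
        ≤ ∑ p, ∑ r, |w p r| := by
      refine Finset.sum_le_sum fun p _ => Finset.sum_le_sum fun r _ => ?_
      rw [← sub_mul]
      refine (le_abs_self _).trans ?_
      rw [abs_mul]
      refine mul_le_of_le_one_left (abs_nonneg _) ?_
      obtain ⟨h4, h5, _⟩ := h01 p r
      rw [abs_le]
      rcases hb1 p r with h6 | h6 <;> rw [h6] <;> omega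
    simp only [Finset.sum_sub_distrib] at h3
    have h4 : 0 ≤ ∑ p, ∑ r, |w p r| :=
      Finset.sum_nonneg fun p _ => Finset.sum_nonneg fun r _ => abs_nonneg _
    nlinarith
  refine ⟨h0, hperm h0, fun A' hA' => ?_⟩
  obtain ⟨b, hb0, hb1, hb2, hb3, hb4⟩ := K.exists_int_of_permissible hA'
  have h1 := hopt b hb1 hb2 hb3 hb4
  simp only [h0, Finset.sum_const_zero, mul_zero, add_zero] at h1
  have hD' : (0 : ℝ) < D := by exact_mod_cast hD
  have h2 : (D : ℝ) * ∑ p, ∑ r, A' p r * L p r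
      ≤ D * ∑ p : Fin n, ∑ r : Fin m, ((res (n + r) p : ℤ) : ℝ) * L p r := by
    have h3 : ((∑ p, ∑ r, b p r * w p r : ℤ) : ℝ)
        ≤ ((∑ p : Fin n, ∑ r : Fin m, res (n + r) p * w p r : ℤ) : ℝ) := by exact_mod_cast h1
    push_cast at h3
    simp only [hL] at h3
    simp only [Finset.mul_sum]
    simpa only [hb0, mul_left_comm] using h3
  simp only [USW, Matrix.of_apply]
  exact mul_le_mul_of_nonneg_left (le_of_mul_le_mul_left h2 hD') (by positivity)

/-! ## The program: insertion of an arc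

Arrays `12`, `13`, `14` hold the residual capacities, the costs and the potentials, arrays `15` and
`16` the marks and the parents of the search tree. -/

theorem upd_same (f : ℤ → ℤ → ℤ) (i j w : ℤ) : upd f i j w i j = w := by simp [upd]

/-- `τ` differs from `σ` in the arrays of `l` only. -/
def Frame (l : List ℕ) (σ τ : Store) : Prop := ∀ a, a ∉ l → τ a = σ a

theorem Frame.refl (l : List ℕ) (σ : Store) : Frame l σ σ := fun _ _ => rfl

theorem Frame.trans {l l' : List ℕ} {σ ρ τ : Store} (h : Frame l σ ρ) (h' : Frame l' ρ τ)
    (hl : l' ⊆ l) : Frame l σ τ :=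
  fun a ha => (h' a fun hc => ha (hl hc)).trans (h a ha)

theorem Frame.mono {l l' : List ℕ} {σ τ : Store} (h : Frame l σ τ) (hl : l ⊆ l') : Frame l' σ τ :=
  fun a ha => h a fun hc => ha (hl hc)

theorem Frame.set {l : List ℕ} {σ ρ : Store} (h : Frame l σ ρ) {a : ℕ} (ha : a ∈ l) (i j v : ℤ) :
    Frame l σ (ρ.set a i j v) := by
  intro a' ha'
  rw [Store.set_of_ne (by rintro rfl; exact ha' ha), h a' ha']

namespace Prog

def nodeCount : IntExpr := .add (.add (.var 0) (.var 1)) (.const 1)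

/-- Scalars during an insertion: `20` and `32` hold the ends `p₀` and `r₀` of the new arc, `29` the
round, `30` and `31` the scanned arc, `26` the best value so far, `27` and `28` the ends of the best
arc, with `-1` in `28` if there is none, and `33` and `34` the current node of the trace and its
parent. -/
def reducedCost : IntExpr :=
  .sub (.add (.cell 14 (.var 30) (.const 0)) (.cell 13 (.var 30) (.var 31)))
    (.cell 14 (.var 31) (.const 0))

def violation : IntExpr :=
  .sub (.sub (.cell 14 (.var 32) (.const 0)) (.cell 13 (.var 20) (.var 32)))
    (.cell 14 (.var 20) (.const 0))

def searchStep : Prog :=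
  .ifPos (.cell 15 (.var 30) (.const 0))
    (.ifPos (.sub (.const 1) (.cell 15 (.var 31) (.const 0)))
      (.ifPos (.cell 12 (.var 30) (.var 31))
        (.ifPos (.sub (.var 26) reducedCost)
          (.seq (.assign 26 reducedCost) (.seq (.assign 27 (.var 30)) (.assign 28 (.var 31))))
          .skip)
        .skip)
      .skip)
    .skip

def search : Prog := .forRange 30 nodeCount (.forRange 31 nodeCount searchStep)

def raise : Prog :=
  .forRange 31 nodeCount
    (.ifPos (.sub (.const 1) (.cell 15 (.var 31) (.const 0)))
      (.write 14 (.var 31) (.const 0) (.add (.cell 14 (.var 31) (.const 0)) (.var 26)))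
      .skip)

def attach : Prog :=
  .ifPos (.add (.var 28) (.const 1))
    (.seq (.write 15 (.var 28) (.const 0) (.add (.var 29) (.const 2)))
      (.write 16 (.var 28) (.const 0) (.var 27)))
    .skip

def growRound : Prog :=
  .ifPos (.sub (.const 1) (.cell 15 (.var 20) (.const 0)))
    (.ifPos violation
      (.seq (.assign 26 violation) (.seq (.assign 28 (.const (-1)))
        (.seq search (.seq raise attach))))
      .skip)
    .skip

def clearMarks : Prog :=
  .seq (.forRange 31 nodeCount (.write 15 (.var 31) (.const 0) (.const 0)))
    (.write 15 (.var 32) (.const 0) (.const 1))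

def pushArc (u v : IntExpr) : Prog :=
  .seq (.write 12 u v (.sub (.cell 12 u v) (.const 1)))
    (.write 12 v u (.add (.cell 12 v u) (.const 1)))

def trace : Prog :=
  .seq (pushArc (.var 20) (.var 32)) (.seq (.assign 33 (.var 20))
    (.whilePos (.sub (.cell 15 (.var 33) (.const 0)) (.const 1))
      (.seq (.assign 34 (.cell 16 (.var 33) (.const 0)))
        (.seq (pushArc (.var 34) (.var 33)) (.assign 33 (.var 34))))))

def insertArc : Prog :=
  .seq (.write 12 (.var 20) (.var 32) (.const 1))
    (.ifPos violation
      (.seq clearMarks (.seq (.forRange 29 nodeCount growRound)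
        (.ifPos (.cell 15 (.var 20) (.const 0)) trace .skip)))
      .skip)

end Prog

/-! ### Scanning for the cheapest arc leaving the tree -/

section bestArc
variable {N : ℕ} {res cost pi mark : ℤ → ℤ → ℤ} {viol best bu bv : ℤ} {S S' : ℤ → ℤ → Prop}

theorem BestArc.start : BestArc N res cost pi mark viol (fun _ _ => False) viol bu (-1) :=
  ⟨le_rfl, Or.inl ⟨rfl, rfl⟩, fun _ _ _ _ h => h.elim⟩

theorem BestArc.mono (h : BestArc N res cost pi mark viol S best bu bv)
    (hS : ∀ u v, IsNode N u → IsNode N v → S' u v → 0 < mark u 0 → mark v 0 = 0 → 0 < res u v →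
      S u v ∨ best ≤ pi u 0 + cost u v - pi v 0) :
    BestArc N res cost pi mark viol S' best bu bv :=
  ⟨h.le, h.found, fun u v hu hv h' h1 h2 h3 =>
    (hS u v hu hv h' h1 h2 h3).elim (fun hs => h.min u v hu hv hs h1 h2 h3) id⟩

theorem BestArc.improve (h : BestArc N res cost pi mark viol S best bu bv) {u v : ℤ}
    (hu : IsNode N u) (hv : IsNode N v) (h1 : 0 < mark u 0) (h2 : mark v 0 = 0) (h3 : 0 < res u v)
    (hlt : pi u 0 + cost u v - pi v 0 < best) (hS : ∀ x y, S' x y → S x y ∨ (x = u ∧ y = v)) :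
    BestArc N res cost pi mark viol S' (pi u 0 + cost u v - pi v 0) u v := by
  refine ⟨hlt.le.trans h.le, Or.inr ⟨hv, hu, h1, h2, h3, rfl⟩, fun x y hx hy hs h4 h5 h6 => ?_⟩
  rcases hS x y hs with hs | ⟨rfl, rfl⟩
  · exact hlt.le.trans (h.min x y hx hy hs h4 h5 h6)
  · exact le_rfl

end bestArc

/-! ### Verification of the search and of the raise -/

section programs
variable {b N n m : ℕ} {σ : Store}

theorem nodeCount_val {ρ : Store} (h0 : ρ 0 0 0 = n) (h1 : ρ 1 0 0 = m) :
    Prog.nodeCount.val ρ = ((n + m + 1 : ℕ) : ℤ) := by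
  simp [Prog.nodeCount, IntExpr.val, h0, h1]

theorem Runs.searchStep {viol M : ℤ} (hM : M < 2 ^ b) (hviol : viol ≤ M) (hN : (N : ℤ) < 2 ^ b)
    (hmark : ∀ v, IsNode N v → 0 ≤ σ 15 v 0)
    (hrc : ∀ u v, IsNode N u → IsNode N v → 0 < σ 15 u 0 → σ 15 v 0 = 0 → 0 < σ 12 u v →
      0 ≤ σ 14 u 0 + σ 13 u v - σ 14 v 0) {i j : ℕ} (hi : i < N) (hj : j < N) {ρ : Store}
    (hF : Frame [26, 27, 28, 30, 31] σ ρ) (h30 : ρ 30 0 0 = i) (h31 : ρ 31 0 0 = j)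
    (hB : BestArc N (σ 12) (σ 13) (σ 14) (σ 15) viol (fun u v => u < i ∨ u = i ∧ v < j)
      (ρ 26 0 0) (ρ 27 0 0) (ρ 28 0 0)) :
    Runs b Prog.searchStep ρ 7 fun τ => τ 31 0 0 = j ∧ τ 30 0 0 = i ∧
      Frame [26, 27, 28, 30, 31] σ τ ∧
      BestArc N (σ 12) (σ 13) (σ 14) (σ 15) viol (fun u v => u < i ∨ u = i ∧ v < (j + 1 : ℕ))
        (τ 26 0 0) (τ 27 0 0) (τ 28 0 0) := by
  have hi' : IsNode N (i : ℤ) := ⟨by omega, by omega⟩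
  have hj' : IsNode N (j : ℤ) := ⟨by omega, by omega⟩
  have h12 := hF 12 (by decide)
  have h13 := hF 13 (by decide)
  have h14 := hF 14 (by decide)
  have h15 := hF 15 (by decide)
  have hrcv : Prog.reducedCost.val ρ = σ 14 i 0 + σ 13 i j - σ 14 j 0 := by
    simp [Prog.reducedCost, IntExpr.val, h30, h31, h13, h14]
  -- All four failing tests end the same way: the scanned arc is not eligible or does not beat the
  -- current best.
  have hskip : (0 < σ 15 i 0 → σ 15 j 0 = 0 → 0 < σ 12 i j →
      ρ 26 0 0 ≤ σ 14 i 0 + σ 13 i j - σ 14 j 0) → Runs b Prog.skip ρ 1 fun τ => τ 31 0 0 = j ∧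
      τ 30 0 0 = i ∧ Frame [26, 27, 28, 30, 31] σ τ ∧
      BestArc N (σ 12) (σ 13) (σ 14) (σ 15) viol (fun u v => u < i ∨ u = i ∧ v < (j + 1 : ℕ))
        (τ 26 0 0) (τ 27 0 0) (τ 28 0 0) := by
    intro h
    refine Runs.skip ⟨h31, h30, hF, hB.mono fun u v _ _ hs h1 h2 h3 => ?_⟩
    by_cases huv : u = i ∧ v = j
    · obtain ⟨rfl, rfl⟩ := huv
      exact Or.inr (h h1 h2 h3)
    · left
      push_cast at hs
      omega
  unfold Prog.searchStep
  refine Runs.ifPos (s := 6) (fun c1 => ?_) fun c1 => (hskip ?_).mono (by norm_num) fun _ h => h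
  rotate_left
  · simp only [IntExpr.val, h30, h15] at c1
    intro h; omega
  simp only [IntExpr.val, h30, h15] at c1
  refine Runs.ifPos (s := 5) (fun c2 => ?_) fun c2 => (hskip ?_).mono (by norm_num) fun _ h => h
  rotate_left
  · simp only [IntExpr.val, h31, h15] at c2
    intro _ h; omega
  simp only [IntExpr.val, h31, h15] at c2
  refine Runs.ifPos (s := 4) (fun c3 => ?_) fun c3 => (hskip ?_).mono (by norm_num) fun _ h => h
  rotate_left
  · simp only [IntExpr.val, h30, h31, h12] at c3
    intro _ _ h; omega
  simp only [IntExpr.val, h30, h31, h12] at c3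
  refine Runs.ifPos (s := 3) (fun c4 => ?_) fun c4 => (hskip ?_).mono (by norm_num) fun _ h => h
  rotate_left
  · simp only [IntExpr.val, hrcv] at c4
    intro _ _ _; omega
  simp only [IntExpr.val, hrcv] at c4
  have hmj : σ 15 j 0 = 0 := by have := hmark j hj'; omega
  have hr0 := hrc i j hi' hj' c1 hmj c3
  have hle := hB.le
  refine (Runs.seq (s := 1) (t := 2) (Runs.assign ?_ (Runs.seq (s := 1) (t := 1)
    (Runs.assign ?_ (Runs.assign ?_ ?_)))))
  · rw [hrcv, abs_of_nonneg hr0]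
    omega
  · simp [IntExpr.val, Store.set_of_ne, h30]
    omega
  · simp [IntExpr.val, Store.set_of_ne, h31]
    omega
  · refine ⟨by simp [Store.set_of_ne, h31], by simp [Store.set_of_ne, h30],
      ((hF.set (by decide) _ _ _).set (by decide) _ _ _).set (by decide) _ _ _, ?_⟩
    simp only [IntExpr.val, Store.set_of_ne, Store.set_eq_upd, upd_same, hrcv, h30, h31, ne_eq,
      Nat.reduceEqDiff, not_false_eq_true]
    refine hB.improve hi' hj' c1 hmj c3 (by omega) fun x y hs => ?_
    push_cast at hs
    omega

theorem Runs.search {viol M : ℤ} (hM : M < 2 ^ b) (hviol : viol ≤ M)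
    (hN : ((n + m + 1 : ℕ) : ℤ) < 2 ^ b) (h0 : σ 0 0 0 = n) (h1 : σ 1 0 0 = m)
    (hmark : ∀ v, IsNode (n + m + 1) v → 0 ≤ σ 15 v 0)
    (hrc : ∀ u v, IsNode (n + m + 1) u → IsNode (n + m + 1) v → 0 < σ 15 u 0 → σ 15 v 0 = 0 →
      0 < σ 12 u v → 0 ≤ σ 14 u 0 + σ 13 u v - σ 14 v 0)
    (hbest : σ 26 0 0 = viol) (hbv : σ 28 0 0 = -1) :
    Runs b Prog.search σ ((n + m + 1) * (((n + m + 1) * (7 + 2) + 2) + 2) + 2) fun τ =>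
      Frame [26, 27, 28, 30, 31] σ τ ∧
      BestArc (n + m + 1) (σ 12) (σ 13) (σ 14) (σ 15) viol (fun _ _ => True)
        (τ 26 0 0) (τ 27 0 0) (τ 28 0 0) := by
  unfold Prog.search
  refine (Runs.forRange (M := n + m + 1) (fun i ρ => Frame [26, 27, 28, 30, 31] σ ρ ∧
      BestArc (n + m + 1) (σ 12) (σ 13) (σ 14) (σ 15) viol (fun u _ => u < i)
        (ρ 26 0 0) (ρ 27 0 0) (ρ 28 0 0)) hN ?_ ?_ ?_ ?_).mono le_rfl ?_
  · refine ⟨Frame.refl _ _, ?_⟩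
    rw [hbest, hbv]
    refine BestArc.start.mono fun u v hu _ hs => ?_
    push_cast at hs
    omega
  · rintro k ρ v ⟨hF, hB⟩
    refine ⟨hF.set (by decide) _ _ _, ?_⟩
    simpa [Store.set_of_ne] using hB
  · rintro k ρ ⟨hF, -⟩
    exact nodeCount_val (by rw [hF 0 (by decide), h0]) (by rw [hF 1 (by decide), h1])
  · rintro i ρ hi ⟨hF, hB⟩ h30
    refine (Runs.forRange (M := n + m + 1) (fun j ρ => ρ 30 0 0 = i ∧
      Frame [26, 27, 28, 30, 31] σ ρ ∧
      BestArc (n + m + 1) (σ 12) (σ 13) (σ 14) (σ 15) viol (fun u v => u < i ∨ u = i ∧ v < j)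
        (ρ 26 0 0) (ρ 27 0 0) (ρ 28 0 0)) hN ?_ ?_ ?_ ?_).mono le_rfl ?_
    · refine ⟨h30, hF, hB.mono fun u v _ hv hs _ _ _ => Or.inl ?_⟩
      push_cast at hs
      omega
    · rintro k ρ v ⟨h, hF, hB⟩
      refine ⟨by simpa [Store.set_of_ne] using h, hF.set (by decide) _ _ _, ?_⟩
      simpa [Store.set_of_ne] using hB
    · rintro k ρ ⟨_, hF, -⟩
      exact nodeCount_val (by rw [hF 0 (by decide), h0]) (by rw [hF 1 (by decide), h1])
    · rintro j ρ hj ⟨h30, hF, hB⟩ h31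
      exact Runs.searchStep hM hviol hN hmark hrc hi hj hF h30 h31 hB
    · rintro τ ⟨h30, hF, hB⟩
      refine ⟨h30, hF, hB.mono fun u v _ hv hs _ _ _ => Or.inl ?_⟩
      push_cast at hs hv
      omega
  · rintro τ ⟨hF, hB⟩
    exact ⟨hF, hB.mono fun u v hu _ _ _ _ _ => Or.inl hu.2⟩

theorem Runs.raise {M : ℤ} (hM : M < 2 ^ b)
    (hN : ((n + m + 1 : ℕ) : ℤ) < 2 ^ b) (h0 : σ 0 0 0 = n) (h1 : σ 1 0 0 = m)
    (hmark : ∀ v, IsNode (n + m + 1) v → 0 ≤ σ 15 v 0)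
    (hpi : ∀ v, IsNode (n + m + 1) v → 0 ≤ σ 14 v 0 + σ 26 0 0 ∧ σ 14 v 0 + σ 26 0 0 ≤ M) :
    Runs b Prog.raise σ ((n + m + 1) * ((1 + 1) + 2) + 2) fun τ =>
      Frame [14, 31] σ τ ∧
      τ 14 = raisePotential (σ 15) (σ 14) (σ 26 0 0) (n + m + 1) := by
  unfold Prog.raise
  refine (Runs.forRange (M := n + m + 1) (fun i ρ => Frame [14, 31] σ ρ ∧
      ρ 14 = raisePotential (σ 15) (σ 14) (σ 26 0 0) i) hN ?_ ?_ ?_ ?_).mono le_rfl ?_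
  · refine ⟨Frame.refl _ _, ?_⟩
    funext x y
    unfold raisePotential
    rw [if_neg]
    rintro ⟨⟨_, _⟩, _⟩
    omega
  · rintro k ρ v ⟨hF, hB⟩
    refine ⟨hF.set (by decide) _ _ _, ?_⟩
    simpa [Store.set_of_ne] using hB
  · rintro k ρ ⟨hF, -⟩
    exact nodeCount_val (by rw [hF 0 (by decide), h0]) (by rw [hF 1 (by decide), h1])
  · rintro j ρ hj ⟨hF, h14⟩ h31
    have hj' : IsNode (n + m + 1) (j : ℤ) := ⟨by omega, by omega⟩
    have h15 := hF 15 (by decide)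
    have h26 := hF 26 (by decide)
    have hval : raisePotential (σ 15) (σ 14) (σ 26 0 0) j j 0 = σ 14 j 0 := by
      unfold raisePotential
      rw [if_neg]
      rintro ⟨⟨_, h⟩, _⟩
      omega
    refine Runs.ifPos (fun c => ?_) fun c => ?_
    · simp only [IntExpr.val, h31, h15] at c
      have hm : σ 15 j 0 = 0 := by have := hmark j hj'; omega
      obtain ⟨hp1, hp2⟩ := hpi j hj'
      refine Runs.write ?_ ⟨?_, hF.set (by decide) _ _ _, ?_⟩
      · simp only [IntExpr.val, h31, h14, h26, hval]
        rw [abs_of_nonneg hp1]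
        omega
      · simp [Store.set_of_ne, h31]
      · simp only [IntExpr.val, h31, h14, h26, Store.set_eq_upd, hval]
        funext x y
        unfold upd raisePotential
        by_cases hx : x = j ∧ y = 0
        · obtain ⟨rfl, rfl⟩ := hx
          rw [if_pos ⟨rfl, rfl⟩, if_pos ⟨⟨by omega, by omega⟩, rfl, hm⟩]
        · rw [if_neg hx]
          refine if_congr ?_ rfl rfl
          constructor
          · rintro ⟨⟨_, h⟩, h'⟩
            exact ⟨⟨by omega, by push_cast; omega⟩, h'⟩
          · rintro ⟨⟨_, h⟩, h'⟩
            have := h'.1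
            push_cast at h
            exact ⟨⟨by omega, by omega⟩, h'⟩
    · simp only [IntExpr.val, h31, h15] at c
      refine Runs.skip ⟨h31, hF, ?_⟩
      rw [h14]
      funext x y
      unfold raisePotential
      refine if_congr ?_ rfl rfl
      constructor
      · rintro ⟨⟨_, h⟩, h'⟩
        exact ⟨⟨by omega, by push_cast; omega⟩, h'⟩
      · rintro ⟨⟨_, h⟩, h'⟩
        have hxj : x ≠ j := by
          rintro rfl
          have := h'.2
          omega
        push_cast at h
        exact ⟨⟨by omega, by omega⟩, h'⟩
  · exact fun τ h => h

end programs

def growSteps (N : ℕ) : ℕ :=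
  1 + (1 + (N * ((N * (7 + 2) + 2) + 2) + 2 + (N * ((1 + 1) + 2) + 2 + 3))) + 1 + 1

def traceSteps (N : ℕ) : ℕ := 2 + (1 + (N * (1 + (2 + 1) + 1) + 1))

def insertSteps (N : ℕ) : ℕ :=
  1 + (N * (1 + 2) + 2 + 1 + (N * (growSteps N + 2) + 2 + (traceSteps N + 1)) + 1)

/-! ### Verification of growing, tracing and insertion -/

section programs
variable {b n m : ℕ} {σ : Store} {p₀ r₀ : ℤ}

theorem violation_val {ρ : Store} (h20 : ρ 20 0 0 = p₀) (h32 : ρ 32 0 0 = r₀) :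
    Prog.violation.val ρ = ρ 14 r₀ 0 - ρ 13 p₀ r₀ - ρ 14 p₀ 0 := by
  simp [Prog.violation, IntExpr.val, h20, h32]

/-- With `-1` as head, no leaving arc beat the violation; the raise was by the full violation and
the search is finished. -/
theorem Runs.attach {M : ℤ} {k : ℕ} (hk : (k : ℤ) + 2 < 2 ^ b)
    (hN : ((n + m + 1 : ℕ) : ℤ) < 2 ^ b) (h29 : σ 29 0 0 = k)
    (hG : Growing (n + m + 1) p₀ r₀ (σ 12) (σ 13) (σ 14) (σ 15) (σ 16) M k)
    (hdone : σ 28 0 0 = -1 → σ 14 r₀ 0 - σ 13 p₀ r₀ - σ 14 p₀ 0 ≤ 0)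
    (hfound : σ 28 0 0 ≠ -1 → IsNode (n + m + 1) (σ 28 0 0) ∧ IsNode (n + m + 1) (σ 27 0 0) ∧
      0 < σ 15 (σ 27 0 0) 0 ∧ σ 15 (σ 28 0 0) 0 = 0 ∧ 0 < σ 12 (σ 27 0 0) (σ 28 0 0) ∧
      σ 14 (σ 28 0 0) 0 = σ 14 (σ 27 0 0) 0 + σ 13 (σ 27 0 0) (σ 28 0 0)) :
    Runs b Prog.attach σ 3 fun τ => Frame [15, 16] σ τ ∧
      Growing (n + m + 1) p₀ r₀ (τ 12) (τ 13) (τ 14) (τ 15) (τ 16) M (k + 1) := by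
  unfold Prog.attach
  refine Runs.ifPos (s := 2) (fun c => ?_) fun c => ?_
  · simp only [IntExpr.val] at c
    obtain ⟨h1, h2, h3, h4, h5, h6⟩ := hfound (by omega)
    refine Runs.seq (s := 1) (t := 1) (Runs.write ?_ (Runs.write ?_ ?_))
    · simp only [IntExpr.val, h29]
      rw [abs_of_nonneg (by positivity)]
      exact hk
    · simp only [IntExpr.val, Store.set_of_ne, ne_eq, Nat.reduceEqDiff, not_false_eq_true]
      rw [abs_of_nonneg h2.1]
      exact h2.2.trans hN
    · refine ⟨((Frame.refl _ _).set (by decide) _ _ _).set (by decide) _ _ _, ?_⟩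
      simp only [IntExpr.val, Store.set_of_ne, Store.set_eq_upd, ne_eq, Nat.reduceEqDiff,
        not_false_eq_true, h29]
      exact hG.attach h1 h2 h3 h4 h5 h6
  · refine (Runs.skip ⟨Frame.refl _ _, ?_⟩).mono (by norm_num) fun _ h => h
    refine hG.succ (Or.inr (hdone ?_))
    by_contra hc
    have := (hfound hc).1.1
    simp only [IntExpr.val] at c
    omega

theorem Runs.growRound {M : ℤ} {k : ℕ} (hM : M < 2 ^ b) (hk : (k : ℤ) + 2 < 2 ^ b) (hb : b ≠ 0)
    (hN : ((n + m + 1 : ℕ) : ℤ) < 2 ^ b) (h0 : σ 0 0 0 = n) (h1 : σ 1 0 0 = m)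
    (h20 : σ 20 0 0 = p₀) (h32 : σ 32 0 0 = r₀) (h29 : σ 29 0 0 = k)
    (hp₀ : IsNode (n + m + 1) p₀)
    (hG : Growing (n + m + 1) p₀ r₀ (σ 12) (σ 13) (σ 14) (σ 15) (σ 16) M k) :
    Runs b Prog.growRound σ (growSteps (n + m + 1)) fun τ =>
      Frame [14, 15, 16, 26, 27, 28, 30, 31] σ τ ∧
      Growing (n + m + 1) p₀ r₀ (τ 12) (τ 13) (τ 14) (τ 15) (τ 16) M (k + 1) := by
  unfold Prog.growRound growSteps
  refine Runs.ifPos (fun c1 => ?_) fun c1 => (Runs.skip ⟨Frame.refl _ _, hG.succ ?_⟩).mono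
    (by omega) fun _ h => h
  rotate_left
  · simp only [IntExpr.val, h20] at c1
    left; omega
  simp only [IntExpr.val, h20] at c1
  have hmp : σ 15 p₀ 0 = 0 := by have := hG.tree.mark_nonneg p₀ hp₀; omega
  refine Runs.ifPos (fun c2 => ?_) fun c2 => (Runs.skip ⟨Frame.refl _ _, hG.succ ?_⟩).mono
    (by omega) fun _ h => h
  rotate_left
  · rw [violation_val h20 h32] at c2
    right; omega
  rw [violation_val h20 h32] at c2
  have hviolM : σ 14 r₀ 0 - σ 13 p₀ r₀ - σ 14 p₀ 0 ≤ M := by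
    have := hG.bound p₀ hp₀
    have := hG.pi_nonneg p₀ hp₀
    omega
  refine Runs.seq (Runs.assign ?_ (Runs.seq (Runs.assign ?_ (Runs.seq
    ((Runs.search (n := n) (m := m) hM hviolM hN ?_ ?_ ?_ ?_ ?_ ?_).mono le_rfl ?_)))))
  · rw [violation_val h20 h32, abs_of_pos c2]
    exact hviolM.trans_lt hM
  · simp only [IntExpr.val]
    exact lt_of_lt_of_le (by norm_num) (pow_le_pow_right₀ (by norm_num)
      (Nat.one_le_iff_ne_zero.2 hb))
  · simpa [Store.set_of_ne] using h0
  · simpa [Store.set_of_ne] using h1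
  · simpa [Store.set_of_ne] using hG.tree.mark_nonneg
  · simp only [Store.set_of_ne, ne_eq, Nat.reduceEqDiff, not_false_eq_true]
    intro u v hu hv hm1 hm2 hpos
    have := hG.feas u v hu hv (fun hc => by rw [hc.1, hmp] at hm1; omega) hpos
    omega
  · simp only [Store.set_of_ne, Store.set_eq_upd, ne_eq, Nat.reduceEqDiff, not_false_eq_true,
      IntExpr.val, upd_same]
    exact violation_val h20 h32
  · simp only [Store.set_eq_upd, upd_same, IntExpr.val]
  rintro ρ ⟨hF, hB⟩
  have hF' : Frame [26, 27, 28, 30, 31] σ ρ := Frame.trans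
    (((Frame.refl _ _).set (by decide) _ _ _).set (by decide) _ _ _) hF (List.Subset.refl _)
  simp only [Store.set_of_ne, ne_eq, Nat.reduceEqDiff, not_false_eq_true] at hB
  have e12 := hF' 12 (by decide)
  have e13 := hF' 13 (by decide)
  have e14 := hF' 14 (by decide)
  have e15 := hF' 15 (by decide)
  have e16 := hF' 16 (by decide)
  have hbest := hG.best_nonneg hmp hB
  have hle := hB.le
  refine Runs.seq ((Runs.raise (n := n) (m := m) hM hN (by rw [hF' 0 (by decide), h0])
    (by rw [hF' 1 (by decide), h1]) (by rw [e15]; exact hG.tree.mark_nonneg) ?_).mono le_rfl ?_)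
  · intro v hv
    rw [e14]
    have := hG.pi_nonneg v hv
    have := hG.bound v hv
    exact ⟨by omega, by omega⟩
  rintro ξ ⟨hF2, h14⟩
  have hF3 : Frame [14, 26, 27, 28, 30, 31] σ ξ := Frame.trans
    (hF'.mono (by decide)) hF2 (by decide)
  have f12 := hF3 12 (by decide)
  have f13 := hF3 13 (by decide)
  have f15 := hF3 15 (by decide)
  have f16 := hF3 16 (by decide)
  have f27 := hF2 27 (by decide)
  have f28 := hF2 28 (by decide)
  rw [e14, e15] at h14
  have hR := hG.raise hp₀ hmp hB
  have hrr : ξ 14 r₀ 0 = σ 14 r₀ 0 := by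
    rw [h14]
    exact raisePotential_of_marked (by rw [hG.tree.root_mark]; norm_num)
  have hpp : ξ 14 p₀ 0 = σ 14 p₀ 0 + ρ 26 0 0 := by
    rw [h14]
    exact raisePotential_of_unmarked hp₀ hmp
  refine (Runs.attach (n := n) (m := m) (M := M) (p₀ := p₀) (r₀ := r₀) hk hN
    (by rw [hF3 29 (by decide), h29]) ?_ ?_ ?_).mono le_rfl ?_
  · rw [f12, f13, f15, f16, h14]
    exact hR
  · intro h
    rw [f28] at h
    rw [f13, hrr, hpp]
    rcases hB.found with ⟨_, h2⟩ | ⟨h2, _⟩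
    · omega
    · have := h2.1
      omega
  · intro h
    rw [f28] at h
    rw [f27, f28, f15, f12, f13]
    rcases hB.found with ⟨h2, _⟩ | ⟨g1, g2, g3, g4, g5, g6⟩
    · exact absurd h2 h
    · refine ⟨g1, g2, g3, g4, g5, ?_⟩
      -- The head was raised by exactly the reduced cost of the arc, which makes it tight.
      rw [h14, raisePotential_of_unmarked g1 g4, raisePotential_of_marked g3]
      omega
  · rintro τ ⟨hF4, hG'⟩
    exact ⟨Frame.trans (hF3.mono (by decide)) hF4 (by decide), hG'⟩

theorem Runs.clearMarks (hN : ((n + m + 1 : ℕ) : ℤ) < 2 ^ b) (h0 : σ 0 0 0 = n)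
    (h1 : σ 1 0 0 = m) (h32 : σ 32 0 0 = r₀) :
    Runs b Prog.clearMarks σ ((n + m + 1) * (1 + 2) + 2 + 1) fun τ => Frame [15, 31] σ τ ∧
      ∀ v, IsNode (n + m + 1) v → τ 15 v 0 = if v = r₀ then 1 else 0 := by
  unfold Prog.clearMarks
  refine Runs.seq ((Runs.forRange (M := n + m + 1) (s := 1) (fun i ρ => Frame [15, 31] σ ρ ∧
    ∀ v : ℤ, 0 ≤ v → v < i → ρ 15 v 0 = 0) hN ?_ ?_ ?_ ?_).mono le_rfl ?_)
  · exact ⟨Frame.refl _ _, fun v hv hv' => absurd hv (not_le.2 (by simpa using hv'))⟩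
  · rintro k ρ v ⟨hF, hB⟩
    refine ⟨hF.set (by decide) _ _ _, ?_⟩
    simpa [Store.set_of_ne] using hB
  · rintro k ρ ⟨hF, -⟩
    exact nodeCount_val (by rw [hF 0 (by decide), h0]) (by rw [hF 1 (by decide), h1])
  · rintro j ρ hj ⟨hF, hz⟩ h31
    refine Runs.write (by simp [IntExpr.val]) ⟨?_, hF.set (by decide) _ _ _, fun v h2 h3 => ?_⟩
    · simp [Store.set_of_ne, h31]
    · simp only [IntExpr.val, h31, Store.set_eq_upd, upd]
      split_ifs with hv
      · rfl
      · have h3' : v < (j : ℤ) + 1 := by exact_mod_cast h3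
        have h4 : v ≠ j := fun hc => hv ⟨hc, trivial⟩
        exact hz v h2 (by omega)
  · rintro ρ ⟨hF, hz⟩
    have e32 : ρ 32 0 0 = r₀ := by rw [hF 32 (by decide), h32]
    refine Runs.write ?_ ⟨hF.set (by decide) _ _ _, fun v hv => ?_⟩
    · simp only [IntExpr.val, abs_one]
      have : (1 : ℤ) ≤ (n + m + 1 : ℕ) := by push_cast; omega
      omega
    · simp only [IntExpr.val, e32, Store.set_eq_upd, upd, and_true]
      split_ifs
      · rfl
      · exact hz v hv.1 hv.2

/-- The first write must not disturb the addresses used by the second. The pair total is invariant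
under a push, so together with nonnegativity it bounds both written entries. -/
theorem Runs.pushArc {u v : IntExpr} {x y : ℤ} {Q : Store → Prop} {ρ : Store}
    (hu : ∀ w z t, u.val (ρ.set 12 w z t) = x) (hv : ∀ w z t, v.val (ρ.set 12 w z t) = y)
    (hu' : u.val ρ = x) (hv' : v.val ρ = y) (hxy : x ≠ y)
    (h1 : 0 ≤ push (ρ 12) x y x y) (h2 : 0 ≤ push (ρ 12) x y y x)
    (h3 : ρ 12 x y + ρ 12 y x < 2 ^ b)
    (hQ : ∀ τ, Frame [12] ρ τ → τ 12 = push (ρ 12) x y → Q τ) :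
    Runs b (Prog.pushArc u v) ρ 2 Q := by
  unfold Prog.pushArc
  have htot := push_tot (res := ρ 12) hxy x y
  have e1 : push (ρ 12) x y x y = ρ 12 x y - 1 := by simp [push_apply hxy, hxy]
  have e2 : push (ρ 12) x y y x = ρ 12 y x + 1 := by simp [push_apply hxy, hxy.symm]
  refine Runs.seq (s := 1) (t := 1) (Runs.write ?_ (Runs.write ?_ ?_))
  · simp only [IntExpr.val, hu', hv']
    rw [abs_lt]
    constructor <;> omega
  · simp only [IntExpr.val, hu, hv, hu', hv', Store.set_eq_upd]
    have : upd (ρ 12) x y (ρ 12 x y - 1) y x = ρ 12 y x := by simp [upd, hxy.symm]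
    rw [this, abs_lt]
    constructor <;> omega
  · refine hQ _ (((Frame.refl _ _).set (by decide) _ _ _).set (by decide) _ _ _) ?_
    simp only [IntExpr.val, hu, hv, hu', hv', Store.set_eq_upd]
    rfl

theorem Runs.trace {M : ℤ} (hN : ((n + m + 1 : ℕ) : ℤ) < 2 ^ b)
    (h20 : σ 20 0 0 = p₀) (h32 : σ 32 0 0 = r₀)
    (hp₀ : IsNode (n + m + 1) p₀) (hr₀ : IsNode (n + m + 1) r₀) (hpr : p₀ ≠ r₀)
    (hG : Growing (n + m + 1) p₀ r₀ (σ 12) (σ 13) (σ 14) (σ 15) (σ 16) M (n + m + 1))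
    (hm : 0 < σ 15 p₀ 0) (hnn : ∀ u v, IsNode (n + m + 1) u → IsNode (n + m + 1) v → 0 ≤ σ 12 u v)
    (hres : σ 12 p₀ r₀ = 1) (hcost : ∀ u v, σ 13 u v = - σ 13 v u)
    (hcap : ∀ u v, IsNode (n + m + 1) u → IsNode (n + m + 1) v → σ 12 u v + σ 12 v u < 2 ^ b) :
    Runs b Prog.trace σ (traceSteps (n + m + 1)) fun τ => Frame [12, 33, 34] σ τ ∧
      (∀ u v, IsNode (n + m + 1) u → IsNode (n + m + 1) v → 0 ≤ τ 12 u v) ∧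
      (∀ u v, IsNode (n + m + 1) u → IsNode (n + m + 1) v → 0 < τ 12 u v →
        σ 14 v 0 ≤ σ 14 u 0 + σ 13 u v) ∧
      Circ (n + m + 1) (τ 12) (σ 12) := by
  unfold Prog.trace traceSteps
  have hT := hG.startTracing hp₀ hr₀ hpr hm hnn hres hcost
  refine Runs.seq (Runs.pushArc (x := p₀) (y := r₀) ?_ ?_ ?_ ?_ hpr
    (hT.nonneg _ _ hp₀ hr₀) (hT.nonneg _ _ hr₀ hp₀) (hcap _ _ hp₀ hr₀) ?_)
  · intro w z t
    simpa [IntExpr.val, Store.set_of_ne] using h20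
  · intro w z t
    simpa [IntExpr.val, Store.set_of_ne] using h32
  · simpa [IntExpr.val] using h20
  · simpa [IntExpr.val] using h32
  intro ρ hFρ h12ρ
  have e20 : ρ 20 0 0 = p₀ := by rw [hFρ 20 (by decide), h20]
  refine Runs.seq (Runs.assign ?_ ?_)
  · simp only [IntExpr.val, e20]
    rw [abs_of_nonneg hp₀.1]
    exact hp₀.2.trans hN
  -- The label of the current node is the fuel: it drops at each parent and is at most `n + m + 2`
  -- at `p₀`.
  let Inv : ℕ → Store → Prop := fun k τ => Frame [12, 33, 34] σ τ ∧
    Tracing (n + m + 1) r₀ (σ 12) (σ 13) (σ 14) (σ 15) (σ 16) (τ 12) (τ 33 0 0) ∧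
    σ 15 (τ 33 0 0) 0 ≤ k + 1
  refine Runs.whilePos (s := 1 + (2 + 1)) Inv ?_ ?_ (n + m + 1) _ ?_
  · rintro k τ ⟨hF, hTr, hk⟩ hpos
    have e15 := hF 15 (by decide)
    have e16 := hF 16 (by decide)
    simp only [IntExpr.val, e15] at hpos
    have hm1 : 1 < σ 15 (τ 33 0 0) 0 := by omega
    obtain ⟨g1, g2, g3, g4, g5⟩ := hG.tree.parent _ hTr.node hm1
    have hS := hTr.step hG.tree hm1 hcost
    have hne : σ 16 (τ 33 0 0) 0 ≠ τ 33 0 0 := fun hc => by rw [hc] at g3; omega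
    refine ⟨k - 1, by omega, Runs.seq (Runs.assign ?_ (Runs.seq (Runs.pushArc
      (x := σ 16 (τ 33 0 0) 0) (y := τ 33 0 0) ?_ ?_ ?_ ?_ hne ?_ ?_ ?_ ?_)))⟩
    · simp only [IntExpr.val, e16]
      rw [abs_of_nonneg g1.1]
      exact g1.2.trans hN
    · intro w z t
      simp [IntExpr.val, Store.set_of_ne, Store.set_eq_upd, upd_same, e16]
    · intro w z t
      simp [IntExpr.val, Store.set_of_ne]
    · simp [IntExpr.val, Store.set_eq_upd, upd_same, e16]
    · simp [IntExpr.val, Store.set_of_ne]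
    · simpa [Store.set_of_ne] using hS.nonneg _ _ g1 hTr.node
    · simpa [Store.set_of_ne] using hS.nonneg _ _ hTr.node g1
    · simp only [Store.set_of_ne, ne_eq, Nat.reduceEqDiff, not_false_eq_true]
      rw [hTr.tot]
      exact hcap _ _ g1 hTr.node
    · intro ξ hFξ h12ξ
      have e34 : ξ 34 0 0 = σ 16 (τ 33 0 0) 0 := by
        rw [hFξ 34 (by decide)]
        simp [IntExpr.val, Store.set_eq_upd, upd_same, e16]
      refine Runs.assign ?_ ⟨?_, ?_, ?_⟩
      · simp only [IntExpr.val, e34]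
        rw [abs_of_nonneg g1.1]
        exact g1.2.trans hN
      · exact (Frame.trans (hF.set (by decide) _ _ _) hFξ (by decide)).set (by decide) _ _ _
      · simp only [IntExpr.val, e34, Store.set_of_ne, Store.set_eq_upd, upd_same, ne_eq,
          Nat.reduceEqDiff, not_false_eq_true, h12ξ]
        exact hS
      · simp only [IntExpr.val, e34, Store.set_eq_upd, upd_same]
        omega
  · rintro k τ ⟨hF, hTr, -⟩ hneg
    simp only [IntExpr.val, hF 15 (by decide)] at hneg
    exact ⟨hF, hTr.nonneg, hTr.feas, hTr.circ hG.tree (by omega)⟩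
  · refine ⟨(Frame.trans (Frame.refl [12, 33, 34] σ) hFρ (by decide)).set (by decide) _ _ _, ?_, ?_⟩
    · simp only [IntExpr.val, e20, Store.set_of_ne, Store.set_eq_upd, upd_same, ne_eq,
          Nat.reduceEqDiff, not_false_eq_true, h12ρ]
      exact hT
    · simp only [IntExpr.val, e20, Store.set_eq_upd, upd_same]
      exact hG.mark_le p₀ hp₀

theorem Runs.insertArc {base : ℤ → ℤ → ℤ} {B W : ℤ} (hM : 2 * B + W < 2 ^ b) (hb : b ≠ 0)
    (hN : ((n + m + 1 : ℕ) : ℤ) + 1 < 2 ^ b) (h0 : σ 0 0 0 = n) (h1 : σ 1 0 0 = m)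
    (h20 : σ 20 0 0 = p₀) (h32 : σ 32 0 0 = r₀)
    (hp₀ : IsNode (n + m + 1) p₀) (hr₀ : IsNode (n + m + 1) r₀) (hpr : p₀ ≠ r₀)
    (hR : Residual (n + m + 1) (σ 12) (σ 13) (σ 14) base B)
    (hb1 : base p₀ r₀ = 0) (hb2 : base r₀ p₀ = 0) (hW0 : 0 ≤ W) (hW : - σ 13 p₀ r₀ ≤ W)
    (hcost : ∀ u v, σ 13 u v = - σ 13 v u)
    (hcap : ∀ u v, IsNode (n + m + 1) u → IsNode (n + m + 1) v →
      upd base p₀ r₀ 1 u v + upd base p₀ r₀ 1 v u < 2 ^ b) :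
    Runs b Prog.insertArc σ (insertSteps (n + m + 1)) fun τ =>
      Frame [12, 14, 15, 16, 26, 27, 28, 29, 30, 31, 33, 34] σ τ ∧
      Residual (n + m + 1) (τ 12) (τ 13) (τ 14) (upd base p₀ r₀ 1) (2 * B + W) := by
  unfold Prog.insertArc insertSteps
  have hN' : ((n + m + 1 : ℕ) : ℤ) < 2 ^ b := by omega
  have hB0 : 0 ≤ B := (hR.pi_nonneg _ hp₀).trans (hR.pi_le _ hp₀)
  refine Runs.seq (Runs.write ?_ ?_)
  · simp only [IntExpr.val, abs_one]
    have : (0 : ℤ) ≤ (n + m + 1 : ℕ) := by positivity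
    omega
  simp only [IntExpr.val, h20, h32]
  set ρ := σ.set 12 p₀ r₀ 1 with hρ
  have hFρ : Frame [12, 14, 15, 16, 26, 27, 28, 29, 30, 31, 33, 34] σ ρ :=
    (Frame.refl _ _).set (by decide) _ _ _
  have e12 : ρ 12 = upd (σ 12) p₀ r₀ 1 := Store.set_eq_upd _ _ _ _ _
  have e13 : ρ 13 = σ 13 := Store.set_of_ne (by decide)
  have e14 : ρ 14 = σ 14 := Store.set_of_ne (by decide)
  have e20 : ρ 20 0 0 = p₀ := by rw [hFρ 20 (by decide), h20]
  have e32 : ρ 32 0 0 = r₀ := by rw [hFρ 32 (by decide), h32]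
  have e0 : ρ 0 0 0 = n := by rw [hFρ 0 (by decide), h0]
  have e1 : ρ 1 0 0 = m := by rw [hFρ 1 (by decide), h1]
  clear_value ρ
  refine Runs.ifPos (fun c => ?_) fun c => (Runs.skip ⟨hFρ, ?_⟩).mono (by omega) fun _ h => h
  rotate_left
  · rw [violation_val e20 e32, e13, e14] at c
    rw [e12, e13, e14]
    have := hR.insert hp₀ hr₀ hb1 hb2 (by omega)
    exact ⟨this.nonneg, this.feas, this.circ, this.pi_nonneg, fun v hv => by
      have := this.pi_le v hv; omega⟩
  rw [violation_val e20 e32, e13, e14] at c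
  refine Runs.seq ((Runs.clearMarks (n := n) (m := m) hN' e0 e1 e32).mono le_rfl ?_)
  rintro ξ ⟨hFξ, hmark⟩
  have f12 : ξ 12 = upd (σ 12) p₀ r₀ 1 := by rw [hFξ 12 (by decide), e12]
  have f13 : ξ 13 = σ 13 := by rw [hFξ 13 (by decide), e13]
  have f14 : ξ 14 = σ 14 := by rw [hFξ 14 (by decide), e14]
  have f20 : ξ 20 0 0 = p₀ := by rw [hFξ 20 (by decide), e20]
  have f32 : ξ 32 0 0 = r₀ := by rw [hFξ 32 (by decide), e32]
  have f0 : ξ 0 0 0 = n := by rw [hFξ 0 (by decide), e0]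
  have f1 : ξ 1 0 0 = m := by rw [hFξ 1 (by decide), e1]
  have hG0 := hR.startGrowing (par := ξ 16) hp₀ hr₀ c hW hmark
  rw [← f12, ← f13, ← f14] at hG0
  refine Runs.seq ((Runs.forRange (M := n + m + 1) (fun k τ =>
    Frame [14, 15, 16, 26, 27, 28, 29, 30, 31] ξ τ ∧
      Growing (n + m + 1) p₀ r₀ (τ 12) (τ 13) (τ 14) (τ 15) (τ 16) (2 * B + W) k) hN'
    ⟨Frame.refl _ _, hG0⟩ ?_ ?_ ?_).mono le_rfl ?_)
  · rintro k τ v ⟨hF, hG⟩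
    refine ⟨hF.set (by decide) _ _ _, ?_⟩
    simpa [Store.set_of_ne] using hG
  · rintro k τ ⟨hF, -⟩
    exact nodeCount_val (by rw [hF 0 (by decide), f0]) (by rw [hF 1 (by decide), f1])
  · rintro k τ hk ⟨hF, hG⟩ h29
    -- Round `k` writes the label `k + 2`, at most one more than the number of nodes; this is the
    -- extra `1` in `hN`.
    refine (Runs.growRound (n := n) (m := m) hM (by push_cast at hN; omega) hb hN'
      (by rw [hF 0 (by decide), f0]) (by rw [hF 1 (by decide), f1])
      (by rw [hF 20 (by decide), f20]) (by rw [hF 32 (by decide), f32]) h29 hp₀ hG).mono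
      le_rfl ?_
    rintro τ' ⟨hF', hG'⟩
    exact ⟨by rw [hF' 29 (by decide), h29], Frame.trans hF hF' (by decide), hG'⟩
  rintro τ ⟨hF, hG⟩
  have hFτ : Frame [12, 14, 15, 16, 26, 27, 28, 29, 30, 31, 33, 34] σ τ :=
    Frame.trans (Frame.trans hFρ hFξ (by decide)) hF (by decide)
  have g12 : τ 12 = upd (σ 12) p₀ r₀ 1 := by rw [hF 12 (by decide), f12]
  have g13 : τ 13 = σ 13 := by rw [hF 13 (by decide), f13]
  have g20 : τ 20 0 0 = p₀ := by rw [hF 20 (by decide), f20]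
  have g32 : τ 32 0 0 = r₀ := by rw [hF 32 (by decide), f32]
  have hpile : ∀ v, IsNode (n + m + 1) v → τ 14 v 0 ≤ 2 * B + W := by
    intro v hv
    have := hG.bound v hv
    have := hG.viol
    omega
  have hcirc := hR.circ_upd hp₀ hr₀ hb1 hb2
  have hnn : ∀ u v, IsNode (n + m + 1) u → IsNode (n + m + 1) v → 0 ≤ τ 12 u v := by
    rw [g12]
    exact hR.upd_nonneg
  refine Runs.ifPos (fun c2 => ?_) fun c2 => (Runs.skip ⟨hFτ, ?_⟩).mono
    (by unfold traceSteps; omega) fun _ h => h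
  · simp only [IntExpr.val, g20] at c2
    refine (Runs.trace (n := n) (m := m) hN' g20 g32 hp₀ hr₀ hpr hG c2 hnn
      (by rw [g12, upd_same]) (by rw [g13]; exact hcost) ?_).mono le_rfl ?_
    · intro u v hu hv
      rw [g12, hcirc.tot u v hu hv]
      exact hcap u v hu hv
    · rintro τ' ⟨hF', h2, h3, h4⟩
      refine ⟨Frame.trans hFτ hF' (by decide), ?_⟩
      rw [hF' 13 (by decide), hF' 14 (by decide)]
      exact ⟨h2, h3, h4.trans (by rw [g12]; exact hcirc), hG.pi_nonneg, hpile⟩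
  · simp only [IntExpr.val, g20] at c2
    -- As `p₀` was not reached, the violation has been raised away, and the new arc is feasible
    -- without carrying flow.
    have hv := hG.done.resolve_left c2
    refine ⟨hnn, fun u v hu hv' hpos => ?_, by rw [g12]; exact hcirc, hG.pi_nonneg, hpile⟩
    by_cases huv : u = p₀ ∧ v = r₀
    · obtain ⟨rfl, rfl⟩ := huv
      omega
    · exact hG.feas u v hu hv' huv hpos

end programs

/-! ## The program: scores, costs, capacities, main loop and output -/

/-- Lets a write that copies a cell take its bit bound from the store. -/
theorem Runs.of_bdd {b s : ℕ} {c : Prog} {σ : Store} {Q : Store → Prop}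
    (h : σ.Bdd b → Runs b c σ s Q) : Runs b c σ s Q := fun hb => h hb hb

/-- `Inv i j` describes the state when all cells before `(i, j)` in row order are done; `hrow`
passes from the end of a row to the start of the next. -/
theorem Runs.forRange₂ {b s x y M M' : ℕ} {σ : Store} {c : Prog} {e e' : IntExpr}
    (Inv : ℕ → ℕ → Store → Prop) (hxy : x ≠ y) (hM : (M : ℤ) < 2 ^ b) (hM' : (M' : ℤ) < 2 ^ b)
    (h0 : Inv 0 0 σ)
    (hx : ∀ i j ρ v, Inv i j ρ → Inv i j (ρ.set x 0 0 v))
    (hy : ∀ i j ρ v, Inv i j ρ → Inv i j (ρ.set y 0 0 v))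
    (hval : ∀ i j ρ, Inv i j ρ → e.val ρ = M ∧ e'.val ρ = M')
    (hrow : ∀ i ρ, Inv i M' ρ → Inv (i + 1) 0 ρ)
    (hbody : ∀ i j ρ, i < M → j < M' → Inv i j ρ → ρ x 0 0 = i → ρ y 0 0 = j →
      Runs b c ρ s fun τ => τ x 0 0 = i ∧ τ y 0 0 = j ∧ Inv i (j + 1) τ) :
    Runs b (Prog.forRange x e (Prog.forRange y e' c)) σ (M * ((M' * (s + 2) + 2) + 2) + 2)
      (Inv M 0) := by
  refine Runs.forRange (fun i ρ => Inv i 0 ρ) hM h0 (fun i => hx i 0)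
    (fun i ρ h => (hval i 0 ρ h).1) fun i ρ hi hI hxi => ?_
  refine (Runs.forRange (M := M') (s := s) (fun j ρ => ρ x 0 0 = i ∧ Inv i j ρ) hM' ⟨hxi, hI⟩ ?_
    (fun j ρ h => (hval i j ρ h.2).2) ?_).mono le_rfl fun τ h => ⟨h.1, hrow i τ h.2⟩
  · rintro j ρ v ⟨h1, h2⟩
    exact ⟨by rw [Store.set_of_ne hxy, h1], hy _ _ _ _ h2⟩
  · rintro j ρ hj ⟨h1, h2⟩ h3
    exact (hbody i j ρ hi hj h2 h1 h3).mono le_rfl fun τ h => ⟨h.2.1, h.1, h.2.2⟩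

/-- The sum of `f` over the cells of a table with rows of length `m` that precede cell `(i, j)`. -/
def gridSum {α : Type*} [AddCommMonoid α] (m : ℕ) (f : ℕ → ℕ → α) (i j : ℕ) : α :=
  ∑ q ∈ Finset.range i, ∑ s ∈ Finset.range m, f q s + ∑ s ∈ Finset.range j, f i s

/-- The product of `f` over the cells of a table with rows of length `m` that precede `(i, j)`. -/
def gridProd (m : ℕ) (f : ℕ → ℕ → ℤ) (i j : ℕ) : ℤ :=
  (∏ q ∈ Finset.range i, ∏ s ∈ Finset.range m, f q s) * ∏ s ∈ Finset.range j, f i s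

/-! ### Partial sums and products over a table -/

section grid
variable {m : ℕ}

theorem gridSum_zero {α : Type*} [AddCommMonoid α] (f : ℕ → ℕ → α) : gridSum m f 0 0 = 0 := by
  simp [gridSum]

theorem gridSum_succ {α : Type*} [AddCommMonoid α] (f : ℕ → ℕ → α) (i j : ℕ) :
    gridSum m f i (j + 1) = gridSum m f i j + f i j := by
  simp [gridSum, Finset.sum_range_succ, add_assoc]

theorem gridSum_row {α : Type*} [AddCommMonoid α] (f : ℕ → ℕ → α) (i : ℕ) :
    gridSum m f i m = gridSum m f (i + 1) 0 := by
  simp [gridSum, Finset.sum_range_succ]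

theorem gridProd_zero (f : ℕ → ℕ → ℤ) : gridProd m f 0 0 = 1 := by
  simp [gridProd]

theorem gridProd_succ (f : ℕ → ℕ → ℤ) (i j : ℕ) :
    gridProd m f i (j + 1) = gridProd m f i j * f i j := by
  simp [gridProd, Finset.prod_range_succ, mul_assoc]

theorem gridProd_row (f : ℕ → ℕ → ℤ) (i : ℕ) : gridProd m f i m = gridProd m f (i + 1) 0 := by
  simp [gridProd, Finset.prod_range_succ]

theorem gridSum_le {α : Type*} [AddCommMonoid α] [PartialOrder α] [IsOrderedAddMonoid α]
    {f : ℕ → ℕ → α} (hf : ∀ i j, 0 ≤ f i j) {n i j : ℕ} (hi : i < n) (hj : j ≤ m) :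
    gridSum m f i j ≤ gridSum m f n 0 := by
  have h1 : gridSum m f i j ≤ gridSum m f (i + 1) 0 := by
    rw [← gridSum_row]
    unfold gridSum
    gcongr
    · intros
      exact hf _ _
  refine h1.trans ?_
  simp only [gridSum, Finset.range_zero, Finset.sum_empty, add_zero]
  refine Finset.sum_le_sum_of_subset_of_nonneg ?_ fun _ _ _ => Finset.sum_nonneg fun _ _ => hf _ _
  exact Finset.range_subset_range.2 hi

theorem abs_gridProd_le {f : ℕ → ℕ → ℤ} {l : ℕ → ℕ → ℕ} {n i j : ℕ} (hi : i < n) (hj : j ≤ m)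
    (hf : ∀ q s, q < n → s < m → |f q s| ≤ 2 ^ l q s) :
    |gridProd m f i j| ≤ 2 ^ gridSum m l i j := by
  unfold gridProd gridSum
  rw [abs_mul, pow_add, Finset.abs_prod, Finset.abs_prod, ← Finset.prod_pow_eq_pow_sum,
    ← Finset.prod_pow_eq_pow_sum]
  refine mul_le_mul ?_ ?_ (Finset.prod_nonneg fun _ _ => abs_nonneg _)
    (Finset.prod_nonneg fun _ _ => by positivity)
  · refine Finset.prod_le_prod (fun _ _ => abs_nonneg _) fun q hq => ?_
    rw [Finset.abs_prod, ← Finset.prod_pow_eq_pow_sum]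
    exact Finset.prod_le_prod (fun _ _ => abs_nonneg _) fun s hs =>
      hf q s ((Finset.mem_range.1 hq).trans hi) (Finset.mem_range.1 hs)
  · exact Finset.prod_le_prod (fun _ _ => abs_nonneg _) fun s hs =>
      hf i s hi ((Finset.mem_range.1 hs).trans_le hj)

end grid

namespace Prog

/-- The tested value, one minus a sum of two squares, is positive only if both differences vanish:
an equality test by sign. -/
def multiplyScore : Prog :=
  .ifPos (.sub (.const 1) (.add
      (.mul (.sub (.var 22) (.var 20)) (.sub (.var 22) (.var 20)))
      (.mul (.sub (.var 23) (.var 21)) (.sub (.var 23) (.var 21)))))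
    (.assign 24 (.mul (.var 24) (.cell 5 (.var 22) (.var 23))))
    (.assign 24 (.mul (.var 24) (.cell 6 (.var 22) (.var 23))))

def computeScores : Prog :=
  .forRange 20 (.var 0) (.forRange 21 (.var 1)
    (.seq (.assign 24 (.const 1))
      (.seq (.forRange 22 (.var 0) (.forRange 23 (.var 1) multiplyScore))
        (.write 11 (.var 20) (.var 21) (.var 24)))))

/-- Squares stand in for absolute values, since `|z| ≤ z * z` for integers; the initial `1` makes
the comparison strict. -/
def computeShift : Prog :=
  .seq (.assign 25 (.const 1)) (.forRange 20 (.var 0) (.forRange 21 (.var 1)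
    (.assign 25 (.add (.var 25) (.mul (.cell 11 (.var 20) (.var 21))
      (.cell 11 (.var 20) (.var 21)))))))

def computeCosts : Prog :=
  .forRange 20 (.var 0) (.forRange 21 (.var 1)
    (.seq (.write 13 (.add (.var 0) (.var 21)) (.var 20)
        (.add (.cell 11 (.var 20) (.var 21)) (.var 25)))
      (.write 13 (.var 20) (.add (.var 0) (.var 21))
        (.sub (.const 0) (.add (.cell 11 (.var 20) (.var 21)) (.var 25))))))

def computeCapacities : Prog :=
  .seq (.forRange 20 (.var 0) (.write 12 (.add (.var 0) (.var 1)) (.var 20)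
      (.cell 2 (.var 20) (.const 0))))
    (.forRange 21 (.var 1) (.write 12 (.add (.var 0) (.var 21)) (.add (.var 0) (.var 1))
      (.cell 3 (.var 21) (.const 0))))

def insertArcs : Prog :=
  .forRange 20 (.var 0) (.forRange 21 (.var 1)
    (.seq (.assign 32 (.add (.var 0) (.var 21)))
      (.ifPos (.sub (.const 1) (.cell 4 (.var 20) (.var 21))) insertArc .skip)))

/-- The answer flag is cleared if some arc from the hub to a paper keeps capacity, that is, if some
demand is unmet. -/
def output : Prog :=
  .seq (.assign 9 (.const 1))
    (.seq (.forRange 20 (.var 0)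
        (.ifPos (.cell 12 (.add (.var 0) (.var 1)) (.var 20)) (.assign 9 (.const 0)) .skip))
      (.forRange 20 (.var 0) (.forRange 21 (.var 1)
        (.write 10 (.var 20) (.var 21) (.cell 12 (.add (.var 0) (.var 21)) (.var 20))))))

def solveAssignment : Prog :=
  .seq computeScores (.seq computeShift (.seq computeCosts (.seq computeCapacities
    (.seq insertArcs output))))

end Prog

/-- The factor of cell `(q, s)` in the score of `(p, r)` over the common denominator. -/
def scoreFactor (num den : ℤ → ℤ → ℤ) (p r q s : ℕ) : ℤ :=
  if q = p ∧ s = r then num q s else den q s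

/-- The score of `(p, r)` over the common denominator of all scores. -/
def commonScore (n m : ℕ) (num den : ℤ → ℤ → ℤ) (p r : ℕ) : ℤ :=
  gridProd m (scoreFactor num den p r) n 0

/-! ### Verification of the preparation, the main loop and the output -/

section programs
variable {b n m : ℕ} {σ : Store}

theorem Runs.multiplyScore {ρ : Store} {p r q s : ℕ} {f v : ℤ} {num den : ℤ → ℤ → ℤ}
    (h5 : ρ 5 = num) (h6 : ρ 6 = den) (h20 : ρ 20 0 0 = p) (h21 : ρ 21 0 0 = r)
    (h22 : ρ 22 0 0 = q) (h23 : ρ 23 0 0 = s) (h24 : ρ 24 0 0 = v)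
    (hf : f = scoreFactor num den p r q s) (hv : |v * f| < 2 ^ b) :
    Runs b Prog.multiplyScore ρ 2 fun τ => τ = ρ.set 24 0 0 (v * f) := by
  refine Runs.ifPos (s := 1) (fun c => ?_) fun c => ?_
  · simp only [IntExpr.val, h20, h21, h22, h23] at c
    have hq : (q : ℤ) - p = 0 := by
      nlinarith [mul_self_nonneg ((q : ℤ) - p), mul_self_nonneg ((s : ℤ) - r)]
    have hs : (s : ℤ) - r = 0 := by
      nlinarith [mul_self_nonneg ((q : ℤ) - p), mul_self_nonneg ((s : ℤ) - r)]
    have hf' : f = num q s := by rw [hf, scoreFactor, if_pos ⟨by omega, by omega⟩]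
    refine Runs.assign ?_ ?_ <;> simp only [IntExpr.val, h22, h23, h24, h5, ← hf']
    exact hv
  · simp only [IntExpr.val, h20, h21, h22, h23] at c
    have hf' : f = den q s := by
      rw [hf, scoreFactor, if_neg]
      rintro ⟨rfl, rfl⟩
      simp at c
    refine Runs.assign ?_ ?_ <;> simp only [IntExpr.val, h22, h23, h24, h6, ← hf']
    exact hv

theorem Runs.computeScores (hn : (n : ℤ) < 2 ^ b) (hm : (m : ℤ) < 2 ^ b) (hb : b ≠ 0)
    (h0 : σ 0 0 0 = n) (h1 : σ 1 0 0 = m) {l : ℕ → ℕ → ℕ}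
    (h5 : ∀ q s : ℕ, q < n → s < m → |σ 5 q s| ≤ 2 ^ l q s)
    (h6 : ∀ q s : ℕ, q < n → s < m → |σ 6 q s| ≤ 2 ^ l q s)
    (hl : gridSum m l n 0 < b) :
    Runs b Prog.computeScores σ
      (n * ((m * ((1 + ((n * ((m * (2 + 2) + 2) + 2) + 2) + 1)) + 2) + 2) + 2) + 2) fun τ =>
      Frame [11, 20, 21, 22, 23, 24] σ τ ∧
      ∀ p r : ℕ, p < n → r < m → τ 11 p r = commonScore n m (σ 5) (σ 6) p r := by
  have hfac : ∀ p r q s : ℕ, q < n → s < m → |scoreFactor (σ 5) (σ 6) p r q s| ≤ 2 ^ l q s := by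
    intro p r q s hq hs
    unfold scoreFactor
    split_ifs
    exacts [h5 q s hq hs, h6 q s hq hs]
  have hbound : ∀ p r i j : ℕ, i < n → j ≤ m →
      |gridProd m (scoreFactor (σ 5) (σ 6) p r) i j| < 2 ^ b := by
    intro p r i j hi hj
    refine (abs_gridProd_le hi hj (hfac p r)).trans_lt ?_
    exact pow_lt_pow_right₀ (by norm_num)
      ((gridSum_le (fun _ _ => Nat.zero_le _) hi hj).trans_lt hl)
  refine (Runs.forRange₂ (M := n) (M' := m) (fun i j ρ => Frame [11, 20, 21, 22, 23, 24] σ ρ ∧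
    ∀ p r : ℕ, r < m → p < i ∨ p = i ∧ r < j → ρ 11 p r = commonScore n m (σ 5) (σ 6) p r)
    (by decide) hn hm ?_ ?_ ?_ ?_ ?_ ?_).mono le_rfl ?_
  · exact ⟨Frame.refl _ _, fun p r _ h => by omega⟩
  · rintro i j ρ v ⟨hF, hI⟩
    exact ⟨hF.set (by decide) _ _ _, by simpa [Store.set_of_ne] using hI⟩
  · rintro i j ρ v ⟨hF, hI⟩
    exact ⟨hF.set (by decide) _ _ _, by simpa [Store.set_of_ne] using hI⟩
  · rintro i j ρ ⟨hF, -⟩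
    simp only [IntExpr.val]
    rw [hF 0 (by decide), hF 1 (by decide)]
    exact ⟨h0, h1⟩
  · rintro i ρ ⟨hF, hI⟩
    exact ⟨hF, fun p r hr h => hI p r hr (by omega)⟩
  · rintro i j ρ hi hj ⟨hF, hI⟩ h20 h21
    refine Runs.seq (Runs.assign ?_ ?_)
    · simp only [IntExpr.val, abs_one]
      exact one_lt_pow₀ (by norm_num) hb
    refine Runs.seq ((Runs.forRange₂ (M := n) (M' := m) (s := 2) (fun q s ξ =>
      Frame [22, 23, 24] ρ ξ ∧ (q < n ∨ q = n ∧ s = 0) ∧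
      ξ 24 0 0 = gridProd m (scoreFactor (σ 5) (σ 6) i j) q s)
      (by decide) hn hm ?_ ?_ ?_ ?_ ?_ ?_).mono le_rfl ?_)
    · refine ⟨(Frame.refl _ _).set (by decide) _ _ _, by omega, ?_⟩
      rw [gridProd_zero, Store.set_eq_upd, upd_same]
      rfl
    · rintro q s ξ v ⟨hF', hq, hI'⟩
      exact ⟨hF'.set (by decide) _ _ _, hq, by simpa [Store.set_of_ne] using hI'⟩
    · rintro q s ξ v ⟨hF', hq, hI'⟩
      exact ⟨hF'.set (by decide) _ _ _, hq, by simpa [Store.set_of_ne] using hI'⟩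
    · rintro q s ξ ⟨hF', -⟩
      simp only [IntExpr.val]
      rw [hF' 0 (by decide), hF' 1 (by decide), hF 0 (by decide), hF 1 (by decide)]
      exact ⟨h0, h1⟩
    · rintro q ξ ⟨hF', hq, hI'⟩
      exact ⟨hF', by omega, by rw [hI', gridProd_row]⟩
    · rintro q s ξ hq hs ⟨hF', -, hI'⟩ h22 h23
      refine (Runs.multiplyScore (num := σ 5) (den := σ 6) (p := i) (r := j) ?_ ?_ ?_ ?_ h22 h23 hI'
        rfl ?_).mono le_rfl ?_
      · rw [hF' 5 (by decide), hF 5 (by decide)]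
      · rw [hF' 6 (by decide), hF 6 (by decide)]
      · rw [hF' 20 (by decide), h20]
      · rw [hF' 21 (by decide), h21]
      · rw [← gridProd_succ]
        exact hbound i j q (s + 1) hq hs
      · rintro τ rfl
        refine ⟨by simpa [Store.set_of_ne] using h22, by simpa [Store.set_of_ne] using h23,
          hF'.set (by decide) _ _ _, Or.inl hq, ?_⟩
        rw [Store.set_eq_upd, upd_same, gridProd_succ]
    · rintro ξ ⟨hF', -, hI'⟩
      have e20 : ξ 20 0 0 = i := by rw [hF' 20 (by decide), h20]
      have e21 : ξ 21 0 0 = j := by rw [hF' 21 (by decide), h21]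
      refine Runs.of_bdd fun hbd => Runs.write (hbd _ _ _) ⟨?_, ?_, ?_, ?_⟩
      · simpa [Store.set_of_ne] using e20
      · simpa [Store.set_of_ne] using e21
      · exact (Frame.trans hF hF' (by decide)).set (by decide) _ _ _
      · intro p r hr h
        simp only [IntExpr.val, e20, e21, Store.set_eq_upd, upd, hI']
        by_cases hpr : p = i ∧ r = j
        · obtain ⟨rfl, rfl⟩ := hpr
          simp [commonScore]
        · rw [if_neg (by omega), hF' 11 (by decide)]
          exact hI p r hr (by omega)
  · rintro τ ⟨hF, hI⟩
    exact ⟨hF, fun p r hp hr => hI p r hr (Or.inl hp)⟩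

theorem Runs.computeShift (hn : (n : ℤ) < 2 ^ b) (hm : (m : ℤ) < 2 ^ b) (hb : b ≠ 0)
    (h0 : σ 0 0 0 = n) (h1 : σ 1 0 0 = m)
    (hbig : 1 + gridSum m (fun p r : ℕ => σ 11 p r * σ 11 p r) n 0 < 2 ^ b) :
    Runs b Prog.computeShift σ (1 + (n * ((m * (1 + 2) + 2) + 2) + 2)) fun τ =>
      Frame [20, 21, 25] σ τ ∧
      τ 25 0 0 = 1 + gridSum m (fun p r : ℕ => σ 11 p r * σ 11 p r) n 0 := by
  refine Runs.seq (Runs.assign ?_ ?_)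
  · simp only [IntExpr.val, abs_one]
    exact one_lt_pow₀ (by norm_num) hb
  refine (Runs.forRange₂ (M := n) (M' := m) (s := 1) (fun i j ρ => Frame [20, 21, 25] σ ρ ∧
      ρ 25 0 0 = 1 + gridSum m (fun p r : ℕ => σ 11 p r * σ 11 p r) i j)
    (by decide) hn hm ?_ ?_ ?_ ?_ ?_ ?_).mono le_rfl fun τ h => h
  · refine ⟨(Frame.refl _ _).set (by decide) _ _ _, ?_⟩
    rw [gridSum_zero, Store.set_eq_upd, upd_same]
    rfl
  · rintro i j ρ v ⟨hF, hI⟩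
    exact ⟨hF.set (by decide) _ _ _, by simpa [Store.set_of_ne] using hI⟩
  · rintro i j ρ v ⟨hF, hI⟩
    exact ⟨hF.set (by decide) _ _ _, by simpa [Store.set_of_ne] using hI⟩
  · rintro i j ρ ⟨hF, -⟩
    simp only [IntExpr.val]
    rw [hF 0 (by decide), hF 1 (by decide)]
    exact ⟨h0, h1⟩
  · rintro i ρ ⟨hF, hI⟩
    exact ⟨hF, by rw [hI, gridSum_row]⟩
  · rintro i j ρ hi hj ⟨hF, hI⟩ h20 h21
    have hnn : ∀ p r : ℕ, 0 ≤ σ 11 p r * σ 11 p r := fun p r => mul_self_nonneg _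
    have hle := gridSum_le hnn hi (Nat.succ_le_of_lt hj)
    have h0' : 0 ≤ gridSum m (fun p r : ℕ => σ 11 p r * σ 11 p r) i (j + 1) := by
      unfold gridSum
      exact add_nonneg (Finset.sum_nonneg fun _ _ => Finset.sum_nonneg fun _ _ => hnn _ _)
        (Finset.sum_nonneg fun _ _ => hnn _ _)
    have hv : 1 + gridSum m (fun p r : ℕ => σ 11 p r * σ 11 p r) i j + σ 11 i j * σ 11 i j
        = 1 + gridSum m (fun p r : ℕ => σ 11 p r * σ 11 p r) i (j + 1) := by
      rw [gridSum_succ, add_assoc]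
    refine Runs.assign ?_ ⟨by simpa [Store.set_of_ne] using h20,
      by simpa [Store.set_of_ne] using h21, hF.set (by decide) _ _ _, ?_⟩
    · simp only [IntExpr.val, h20, h21, hI, hF 11 (by decide), hv]
      rw [abs_of_nonneg (by omega)]
      exact lt_of_le_of_lt (by simpa using hle) hbig
    · simp only [IntExpr.val, h20, h21, hI, hF 11 (by decide), hv, Store.set_eq_upd, upd_same]

theorem Runs.computeCosts {W : ℤ} (hn : (n : ℤ) < 2 ^ b) (hm : (m : ℤ) < 2 ^ b)
    (h0 : σ 0 0 0 = n) (h1 : σ 1 0 0 = m) (h13 : ∀ u v, σ 13 u v = 0) (hW : W < 2 ^ b)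
    (hscore : ∀ p r : ℕ, p < n → r < m → |σ 11 p r + σ 25 0 0| ≤ W) :
    Runs b Prog.computeCosts σ (n * ((m * ((1 + 1) + 2) + 2) + 2) + 2) fun τ =>
      Frame [13, 20, 21] σ τ ∧ (∀ u v, τ 13 u v = - τ 13 v u) ∧
      (∀ x : ℕ, τ 13 x (n + m) = 0) ∧
      ∀ p r : ℕ, p < n → r < m → τ 13 (n + r) p = σ 11 p r + σ 25 0 0 := by
  refine (Runs.forRange₂ (M := n) (M' := m) (s := 1 + 1) (fun i j ρ => Frame [13, 20, 21] σ ρ ∧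
      (∀ u v, ρ 13 u v = - ρ 13 v u) ∧ (∀ x : ℕ, ρ 13 x (n + m) = 0) ∧
      ∀ p r : ℕ, r < m → p < i ∨ p = i ∧ r < j → ρ 13 (n + r) p = σ 11 p r + σ 25 0 0)
    (by decide) hn hm ?_ ?_ ?_ ?_ ?_ ?_).mono le_rfl ?_
  · exact ⟨Frame.refl _ _, fun u v => by simp [h13], fun x => h13 _ _, fun p r _ h => by omega⟩
  · rintro i j ρ v ⟨hF, hI⟩
    exact ⟨hF.set (by decide) _ _ _, by simpa [Store.set_of_ne] using hI⟩
  · rintro i j ρ v ⟨hF, hI⟩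
    exact ⟨hF.set (by decide) _ _ _, by simpa [Store.set_of_ne] using hI⟩
  · rintro i j ρ ⟨hF, -⟩
    simp only [IntExpr.val]
    rw [hF 0 (by decide), hF 1 (by decide)]
    exact ⟨h0, h1⟩
  · rintro i ρ ⟨hF, h2, h3, hI⟩
    exact ⟨hF, h2, h3, fun p r hr h => hI p r hr (by omega)⟩
  · rintro i j ρ hi hj ⟨hF, hanti, hhub, hI⟩ h20 h21
    have e0 : ρ 0 0 0 = n := by rw [hF 0 (by decide), h0]
    have e11 := hF 11 (by decide)
    have e25 := hF 25 (by decide)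
    have hs := (hscore i j hi hj).trans_lt hW
    refine Runs.seq (Runs.write ?_ (Runs.write ?_ ⟨?_, ?_, ?_, ?_, ?_, ?_⟩))
    · simpa only [IntExpr.val, h20, h21, e11, e25] using hs
    · simp only [IntExpr.val, Store.set_of_ne, ne_eq, Nat.reduceEqDiff, not_false_eq_true, h20,
        h21, e11, e25, zero_sub, abs_neg]
      exact hs
    · simpa [Store.set_of_ne] using h20
    · simpa [Store.set_of_ne] using h21
    · exact (hF.set (by decide) _ _ _).set (by decide) _ _ _
    all_goals
      simp only [IntExpr.val, Store.set_of_ne, Store.set_eq_upd, ne_eq, Nat.reduceEqDiff,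
        not_false_eq_true, h20, h21, e11, e25, e0, zero_sub, upd]
    · intro u v
      have := hanti u v
      split_ifs <;> omega
    · intro x
      rw [if_neg (by omega), if_neg (by omega)]
      exact hhub x
    · intro p r hr h
      by_cases hpr : p = i ∧ r = j
      · obtain ⟨rfl, rfl⟩ := hpr
        rw [if_neg (by omega), if_pos ⟨rfl, rfl⟩]
      · rw [if_neg (by omega), if_neg (by omega)]
        exact hI p r hr (by omega)
  · rintro τ ⟨hF, h2, h3, hI⟩
    exact ⟨hF, h2, h3, fun p r hp hr => hI p r hr (Or.inl hp)⟩

/-- The capacities of the arcs from the hub to the first `i` papers and from the first `j` reviewers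
to the hub. -/
def hubNet (n m : ℕ) (cov load : ℤ → ℤ → ℤ) (i j : ℕ) : ℤ → ℤ → ℤ := fun x y =>
  if x = n + m ∧ IsNode i y then cov y 0
  else if y = n + m ∧ n ≤ x ∧ x < n + j then load (x - n) 0
  else 0

theorem hubNet_eq_assignmentNet (cov load conf : ℤ → ℤ → ℤ) :
    hubNet n m cov load n m = assignmentNet n m cov load conf 0 0 := by
  funext x y
  unfold hubNet assignmentNet
  have : ∀ φ : Prop, ¬ (IsNode n x ∧ (n ≤ y ∧ y < n + m) ∧ φ ∧
      (x < (0 : ℕ) ∨ x = (0 : ℕ) ∧ y - n < (0 : ℕ))) := by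
    rintro φ ⟨h1, h2, -, h3⟩
    push_cast at h3
    omega
  simp only [this, if_false]

theorem Runs.computeCapacities (hn : (n : ℤ) < 2 ^ b) (hm : (m : ℤ) < 2 ^ b)
    (h0 : σ 0 0 0 = n) (h1 : σ 1 0 0 = m) (h12 : ∀ u v, σ 12 u v = 0) (conf : ℤ → ℤ → ℤ) :
    Runs b Prog.computeCapacities σ (n * (1 + 2) + 2 + (m * (1 + 2) + 2)) fun τ =>
      Frame [12, 20, 21] σ τ ∧ τ 12 = assignmentNet n m (σ 2) (σ 3) conf 0 0 := by
  refine Runs.seq ((Runs.forRange (M := n) (s := 1) (fun i ρ => Frame [12, 20, 21] σ ρ ∧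
    ρ 12 = hubNet n m (σ 2) (σ 3) i 0) hn ?_ ?_ ?_ ?_).mono le_rfl ?_)
  · refine ⟨Frame.refl _ _, ?_⟩
    funext x y
    unfold hubNet
    rw [h12, if_neg, if_neg]
    · push_cast
      omega
    · rintro ⟨_, _, _⟩
      omega
  · rintro i ρ v ⟨hF, hI⟩
    exact ⟨hF.set (by decide) _ _ _, by simpa [Store.set_of_ne] using hI⟩
  · rintro i ρ ⟨hF, -⟩
    simp only [IntExpr.val]
    rw [hF 0 (by decide), h0]
  · rintro i ρ hi ⟨hF, hI⟩ h20
    have e0 : ρ 0 0 0 = n := by rw [hF 0 (by decide), h0]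
    have e1 : ρ 1 0 0 = m := by rw [hF 1 (by decide), h1]
    refine Runs.of_bdd fun hbd => Runs.write (hbd _ _ _) ⟨by simpa [Store.set_of_ne] using h20,
      hF.set (by decide) _ _ _, ?_⟩
    simp only [IntExpr.val, Store.set_eq_upd, h20, e0, e1, hI, hF 2 (by decide)]
    funext x y
    unfold upd hubNet
    by_cases hxy : x = n + m ∧ y = i
    · obtain ⟨rfl, rfl⟩ := hxy
      rw [if_pos ⟨rfl, rfl⟩, if_pos ⟨rfl, by constructor <;> push_cast <;> omega⟩]
    · rw [if_neg hxy]
      refine if_congr ⟨?_, ?_⟩ rfl rfl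
      · rintro ⟨h, _, _⟩
        exact ⟨h, by omega, by push_cast; omega⟩
      · rintro ⟨h, h', h''⟩
        push_cast at h''
        exact ⟨h, h', by omega⟩
  rintro ξ ⟨hFξ, hξ⟩
  refine (Runs.forRange (M := m) (s := 1) (fun j ρ => Frame [12, 20, 21] σ ρ ∧
    ρ 12 = hubNet n m (σ 2) (σ 3) n j) hm ⟨hFξ, hξ⟩ ?_ ?_ ?_).mono le_rfl ?_
  · rintro i ρ v ⟨hF, hI⟩
    exact ⟨hF.set (by decide) _ _ _, by simpa [Store.set_of_ne] using hI⟩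
  · rintro i ρ ⟨hF, -⟩
    simp only [IntExpr.val]
    rw [hF 1 (by decide), h1]
  · rintro j ρ hj ⟨hF, hI⟩ h21
    have e0 : ρ 0 0 0 = n := by rw [hF 0 (by decide), h0]
    have e1 : ρ 1 0 0 = m := by rw [hF 1 (by decide), h1]
    refine Runs.of_bdd fun hbd => Runs.write (hbd _ _ _) ⟨by simpa [Store.set_of_ne] using h21,
      hF.set (by decide) _ _ _, ?_⟩
    simp only [IntExpr.val, Store.set_eq_upd, h21, e0, e1, hI, hF 3 (by decide)]
    funext x y
    unfold upd hubNet
    by_cases hxy : x = n + j ∧ y = n + m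
    · obtain ⟨rfl, rfl⟩ := hxy
      rw [if_pos ⟨rfl, rfl⟩, if_neg (by omega), if_pos ⟨rfl, by push_cast; omega⟩]
      congr 1
      ring
    · rw [if_neg hxy]
      refine if_congr Iff.rfl rfl (if_congr ⟨?_, ?_⟩ rfl rfl)
      · rintro ⟨h, _, _⟩
        exact ⟨h, by omega, by push_cast; omega⟩
      · rintro ⟨h, h', h''⟩
        push_cast at h''
        exact ⟨h, h', by omega⟩
  · rintro τ ⟨hF, hI⟩
    exact ⟨hF, by rw [hI, hubNet_eq_assignmentNet]⟩

theorem Residual.mono {N : ℕ} {res cost pi base : ℤ → ℤ → ℤ} {B B' : ℤ}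
    (h : Residual N res cost pi base B) (hB : B ≤ B') : Residual N res cost pi base B' :=
  ⟨h.nonneg, h.feas, h.circ, h.pi_nonneg, fun v hv => (h.pi_le v hv).trans hB⟩

/-- At first only hub arcs are open and they cost nothing, so zero potentials are feasible. -/
theorem Residual.start {cov load conf cost pi : ℤ → ℤ → ℤ} (hcov : ∀ x, 0 ≤ cov x 0)
    (hload : ∀ x, 0 ≤ load x 0) (hcost : ∀ u v, cost u v = - cost v u)
    (hhub : ∀ x : ℕ, cost x (n + m) = 0) (hpi : ∀ u v, pi u v = 0) :
    Residual (n + m + 1) (assignmentNet n m cov load conf 0 0) cost pi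
      (assignmentNet n m cov load conf 0 0) 0 := by
  refine ⟨fun u v _ _ => assignmentNet_nonneg hcov hload _ _ _ _, fun u v hu hv hpos => ?_,
    ⟨fun _ _ _ _ => rfl, fun _ _ => rfl, fun _ _ => rfl⟩, fun v _ => (hpi v 0).ge,
    fun v _ => (hpi v 0).le⟩
  rw [hpi, hpi, zero_add]
  rw [← hubNet_eq_assignmentNet] at hpos
  unfold hubNet at hpos
  split_ifs at hpos with h1 h2
  · obtain ⟨rfl, h1⟩ := h1
    have := hhub v.toNat
    rw [Int.toNat_of_nonneg hv.1] at this
    rw [hcost, this, neg_zero]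
  · obtain ⟨rfl, h2⟩ := h2
    have := hhub u.toNat
    rw [Int.toNat_of_nonneg hu.1] at this
    rw [this]
  · exact absurd hpos (lt_irrefl _)

/-- Iterating `B ↦ 2 * B + W` from `0` gives `W * (2 ^ k - 1)` after `k` cells. The factor `2` in
`hc` accommodates pair totals of two capacities. -/
theorem Runs.insertArcs {W c : ℤ} (hb : b ≠ 0) (hN : ((n + m + 1 : ℕ) : ℤ) + 1 < 2 ^ b)
    (h0 : σ 0 0 0 = n) (h1 : σ 1 0 0 = m)
    (hc1 : 1 ≤ c) (hcov : ∀ x, σ 2 x 0 ≤ c) (hload : ∀ x, σ 3 x 0 ≤ c) (hc : 2 * c < 2 ^ b)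
    (hcost : ∀ u v, σ 13 u v = - σ 13 v u) (hW0 : 0 ≤ W)
    (hW : ∀ p r : ℕ, p < n → r < m → σ 13 (n + r) p ≤ W) (hWb : W * 2 ^ (n * m) < 2 ^ b)
    (hR : Residual (n + m + 1) (σ 12) (σ 13) (σ 14) (assignmentNet n m (σ 2) (σ 3) (σ 4) 0 0) 0) :
    Runs b Prog.insertArcs σ
      (n * ((m * ((1 + (insertSteps (n + m + 1) + 1)) + 2) + 2) + 2) + 2) fun τ =>
      Frame [12, 14, 15, 16, 20, 21, 26, 27, 28, 29, 30, 31, 32, 33, 34] σ τ ∧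
      Residual (n + m + 1) (τ 12) (τ 13) (τ 14) (assignmentNet n m (σ 2) (σ 3) (σ 4) n 0)
        (W * (2 ^ (n * m) - 1)) := by
  have hn : (n : ℤ) < 2 ^ b := by push_cast at hN; omega
  have hm : (m : ℤ) < 2 ^ b := by push_cast at hN; omega
  refine (Runs.forRange₂ (M := n) (M' := m) (fun i j ρ =>
    Frame [12, 14, 15, 16, 20, 21, 26, 27, 28, 29, 30, 31, 32, 33, 34] σ ρ ∧
      Residual (n + m + 1) (ρ 12) (ρ 13) (ρ 14) (assignmentNet n m (σ 2) (σ 3) (σ 4) i j)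
        (W * (2 ^ (i * m + j) - 1)))
    (by decide) hn hm ?_ ?_ ?_ ?_ ?_ ?_).mono le_rfl ?_
  · refine ⟨Frame.refl _ _, ?_⟩
    simpa using hR
  · rintro i j ρ v ⟨hF, hI⟩
    exact ⟨hF.set (by decide) _ _ _, by simpa [Store.set_of_ne] using hI⟩
  · rintro i j ρ v ⟨hF, hI⟩
    exact ⟨hF.set (by decide) _ _ _, by simpa [Store.set_of_ne] using hI⟩
  · rintro i j ρ ⟨hF, -⟩
    simp only [IntExpr.val]
    rw [hF 0 (by decide), hF 1 (by decide)]
    exact ⟨h0, h1⟩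
  · rintro i ρ ⟨hF, hI⟩
    refine ⟨hF, ?_⟩
    rw [← assignmentNet_row, add_zero, Nat.succ_mul]
    exact hI
  · rintro i j ρ hi hj ⟨hF, hI⟩ h20 h21
    have hstep : 2 * (W * (2 ^ (i * m + j) - 1)) + W = W * (2 ^ (i * m + (j + 1)) - 1) := by
      rw [← add_assoc, pow_succ]
      ring
    have hk : i * m + (j + 1) ≤ n * m := by
      calc i * m + (j + 1) ≤ i * m + m := by omega
        _ = (i + 1) * m := by ring
        _ ≤ n * m := Nat.mul_le_mul_right _ hi
    have hbnd : W * (2 ^ (i * m + (j + 1)) - 1) < 2 ^ b := by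
      refine lt_of_le_of_lt (mul_le_mul_of_nonneg_left ?_ hW0) hWb
      have : (2 : ℤ) ^ (i * m + (j + 1)) ≤ 2 ^ (n * m) := pow_le_pow_right₀ (by norm_num) hk
      omega
    have hle : W * (2 ^ (i * m + j) - 1) ≤ W * (2 ^ (i * m + (j + 1)) - 1) := by
      refine mul_le_mul_of_nonneg_left ?_ hW0
      have : (2 : ℤ) ^ (i * m + j) ≤ 2 ^ (i * m + (j + 1)) :=
        pow_le_pow_right₀ (by norm_num) (by omega)
      omega
    have e0 : ρ 0 0 0 = n := by rw [hF 0 (by decide), h0]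
    have e4 := hF 4 (by decide)
    have e13 := hF 13 (by decide)
    refine Runs.seq (Runs.assign ?_ ?_)
    · simp only [IntExpr.val, e0, h21]
      rw [abs_of_nonneg (by positivity)]
      push_cast at hN
      omega
    simp only [IntExpr.val, e0, h21]
    set ξ := ρ.set 32 0 0 ((n : ℤ) + j) with hξ
    have hFξ : Frame [32] ρ ξ := (Frame.refl _ _).set (by decide) _ _ _
    have f32 : ξ 32 0 0 = (n : ℤ) + j := Store.set_same _ _ _ _ _
    have hF' := Frame.trans hF hFξ (by decide)
    clear_value ξ
    have f12 := hFξ 12 (by decide)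
    have f13 := hFξ 13 (by decide)
    have f14 := hFξ 14 (by decide)
    have f20 : ξ 20 0 0 = i := by rw [hFξ 20 (by decide), h20]
    have f21 : ξ 21 0 0 = j := by rw [hFξ 21 (by decide), h21]
    have f4 := hF' 4 (by decide)
    refine Runs.ifPos (fun cc => ?_) fun cc => ?_
    · simp only [IntExpr.val, f20, f21, f4] at cc
      have hins := assignmentNet_insert (cov := σ 2) (load := σ 3) hi hj
        (conf := σ 4) (by omega)
      refine (Runs.insertArc (n := n) (m := m) (W := W) (B := W * (2 ^ (i * m + j) - 1))
        (base := assignmentNet n m (σ 2) (σ 3) (σ 4) i j) (by rw [hstep]; exact hbnd) hb hN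
        (by rw [hF' 0 (by decide), h0]) (by rw [hF' 1 (by decide), h1]) f20 f32
        ⟨by omega, by push_cast; omega⟩ ⟨by omega, by push_cast; omega⟩ (by omega)
        (by rw [f12, f13, f14]; exact hI) (assignmentNet_new hi) (assignmentNet_new_rev hi hj) hW0
        ?_ ?_ ?_).mono le_rfl ?_
      · rw [f13, e13, ← hcost]
        exact hW i j hi hj
      · rw [f13, e13]
        exact hcost
      · intro u v _ _
        rw [hins]
        have := assignmentNet_le (conf := σ 4) (n := n) (m := m) hc1 hcov hload i (j + 1) u v
        have := assignmentNet_le (conf := σ 4) (n := n) (m := m) hc1 hcov hload i (j + 1) v u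
        omega
      · rintro τ ⟨hFτ, hRτ⟩
        rw [hins, hstep] at hRτ
        exact ⟨by rw [hFτ 20 (by decide), f20], by rw [hFτ 21 (by decide), f21],
          Frame.trans hF' hFτ (by decide), hRτ⟩
    · simp only [IntExpr.val, f20, f21, f4] at cc
      -- At a conflict the network is unchanged; the bound counts cells rather than insertions and
      -- is merely relaxed.
      refine (Runs.skip ⟨f20, f21, hF', ?_⟩).mono (by unfold insertSteps; omega) fun _ h => h
      rw [f12, f13, f14, ← assignmentNet_skip (by omega)]
      exact hI.mono hle
  · rintro τ ⟨hF, hI⟩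
    exact ⟨hF, by simpa using hI⟩

theorem Runs.output (hb : b ≠ 0) (hn : (n : ℤ) < 2 ^ b) (hm : (m : ℤ) < 2 ^ b)
    (h0 : σ 0 0 0 = n) (h1 : σ 1 0 0 = m) :
    Runs b Prog.output σ (1 + (n * (2 + 2) + 2 + (n * ((m * (1 + 2) + 2) + 2) + 2))) fun τ =>
      ((∀ p : ℕ, p < n → ¬ 0 < σ 12 (n + m) p) → τ 9 0 0 = 1) ∧
      (¬ (∀ p : ℕ, p < n → ¬ 0 < σ 12 (n + m) p) → τ 9 0 0 = 0) ∧
      ∀ p r : ℕ, p < n → r < m → τ 10 p r = σ 12 (n + r) p := by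
  refine Runs.seq (Runs.assign ?_ (Runs.seq ((Runs.forRange (M := n) (s := 2) (fun i ρ =>
    Frame [9, 20] σ ρ ∧ ((∀ p : ℕ, p < i → ¬ 0 < σ 12 (n + m) p) → ρ 9 0 0 = 1) ∧
      (¬ (∀ p : ℕ, p < i → ¬ 0 < σ 12 (n + m) p) → ρ 9 0 0 = 0)) hn ?_ ?_ ?_ ?_).mono le_rfl ?_)))
  · simp only [IntExpr.val, abs_one]
    exact one_lt_pow₀ (by norm_num) hb
  · refine ⟨(Frame.refl _ _).set (by decide) _ _ _, fun _ => ?_, fun h => absurd ?_ h⟩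
    · rw [Store.set_eq_upd, upd_same]
      rfl
    · intro p hp
      omega
  · rintro i ρ v ⟨hF, hI⟩
    exact ⟨hF.set (by decide) _ _ _, by simpa [Store.set_of_ne] using hI⟩
  · rintro i ρ ⟨hF, -⟩
    simp only [IntExpr.val]
    rw [hF 0 (by decide), h0]
  · rintro i ρ hi ⟨hF, h2, h3⟩ h20
    have e0 : ρ 0 0 0 = n := by rw [hF 0 (by decide), h0]
    have e1 : ρ 1 0 0 = m := by rw [hF 1 (by decide), h1]
    have e12 := hF 12 (by decide)
    refine Runs.ifPos (s := 1) (fun c => ?_) fun c => ?_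
    · simp only [IntExpr.val, e0, e1, h20, e12] at c
      refine Runs.assign (by simp [IntExpr.val]) ⟨by simpa [Store.set_of_ne] using h20,
        hF.set (by decide) _ _ _, fun h => absurd c (h i (Nat.lt_succ_self i)), fun _ => ?_⟩
      rw [Store.set_eq_upd, upd_same]
      rfl
    · simp only [IntExpr.val, e0, e1, h20, e12] at c
      have hiff : (∀ p : ℕ, p < i + 1 → ¬ 0 < σ 12 (n + m) p) ↔
          ∀ p : ℕ, p < i → ¬ 0 < σ 12 (n + m) p := by
        refine ⟨fun h p hp => h p (by omega), fun h p hp => ?_⟩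
        rcases Nat.lt_succ_iff_lt_or_eq.1 hp with hp | rfl
        · exact h p hp
        · exact c
      exact Runs.skip ⟨h20, hF, by rw [hiff]; exact h2, by rw [hiff]; exact h3⟩
  rintro ξ ⟨hFξ, h2, h3⟩
  refine (Runs.forRange₂ (M := n) (M' := m) (s := 1) (fun i j ρ => Frame [10, 20, 21] ξ ρ ∧
    ∀ p r : ℕ, r < m → p < i ∨ p = i ∧ r < j → ρ 10 p r = σ 12 (n + r) p)
    (by decide) hn hm ?_ ?_ ?_ ?_ ?_ ?_).mono le_rfl ?_
  · exact ⟨Frame.refl _ _, fun p r _ h => by omega⟩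
  · rintro i j ρ v ⟨hF, hI⟩
    exact ⟨hF.set (by decide) _ _ _, by simpa [Store.set_of_ne] using hI⟩
  · rintro i j ρ v ⟨hF, hI⟩
    exact ⟨hF.set (by decide) _ _ _, by simpa [Store.set_of_ne] using hI⟩
  · rintro i j ρ ⟨hF, -⟩
    simp only [IntExpr.val]
    rw [hF 0 (by decide), hF 1 (by decide), hFξ 0 (by decide), hFξ 1 (by decide)]
    exact ⟨h0, h1⟩
  · rintro i ρ ⟨hF, hI⟩
    exact ⟨hF, fun p r hr h => hI p r hr (by omega)⟩
  · rintro i j ρ hi hj ⟨hF, hI⟩ h20 h21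
    have e0 : ρ 0 0 0 = n := by rw [hF 0 (by decide), hFξ 0 (by decide), h0]
    have e12 : ρ 12 = σ 12 := by rw [hF 12 (by decide), hFξ 12 (by decide)]
    refine Runs.of_bdd fun hbd => Runs.write (hbd _ _ _) ⟨by simpa [Store.set_of_ne] using h20,
      by simpa [Store.set_of_ne] using h21, hF.set (by decide) _ _ _, fun p r hr h => ?_⟩
    simp only [IntExpr.val, h20, h21, e0, e12, Store.set_eq_upd, upd]
    by_cases hpr : p = i ∧ r = j
    · obtain ⟨rfl, rfl⟩ := hpr
      simp
    · rw [if_neg (by omega)]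
      exact hI p r hr (by omega)
  · rintro τ ⟨hF, hI⟩
    rw [hF 9 (by decide)]
    exact ⟨h2, h3, fun p r hp hr => hI p r hr (Or.inl hp)⟩

end programs

/-! ## Input bounds and correctness of the program -/

def totalSteps (n m : ℕ) : ℕ :=
  (n * ((m * ((1 + ((n * ((m * (2 + 2) + 2) + 2) + 2) + 1)) + 2) + 2) + 2) + 2)
    + ((1 + (n * ((m * (1 + 2) + 2) + 2) + 2)) + ((n * ((m * ((1 + 1) + 2) + 2) + 2) + 2)
    + ((n * (1 + 2) + 2 + (m * (1 + 2) + 2))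
    + ((n * ((m * ((1 + (insertSteps (n + m + 1) + 1)) + 2) + 2) + 2) + 2)
    + (1 + (n * (2 + 2) + 2 + (n * ((m * (1 + 2) + 2) + 2) + 2)))))))

theorem totalSteps_mono {n m S : ℕ} (hn : n ≤ S) (hm : m ≤ S) :
    totalSteps n m ≤ totalSteps S S := by
  unfold totalSteps insertSteps growSteps traceSteps
  gcongr

/-- `g` is a polynomial function. -/
def IsPolyFun (g : ℕ → ℕ) : Prop := ∃ f : Polynomial ℕ, ∀ x, f.eval x = g x

theorem IsPolyFun.const (c : ℕ) : IsPolyFun fun _ => c := ⟨Polynomial.C c, by simp⟩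

theorem IsPolyFun.id : IsPolyFun fun x => x := ⟨Polynomial.X, by simp⟩

theorem IsPolyFun.add {g h : ℕ → ℕ} (hg : IsPolyFun g) (hh : IsPolyFun h) :
    IsPolyFun fun x => g x + h x := by
  obtain ⟨p, hp⟩ := hg
  obtain ⟨q, hq⟩ := hh
  exact ⟨p + q, by simp [hp, hq]⟩

theorem IsPolyFun.mul {g h : ℕ → ℕ} (hg : IsPolyFun g) (hh : IsPolyFun h) :
    IsPolyFun fun x => g x * h x := by
  obtain ⟨p, hp⟩ := hg
  obtain ⟨q, hq⟩ := hh
  exact ⟨p * q, by simp [hp, hq]⟩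

/-- Step counts are kept as explicit sums and products, so closure under these two operations is
enough. -/
theorem isPolyFun_cost (c : ℕ) :
    IsPolyFun fun S => c * ((4 * S + 3 + 1) * totalSteps S S) := by
  unfold totalSteps insertSteps growSteps traceSteps
  repeat' first
    | exact IsPolyFun.const _
    | exact IsPolyFun.id
    | apply IsPolyFun.add
    | apply IsPolyFun.mul

/-! ### Reading the input and bounding it by the instance size -/

theorem tableArray_apply {n m : ℕ} (f : Fin n → Fin m → ℤ) (p : Fin n) (r : Fin m) :
    tableArray f (p : ℕ) (r : ℕ) = f p r := by
  unfold tableArray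
  rw [dif_pos ⟨⟨by positivity, by simp⟩, ⟨by positivity, by simp⟩⟩]
  simp

theorem tableArray_eq_zero_or {n m : ℕ} (f : Fin n → Fin m → ℤ) (i j : ℤ) :
    tableArray f i j = 0 ∨ ∃ p r, tableArray f i j = f p r := by
  unfold tableArray
  split_ifs with h
  · exact Or.inr ⟨_, _, rfl⟩
  · exact Or.inl rfl

theorem abs_tableArray_lt {n m b : ℕ} {f : Fin n → Fin m → ℤ}
    (h : ∀ p r, bitLength (f p r) ≤ b) (i j : ℤ) : |tableArray f i j| < 2 ^ b := by
  rcases tableArray_eq_zero_or f i j with h0 | ⟨p, r, h0⟩ <;> rw [h0]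
  · simp
  · exact bitLength_le_iff.1 (h p r)

theorem tableArray_nonneg {n m : ℕ} {f : Fin n → Fin m → ℤ} (h : ∀ p r, 0 ≤ f p r) (i j : ℤ) :
    0 ≤ tableArray f i j := by
  rcases tableArray_eq_zero_or f i j with h0 | ⟨p, r, h0⟩ <;> rw [h0]
  exact h p r

theorem Nat.le_univ_sum {ι : Type*} [Fintype ι] (f : ι → ℕ) (i : ι) : f i ≤ ∑ j, f j :=
  Finset.single_le_sum (fun _ _ => Nat.zero_le _) (Finset.mem_univ i)

namespace BoxInstance

variable (I : BoxInstance)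

theorem entry_le_size (p : Fin I.n) (r : Fin I.m) :
    1 + bitLength (I.lower p r).num + bitLength ((I.lower p r).den : ℤ)
      + bitLength (I.upper p r).num + bitLength ((I.upper p r).den : ℤ) ≤ I.size := by
  have h1 := Nat.le_univ_sum (fun r => 1 + bitLength (I.lower p r).num
    + bitLength ((I.lower p r).den : ℤ)
    + bitLength (I.upper p r).num + bitLength ((I.upper p r).den : ℤ)) r
  have h2 := Nat.le_univ_sum (fun p => ∑ r, (1 + bitLength (I.lower p r).num
    + bitLength ((I.lower p r).den : ℤ)
    + bitLength (I.upper p r).num + bitLength ((I.upper p r).den : ℤ))) p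
  unfold size
  omega

theorem coverage_le_size (p : Fin I.n) : bitLength (I.constraints.coverage p) ≤ I.size := by
  have h1 := Nat.le_univ_sum (fun p => 1 + bitLength (I.constraints.coverage p)) p
  unfold size
  omega

theorem load_le_size (r : Fin I.m) : bitLength (I.constraints.load r) ≤ I.size := by
  have h1 := Nat.le_univ_sum (fun r => 1 + bitLength (I.constraints.load r)) r
  unfold size
  omega

theorem n_le_size : I.n ≤ I.size := by
  have : I.n ≤ ∑ p, (1 + bitLength (I.constraints.coverage p)) := by
    rw [Finset.sum_add_distrib]
    simp
  unfold size
  omega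

theorem m_le_size : I.m ≤ I.size := by
  have : I.m ≤ ∑ r, (1 + bitLength (I.constraints.load r)) := by
    rw [Finset.sum_add_distrib]
    simp
  unfold size
  omega

/-- The unit charged for each score cell bounds the number of insertions, and with it the number of
doublings, by the size. -/
theorem mul_le_size : I.n * I.m ≤ I.size := by
  have : I.n * I.m ≤ ∑ p, ∑ r, (1 + bitLength (I.lower p r).num
      + bitLength ((I.lower p r).den : ℤ)
      + bitLength (I.upper p r).num + bitLength ((I.upper p r).den : ℤ)) := by
    calc I.n * I.m = ∑ _p : Fin I.n, ∑ _r : Fin I.m, 1 := by simp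
      _ ≤ _ := Finset.sum_le_sum fun p _ => Finset.sum_le_sum fun r _ => by omega
  unfold size
  omega

theorem input_zero : I.input 0 = tableArray fun (_ _ : Fin 1) => (I.n : ℤ) := rfl

theorem input_one : I.input 1 = tableArray fun (_ _ : Fin 1) => (I.m : ℤ) := rfl

theorem input_two :
    I.input 2 = tableArray fun p (_ : Fin 1) => (I.constraints.coverage p : ℤ) := rfl

theorem input_three :
    I.input 3 = tableArray fun r (_ : Fin 1) => (I.constraints.load r : ℤ) := rfl

open Classical in
theorem input_four : I.input 4
    = tableArray fun p r => if (p, r) ∈ I.constraints.conflicts then 1 else 0 := rfl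

theorem input_five : I.input 5 = tableArray fun p r => (I.lower p r).num := rfl

theorem input_six : I.input 6 = tableArray fun p r => ((I.lower p r).den : ℤ) := rfl

theorem input_seven : I.input 7 = tableArray fun p r => (I.upper p r).num := rfl

theorem input_eight : I.input 8 = tableArray fun p r => ((I.upper p r).den : ℤ) := rfl

theorem input_bdd : I.input.Bdd (I.size + 1) := by
  intro a i j
  match a with
  | 0 =>
    rw [input_zero]
    exact abs_tableArray_lt (fun _ _ => by unfold size; omega) i j
  | 1 =>
    rw [input_one]
    exact abs_tableArray_lt (fun _ _ => by unfold size; omega) i j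
  | 2 =>
    rw [input_two]
    exact abs_tableArray_lt (fun p _ => (I.coverage_le_size p).trans (Nat.le_succ _)) i j
  | 3 =>
    rw [input_three]
    exact abs_tableArray_lt (fun r _ => (I.load_le_size r).trans (Nat.le_succ _)) i j
  | 4 =>
    rw [input_four]
    refine abs_tableArray_lt (fun p r => ?_) i j
    have h1 : bitLength 1 = 1 := by simp [bitLength]
    have h0 : bitLength 0 = 0 := by simp [bitLength]
    split_ifs <;> omega
  | 5 =>
    rw [input_five]
    exact abs_tableArray_lt (fun p r => by have := I.entry_le_size p r; omega) i j
  | 6 =>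
    rw [input_six]
    exact abs_tableArray_lt (fun p r => by have := I.entry_le_size p r; omega) i j
  | 7 =>
    rw [input_seven]
    exact abs_tableArray_lt (fun p r => by have := I.entry_le_size p r; omega) i j
  | 8 =>
    rw [input_eight]
    exact abs_tableArray_lt (fun p r => by have := I.entry_le_size p r; omega) i j
  | k + 9 =>
    change |(0 : ℤ)| < _
    simp

theorem input_n : I.input 0 0 0 = I.n := tableArray_apply (fun (_ _ : Fin 1) => (I.n : ℤ)) 0 0

theorem input_m : I.input 1 0 0 = I.m := tableArray_apply (fun (_ _ : Fin 1) => (I.m : ℤ)) 0 0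

theorem input_coverage (p : Fin I.n) : I.input 2 (p : ℕ) 0 = I.constraints.coverage p :=
  tableArray_apply (fun p (_ : Fin 1) => (I.constraints.coverage p : ℤ)) p 0

theorem input_load (r : Fin I.m) : I.input 3 (r : ℕ) 0 = I.constraints.load r :=
  tableArray_apply (fun r (_ : Fin 1) => (I.constraints.load r : ℤ)) r 0

theorem input_conflicts (p : Fin I.n) (r : Fin I.m) :
    I.input 4 (p : ℕ) (r : ℕ) ≤ 0 ↔ (p, r) ∉ I.constraints.conflicts := by
  classical
  have : I.input 4 (p : ℕ) (r : ℕ) = if (p, r) ∈ I.constraints.conflicts then 1 else 0 := by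
    rw [input_four, tableArray_apply]
  rw [this]
  split_ifs with h <;> simp [h]

theorem input_num (p : Fin I.n) (r : Fin I.m) : I.input 5 (p : ℕ) (r : ℕ) = (I.lower p r).num :=
  tableArray_apply (fun p r => (I.lower p r).num) p r

theorem input_den (p : Fin I.n) (r : Fin I.m) : I.input 6 (p : ℕ) (r : ℕ) = (I.lower p r).den :=
  tableArray_apply (fun p r => ((I.lower p r).den : ℤ)) p r

/-- The bit length of the lower score in cell `(q, s)` of the input. -/
noncomputable def scoreLength (q s : ℕ) : ℕ :=
  bitLength (I.input 5 q s) + bitLength (I.input 6 q s)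

theorem gridSum_scoreLength_le : gridSum I.m I.scoreLength I.n 0 ≤ I.size := by
  have : gridSum I.m I.scoreLength I.n 0
      = ∑ p : Fin I.n, ∑ r : Fin I.m, I.scoreLength p r := by
    simp [gridSum, Finset.sum_range]
  rw [this]
  have : ∑ p : Fin I.n, ∑ r : Fin I.m, I.scoreLength p r
      ≤ ∑ p, ∑ r, (1 + bitLength (I.lower p r).num + bitLength ((I.lower p r).den : ℤ)
        + bitLength (I.upper p r).num + bitLength ((I.upper p r).den : ℤ)) := by
    refine Finset.sum_le_sum fun p _ => Finset.sum_le_sum fun r _ => ?_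
    rw [scoreLength, I.input_num, I.input_den]
    omega
  unfold size
  omega

/-- The integral score of `(p, r)` with which the program works. -/
noncomputable def score (p r : ℕ) : ℤ := commonScore I.n I.m (I.input 5) (I.input 6) p r

theorem abs_num_le (q s : ℕ) : |I.input 5 q s| ≤ 2 ^ I.scoreLength q s :=
  (abs_lt_two_pow_bitLength _).le.trans (pow_le_pow_right₀ (by norm_num) (Nat.le_add_right _ _))

theorem abs_den_le (q s : ℕ) : |I.input 6 q s| ≤ 2 ^ I.scoreLength q s :=
  (abs_lt_two_pow_bitLength _).le.trans (pow_le_pow_right₀ (by norm_num) (Nat.le_add_left _ _))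

theorem abs_score_le (p r : ℕ) : |I.score p r| ≤ 2 ^ I.size := by
  unfold score commonScore
  rcases Nat.eq_zero_or_pos I.n with h | h
  · rw [h, gridProd_zero, abs_one]
    exact one_le_pow₀ (by norm_num)
  -- The bound on partial products needs a row index below `n`, so the full product is read as the
  -- end of the last row.
  · obtain ⟨k, hk⟩ : ∃ k, I.n = k + 1 := ⟨I.n - 1, by omega⟩
    have hgs := I.gridSum_scoreLength_le
    rw [hk, ← gridSum_row] at hgs
    rw [hk, ← gridProd_row]
    refine (abs_gridProd_le (n := I.n) (l := I.scoreLength) (by omega) le_rfl ?_).trans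
      (pow_le_pow_right₀ (by norm_num) hgs)
    intro q s _ _
    unfold scoreFactor
    split_ifs
    exacts [I.abs_num_le q s, I.abs_den_le q s]

/-- The constant that the program adds to all scores. -/
noncomputable def shift : ℤ := 1 + gridSum I.m (fun p r => I.score p r * I.score p r) I.n 0

theorem shift_eq : I.shift
    = 1 + ∑ p : Fin I.n, ∑ r : Fin I.m, I.score p r * I.score p r := by
  simp [shift, gridSum, Finset.sum_range]

theorem shift_pos : 0 < I.shift := by
  rw [shift_eq]
  have : 0 ≤ ∑ p : Fin I.n, ∑ r : Fin I.m, I.score p r * I.score p r :=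
    Finset.sum_nonneg fun _ _ => Finset.sum_nonneg fun _ _ => mul_self_nonneg _
  omega

theorem shift_le : I.shift ≤ 2 ^ (3 * I.size + 1) := by
  have h1 : ∑ p : Fin I.n, ∑ r : Fin I.m, I.score p r * I.score p r
      ≤ ((I.n * I.m : ℕ) : ℤ) * 2 ^ (2 * I.size) := by
    calc _ ≤ ∑ _p : Fin I.n, ∑ _r : Fin I.m, (2 : ℤ) ^ (2 * I.size) := by
          refine Finset.sum_le_sum fun p _ => Finset.sum_le_sum fun r _ => ?_
          rw [← abs_mul_abs_self, two_mul, pow_add]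
          exact mul_le_mul (I.abs_score_le _ _) (I.abs_score_le _ _) (abs_nonneg _) (by positivity)
      _ = _ := by
          simp
          ring
  have h2 : ((I.n * I.m : ℕ) : ℤ) ≤ 2 ^ I.size := by
    exact_mod_cast I.mul_le_size.trans Nat.lt_two_pow_self.le
  have h3 : ((I.n * I.m : ℕ) : ℤ) * 2 ^ (2 * I.size) ≤ 2 ^ I.size * 2 ^ (2 * I.size) :=
    mul_le_mul_of_nonneg_right h2 (by positivity)
  have h4 : (2 : ℤ) ^ I.size * 2 ^ (2 * I.size) = 2 ^ (3 * I.size) := by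
    rw [← pow_add]
    congr 1
    ring
  have h5 : (1 : ℤ) ≤ 2 ^ (3 * I.size) := one_le_pow₀ (by norm_num)
  rw [shift_eq, pow_succ]
  linarith

theorem sum_abs_score_lt_shift :
    ∑ p : Fin I.n, ∑ r : Fin I.m, |I.score p r| < I.shift := by
  rw [shift_eq]
  have : ∑ p : Fin I.n, ∑ r : Fin I.m, |I.score p r|
      ≤ ∑ p : Fin I.n, ∑ r : Fin I.m, I.score p r * I.score p r := by
    refine Finset.sum_le_sum fun p _ => Finset.sum_le_sum fun r _ => ?_
    rw [← abs_mul_abs_self]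
    rcases (abs_nonneg (I.score p r)).eq_or_lt with h | h
    · rw [← h]
      norm_num
    · nlinarith
  omega

theorem abs_shifted_score_le (p r : ℕ) : |I.score p r + I.shift| ≤ 2 ^ (3 * I.size + 2) := by
  have h1 := I.abs_score_le p r
  have h2 := I.shift_le
  have h3 := I.shift_pos
  have h4 : (2 : ℤ) ^ I.size ≤ 2 ^ (3 * I.size + 1) :=
    pow_le_pow_right₀ (by norm_num) (by omega)
  refine (abs_add_le _ _).trans ?_
  rw [abs_of_pos h3, pow_succ]
  linarith

/-- The common denominator of the lower scores. -/
noncomputable def denominator : ℤ :=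
  ∏ q ∈ Finset.range I.n, ∏ s ∈ Finset.range I.m, I.input 6 q s

theorem denominator_pos : 0 < I.denominator := by
  unfold denominator
  refine Finset.prod_pos fun q hq => Finset.prod_pos fun s hs => ?_
  have := I.input_den ⟨q, Finset.mem_range.1 hq⟩ ⟨s, Finset.mem_range.1 hs⟩
  simp only at this
  rw [this]
  exact_mod_cast (I.lower _ _).den_pos

end BoxInstance

/-- The common score is the product of all denominators with one factor replaced by its numerator;
cross-multiplying keeps the identity in the integers. -/
theorem commonScore_mul {n m p r : ℕ} (num den : ℤ → ℤ → ℤ) (hp : p < n) (hr : r < m) :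
    commonScore n m num den p r * den p r
      = (∏ q ∈ Finset.range n, ∏ s ∈ Finset.range m, den q s) * num p r := by
  have hmem : (p, r) ∈ Finset.range n ×ˢ Finset.range m := by simp [hp, hr]
  simp only [commonScore, gridProd, Finset.range_zero, Finset.prod_empty, mul_one]
  rw [← Finset.prod_product', ← Finset.prod_product', ← Finset.mul_prod_erase _ _ hmem,
    ← Finset.mul_prod_erase _ (fun x : ℕ × ℕ => den x.1 x.2) hmem]
  have : ∏ x ∈ (Finset.range n ×ˢ Finset.range m).erase (p, r), scoreFactor num den p r x.1 x.2
      = ∏ x ∈ (Finset.range n ×ˢ Finset.range m).erase (p, r), den x.1 x.2 := by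
    refine Finset.prod_congr rfl fun x hx => ?_
    rw [scoreFactor, if_neg]
    rintro ⟨h1, h2⟩
    exact Finset.ne_of_mem_erase hx (Prod.ext h1 h2)
  rw [this]
  simp only [scoreFactor, and_self, if_true]
  ring

namespace BoxInstance

variable (I : BoxInstance)

theorem score_eq (p : Fin I.n) (r : Fin I.m) :
    (I.score p r : ℝ) = I.denominator * ((I.lower p r : ℚ) : ℝ) := by
  have h := commonScore_mul (I.input 5) (I.input 6) p.2 r.2
  rw [I.input_num, I.input_den] at h
  have hden : ((I.lower p r).den : ℝ) ≠ 0 := by exact_mod_cast (I.lower p r).den_nz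
  rw [Rat.cast_def, mul_div_assoc', eq_div_iff hden]
  exact_mod_cast h

theorem runs : Runs (4 * I.size + 3) Prog.solveAssignment I.input (totalSteps I.n I.m)
    I.Correct := by
  -- Costs are at most `2 ^ (3 * I.size + 2)`, and `n * m ≤ I.size` doublings raise the exponent to
  -- at most `4 * I.size + 2`.
  set b := 4 * I.size + 3 with hb
  have hb0 : b ≠ 0 := by omega
  have hpow : ∀ k, k < b → (2 : ℤ) ^ k < 2 ^ b := fun k hk => pow_lt_pow_right₀ (by norm_num) hk
  have hsize : ((I.size : ℕ) : ℤ) + 1 ≤ 2 ^ I.size := by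
    exact_mod_cast Nat.succ_le_of_lt (Nat.lt_two_pow_self (n := I.size))
  have hN : ((I.n + I.m + 1 : ℕ) : ℤ) + 1 < 2 ^ b := by
    have h1 := I.n_le_size
    have h2 := I.m_le_size
    have h3 := hpow (I.size + 1) (by omega)
    rw [pow_succ] at h3
    push_cast
    omega
  have hn : (I.n : ℤ) < 2 ^ b := by push_cast at hN; omega
  have hm : (I.m : ℤ) < 2 ^ b := by push_cast at hN; omega
  have h0 := I.input_n
  have h1 := I.input_m
  have hbdd := I.input_bdd
  unfold Prog.solveAssignment totalSteps
  refine Runs.seq ((Runs.computeScores hn hm hb0 h0 h1 (fun q s _ _ => I.abs_num_le q s)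
    (fun q s _ _ => I.abs_den_le q s) (I.gridSum_scoreLength_le.trans_lt (by omega))).mono
    le_rfl ?_)
  rintro σ₁ ⟨hF₁, hs₁⟩
  have hshift : 1 + gridSum I.m (fun p r : ℕ => σ₁ 11 p r * σ₁ 11 p r) I.n 0 = I.shift := by
    rw [shift_eq]
    simp only [gridSum, Finset.range_zero, Finset.sum_empty, add_zero, Finset.sum_range]
    congr 1
    refine Finset.sum_congr rfl fun p _ => Finset.sum_congr rfl fun r _ => ?_
    rw [hs₁ p r p.2 r.2]
    rfl
  refine Runs.seq ((Runs.computeShift hn hm hb0 (by rw [hF₁ 0 (by decide), h0])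
    (by rw [hF₁ 1 (by decide), h1])
    (by rw [hshift]; exact I.shift_le.trans_lt (hpow _ (by omega)))).mono le_rfl ?_)
  rintro σ₂ ⟨hF₂, hs₂⟩
  rw [hshift] at hs₂
  have hF₂' : Frame [11, 20, 21, 22, 23, 24, 25] I.input σ₂ :=
    Frame.trans (hF₁.mono (by decide)) hF₂ (by decide)
  have e11 : ∀ p r : ℕ, p < I.n → r < I.m → σ₂ 11 p r = I.score p r := fun p r hp hr => by
    rw [hF₂ 11 (by decide)]
    exact hs₁ p r hp hr
  refine Runs.seq ((Runs.computeCosts (W := 2 ^ (3 * I.size + 2)) hn hm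
    (by rw [hF₂' 0 (by decide), h0]) (by rw [hF₂' 1 (by decide), h1])
    (fun u v => by rw [hF₂' 13 (by decide)]; rfl) (hpow _ (by omega))
    (fun p r hp hr => by rw [e11 p r hp hr, hs₂]; exact I.abs_shifted_score_le p r)).mono le_rfl ?_)
  rintro σ₃ ⟨hF₃, hanti, hhub, hcost⟩
  have hcost' : ∀ p r : ℕ, p < I.n → r < I.m → σ₃ 13 (I.n + r) p = I.score p r + I.shift :=
    fun p r hp hr => by rw [hcost p r hp hr, e11 p r hp hr, hs₂]
  have hF₃' : Frame [11, 13, 20, 21, 22, 23, 24, 25] I.input σ₃ :=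
    Frame.trans (hF₂'.mono (by decide)) hF₃ (by decide)
  refine Runs.seq ((Runs.computeCapacities hn hm (by rw [hF₃' 0 (by decide), h0])
    (by rw [hF₃' 1 (by decide), h1]) (fun u v => by rw [hF₃' 12 (by decide)]; rfl)
    (I.input 4)).mono le_rfl ?_)
  rintro σ₄ ⟨hF₄, hnet⟩
  rw [hF₃' 2 (by decide), hF₃' 3 (by decide)] at hnet
  have hF₄' : Frame [11, 12, 13, 20, 21, 22, 23, 24, 25] I.input σ₄ :=
    Frame.trans (hF₃'.mono (by decide)) hF₄ (by decide)
  have e13 := hF₄ 13 (by decide)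
  have hle : ∀ a x, I.input a x 0 ≤ 2 ^ (I.size + 1) :=
    fun a x => (le_abs_self _).trans (hbdd a x 0).le
  have hR := Residual.start (n := I.n) (m := I.m) (cov := I.input 2) (load := I.input 3)
    (conf := I.input 4) (cost := σ₄ 13) (pi := σ₄ 14)
    (fun x => by rw [input_two]; exact tableArray_nonneg (fun _ _ => by positivity) x 0)
    (fun x => by rw [input_three]; exact tableArray_nonneg (fun _ _ => by positivity) x 0)
    (by rw [e13]; exact hanti) (by rw [e13]; exact hhub)
    (fun u v => by rw [hF₄' 14 (by decide)]; rfl)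
  rw [← hnet] at hR
  -- The initial network is both the current residual and the base; only the base is kept in
  -- explicit form.
  nth_rewrite 2 [hnet] at hR
  refine Runs.seq ((Runs.insertArcs (n := I.n) (m := I.m) (W := 2 ^ (3 * I.size + 2))
    (c := 2 ^ (I.size + 1)) hb0 hN (by rw [hF₄' 0 (by decide), h0])
    (by rw [hF₄' 1 (by decide), h1]) (one_le_pow₀ (by norm_num))
    (by rw [hF₄' 2 (by decide)]; exact hle 2) (by rw [hF₄' 3 (by decide)]; exact hle 3)
    (by rw [← pow_succ']; exact hpow _ (by omega)) (by rw [e13]; exact hanti) (by positivity)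
    ?_ ?_ ?_).mono le_rfl ?_)
  · intro p r hp hr
    rw [e13, hcost' p r hp hr]
    exact (le_abs_self _).trans (I.abs_shifted_score_le p r)
  · rw [← pow_add]
    have := I.mul_le_size
    exact hpow _ (by omega)
  · rw [hF₄' 2 (by decide), hF₄' 3 (by decide), hF₄' 4 (by decide)]
    exact hR
  rintro σ₅ ⟨hF₅, hR₅⟩
  rw [hF₄' 2 (by decide), hF₄' 3 (by decide), hF₄' 4 (by decide)] at hR₅
  have f13 : σ₅ 13 = σ₃ 13 := by rw [hF₅ 13 (by decide), e13]
  refine (Runs.output hb0 hn hm (by rw [hF₅ 0 (by decide), hF₄' 0 (by decide), h0])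
    (by rw [hF₅ 1 (by decide), hF₄' 1 (by decide), h1])).mono le_rfl ?_
  rintro τ ⟨hyes, hno, hout⟩
  obtain ⟨g1, g2⟩ := hR₅.solves I.constraints (w := fun p r => I.score p r) (big := I.shift)
    (D := I.denominator) (L := I.lower.map (fun x : ℚ => (x : ℝ))) (by rw [f13]; exact hanti)
    (by rw [f13]; exact hhub) I.input_coverage I.input_load I.input_conflicts
    (fun p r => by rw [f13]; exact hcost' p r p.2 r.2) I.sum_abs_score_lt_shift I.denominator_pos
    I.score_eq
  have hiff : (∀ p : Fin I.n, σ₅ 12 (I.n + I.m) p = 0) ↔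
      ∀ p : ℕ, p < I.n → ¬ 0 < σ₅ 12 (I.n + I.m) p := by
    refine ⟨fun h p hp => by have := h ⟨p, hp⟩; simp only at this; omega, fun h p => ?_⟩
    have hp := p.2
    have h2 := h p hp
    have h3 := hR₅.nonneg (I.n + I.m) p (by constructor <;> push_cast <;> omega)
      (by constructor <;> push_cast <;> omega)
    omega
  refine ⟨fun hne => ⟨hyes (hiff.1 (g1 hne).1), ?_⟩, fun hne => hno fun h => hne (g2 (hiff.2 h))⟩
  rw [maximinAssignments_box]
  · convert (g1 hne).2 using 5 with p r
    exact hout p r p.2 r.2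
  · intro p r
    simpa using I.lower_le_upper p r

/-- Total cost is at most the program weight times the cell length times the step count; the weight
is constant and the other two are polynomial in the size. -/
theorem solvableInPolyTime : SolvableInPolyTime size input Correct := by
  obtain ⟨f, hf⟩ := isPolyFun_cost Prog.solveAssignment.weight
  refine ⟨Prog.solveAssignment, f, fun I => ?_⟩
  have hbdd : I.input.Bdd (4 * I.size + 3) := fun a i j =>
    (I.input_bdd a i j).trans_le (pow_le_pow_right₀ (by norm_num) (by omega))
  obtain ⟨t, τ, h1, h2, -, h3⟩ := I.runs hbdd
  refine ⟨t, τ, h1, h2.trans ?_, h3⟩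
  rw [hf]
  exact Nat.mul_le_mul_left _ (Nat.mul_le_mul_left _ (totalSteps_mono I.n_le_size I.m_le_size))

end BoxInstance

theorem mainTheorem7 :
    (∀ (P R : Type*) [Fintype P] [Fintype R] [DecidableEq P] [DecidableEq R]
      (K : AssignmentConstraints P R) (L U : Matrix P R ℝ), (∀ p r, L p r ≤ U p r) →
      maximinAssignments K.permissible (boxUncertainty L U)
          = argmaxOn K.permissible (fun A => USW A L) ∧
      (assignmentMatrix P R).IsTotallyUnimodular ∧
      argmaxOn K.permissible (fun A => USW A L)
          = argmaxOn K.relaxation (fun X => USW X L) ∩ Set.extremePoints ℝ K.relaxation) ∧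
    SolvableInPolyTime BoxInstance.size BoxInstance.input BoxInstance.Correct :=
  ⟨fun _ _ _ _ _ _ K L _ hLU => ⟨maximinAssignments_box K hLU,
    assignmentMatrix_isTotallyUnimodular, K.argmaxOn_permissible_eq L⟩,
    BoxInstance.solvableInPolyTime⟩
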